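/- Let $n,k\ge 1$ be integers with $k\ge 2$ or $n=1$, let $U=\mathbb C^2$, let $\mathbb P=\mathbb P^{2n+1}$ be the space of lines in $V=\mathbb C^{2n+2}$, so that $H^0(\mathbb P,\mathcal O(1))=V^*$, and write multiplication of binary forms $S^pU\otimes S^qU\to S^{p+q}U$ as a product. Consider pairs $(f,h)$ of linear maps $$f\colon (S^nU)^*\to H^0(\mathbb P,\mathcal O(1)),\qquad h\colon S^{n+2k-2}U\to H^0(\mathbb P,\mathcal O(1)).$$ Let $E^{-1}=S^{k-1}U\otimes\mathcal O(-1)$, $E^0=\big((S^{n+k-1}U)^*\oplus S^{n+k-1}U\big)\otimes\mathcal O$ with the standard symplectic form and $J\colon (E^0)^*\to E^0$ the corresponding isomorphism, and $E^1=(S^{k-1}U)^*\otimes\mathcal O(1)$. Let $A_{f,h}\colon E^0\to E^1$ be the morphism given on global sections by $$A_{f,h}(\xi,s)(a)=f\big(b\mapsto \xi(ab)\big)+h(as),\qquad a\in S^{k-1}U.$$ Then $A_{f,h}\circ J\circ A_{f,h}^*=0$. If $f$ is injective and $A_{f,h}$ is surjective at every point of $\mathbb P$, then $E=\ker(A_{f,h})/\operatorname{im}(J\circ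 A_{f,h}^*)$ is a symplectic vector bundle on $\mathbb P$; the RS-instanton bundles are exactly the bundles of this form that are instanton bundles. Let $L_f\subseteq\mathbb P$ be the common zero locus of the sections in the image of $f$. Let $(\mathrm{GL}(U)\times\mathbb C^*)\ltimes(S^{2n+2k-2}U)^*$ be the group of triples $(g,t,u)$ with product $(g_2,t_2,u_2)(g_1,t_1,u_1)=(g_2g_1,\,t_2t_1,\,u_1+u_2\circ S^{2n+2k-2}g_1)$. It acts on the pairs $(f,h)$ by $(g,t,u)\cdot(f,h)=(f',h')$, $$f'=t\,f\circ(S^ng)^*,\qquad h'(c)=t\Big(h(g^{-1}c)-f\big(b\mapsto u(b\cdot g^{-1}c)\big)\Big),$$ where $g$ also denotes the maps it induces on symmetric powers. The triple $(g,t,u)$ gives the isomorphism of monads from $(f,h)$ to $(f',h')$ with components $$t^{-1}S^{k-1}g,\qquad (\xi,s)\mapsto\big(s'\mapsto \xi(g^{-1}s')+u(s\cdot g^{-1}s'),\ gs\big),\qquad t\,(S^{k-1}g^{-1})^*,$$ and hence an isomorphism between the cohomology bundles. The triples $(\rho\,\mathrm{id}_U,\rho^{-n},0)$ with $\rho^{n+k-1}=1$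 form a normal subgroup $\mu_{n+k-1}$, which acts trivially on the pairs and on $E^0$; put $$G=\big((\mathrm{GL}(U)\times\mathbb C^*)\ltimes(S^{2n+2k-2}U)^*\big)/\mu_{n+k-1}.$$ **Proposition.** Let $(f,h)$ and $(f',h')$ be two pairs with $f,f'$ injective and $A_{f,h},A_{f',h'}$ surjective at every point of $\mathbb P$, with cohomology bundles $E$ and $E'$ (for instance, two RS-instanton bundles). Assume $L_f=L_{f'}$, and let $\varphi\colon E\to E'$ be a symplectic isomorphism. Then there is a unique element of $G$ which sends $(f,h)$ to $(f',h')$ and induces $\varphi$. -/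

import Mathlib

open MvPolynomial Module
open scoped LinearAlgebra.Projectivization

noncomputable section

namespace RS

/-! ### Binary forms: the symmetric powers of `U = ℂ²` -/

/-- `S^p U` for `U = ℂ²`, realised as the space of binary forms of degree `p`: the variables
`X 0, X 1` are the standard basis of `U`. -/
def S (p : ℕ) : Type := ↥(homogeneousSubmodule (Fin 2) ℂ p)

instance (p : ℕ) : AddCommGroup (S p) := Submodule.addCommGroup (homogeneousSubmodule (Fin 2) ℂ p)

instance (p : ℕ) : Module ℂ (S p) := Submodule.module (homogeneousSubmodule (Fin 2) ℂ p)

instance (p : ℕ) : Module.Finite ℂ (S p) :=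
  Module.Finite.iff_fg.mpr (homogeneousSubmodule_fg (σ := Fin 2) (R := ℂ) p)

/-- A binary form as a polynomial. -/
def S.poly {p : ℕ} : S p →ₗ[ℂ] MvPolynomial (Fin 2) ℂ :=
  (homogeneousSubmodule (Fin 2) ℂ p).subtype

theorem S.isHomogeneous {p : ℕ} (a : S p) : a.poly.IsHomogeneous p := a.2

theorem S.ext {p : ℕ} {a b : S p} (h : a.poly = b.poly) : a = b := Subtype.ext h

/-- The multiplication map `S^p U ⊗ S^q U → S^r U` of binary forms, for `r = p + q`. -/
def mulS {p q r : ℕ} (e : p + q = r) : S p →ₗ[ℂ] S q →ₗ[ℂ] S r :=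
  LinearMap.mk₂ ℂ
    (fun a b => ⟨a.poly * b.poly, by
      have h := a.isHomogeneous.mul b.isHomogeneous
      rw [e] at h
      exact h⟩)
    (fun a a' b => S.ext (add_mul _ _ _))
    (fun c a b => S.ext (smul_mul_assoc _ _ _))
    (fun a b b' => S.ext (mul_add _ _ _))
    (fun c a b => S.ext (mul_smul_comm _ _ _))

@[simp] theorem mulS_poly {p q r : ℕ} (e : p + q = r) (a : S p) (b : S q) :
    (mulS e a b).poly = a.poly * b.poly := rfl

/-- The algebra endomorphism of `Sym U = ℂ[X 0, X 1]` induced by a linear map `g` of `U`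
(given by its matrix in the standard basis). -/
def subst (g : Matrix (Fin 2) (Fin 2) ℂ) : MvPolynomial (Fin 2) ℂ →ₐ[ℂ] MvPolynomial (Fin 2) ℂ :=
  aeval (fun j => ∑ i, C (g i j) * X i)

theorem subst_mul (g g' : Matrix (Fin 2) (Fin 2) ℂ) :
    subst (g * g') = (subst g).comp (subst g') := by
  apply MvPolynomial.algHom_ext
  intro j
  simp only [subst, AlgHom.comp_apply, aeval_X, map_mul, algHom_C, Matrix.mul_apply,
    Fin.sum_univ_two, algebraMap_eq, map_add]
  ring

theorem subst_smul_one (c : ℂ) {p : ℕ} {a : MvPolynomial (Fin 2) ℂ} (ha : a.IsHomogeneous p) :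
    subst (c • (1 : Matrix (Fin 2) (Fin 2) ℂ)) a = c ^ p • a := by
  have h1 : subst (c • (1 : Matrix (Fin 2) (Fin 2) ℂ)) = aeval (fun j => c • X j) := by
    apply MvPolynomial.algHom_ext
    intro j
    fin_cases j <;>
      simp [subst, Fin.sum_univ_two, Matrix.one_apply, MvPolynomial.smul_eq_C_mul]
  rw [h1]
  conv_lhs => rw [a.as_sum]
  conv_rhs => rw [a.as_sum]
  rw [map_sum, Finset.smul_sum]
  refine Finset.sum_congr rfl fun d hd => ?_
  have hdeg : d.degree = p := by
    by_contra hne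
    exact (mem_support_iff.mp hd) (ha.coeff_eq_zero hne)
  rw [aeval_monomial, monomial_eq, ← hdeg]
  simp only [Finsupp.prod, smul_pow, Finset.prod_smul, Finset.prod_pow_eq_pow_sum, algebraMap_eq,
    Finsupp.degree]
  rw [mul_smul_comm]
  rfl

theorem subst_one : subst 1 = AlgHom.id ℂ _ := by
  apply MvPolynomial.algHom_ext
  intro j
  fin_cases j <;> simp [subst, Matrix.one_apply]

/-- `S^p g : S^p U → S^p U` for `g ∈ GL(U)`. -/
def symS (p : ℕ) (g : GL (Fin 2) ℂ) : S p →ₗ[ℂ] S p :=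
  (subst g.1).toLinearMap.restrict fun a ha => by
    have h := IsHomogeneous.aeval (n := 1) (show a.IsHomogeneous p from ha)
      (fun j => ∑ i, C (g.1 i j) * X i)
      (fun j => IsHomogeneous.sum _ _ _ fun i _ => isHomogeneous_C_mul_X _ _)
    rw [one_mul] at h
    exact h

@[simp] theorem symS_poly (p : ℕ) (g : GL (Fin 2) ℂ) (a : S p) :
    (symS p g a).poly = subst g.1 a.poly := rfl

@[simp] theorem symS_mul (p : ℕ) (g g' : GL (Fin 2) ℂ) (a : S p) :
    symS p (g * g') a = symS p g (symS p g' a) := by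
  apply S.ext
  simp [subst_mul]

@[simp] theorem symS_one (p : ℕ) (a : S p) : symS p 1 a = a := by
  apply S.ext
  simp [subst_one]

@[simp] theorem symS_inv_self (p : ℕ) (g : GL (Fin 2) ℂ) (a : S p) :
    symS p g⁻¹ (symS p g a) = a := by rw [← symS_mul]; simp

@[simp] theorem symS_self_inv (p : ℕ) (g : GL (Fin 2) ℂ) (a : S p) :
    symS p g (symS p g⁻¹ a) = a := by rw [← symS_mul]; simp

theorem symS_mulS {p q r : ℕ} (e : p + q = r) (g : GL (Fin 2) ℂ) (a : S p) (b : S q) :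
    symS r g (mulS e a b) = mulS e (symS p g a) (symS q g b) := by
  apply S.ext
  simp

/-- The scalar `ρ • id_U` as an element of `GL(U)`. -/
def scalarGL : ℂˣ →* GL (Fin 2) ℂ := Units.map (Matrix.scalar (Fin 2)).toMonoidHom

theorem symS_scalarGL (p : ℕ) (ρ : ℂˣ) (a : S p) :
    symS p (scalarGL ρ) a = ((ρ : ℂ) ^ p) • a := by
  apply S.ext
  have h : (scalarGL ρ).1 = (ρ : ℂ) • (1 : Matrix (Fin 2) (Fin 2) ℂ) := by
    simp [scalarGL, Matrix.smul_one_eq_diagonal]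
  rw [symS_poly, h, subst_smul_one (ρ : ℂ) a.isHomogeneous]
  rfl

theorem scalarGL_comm (ρ : ℂˣ) (g : GL (Fin 2) ℂ) : scalarGL ρ * g = g * scalarGL ρ := by
  apply Units.ext
  simpa [scalarGL] using (Matrix.scalar_commute (ρ : ℂ) (fun r => mul_comm _ r) g.1).eq

/-! ### Projective space, regular functions -/

/-- The vector space `ℂ^{2n+2}`; `H⁰(ℙ, 𝒪(1))` is its dual, where `ℙ = ℙ ℂ (V n)` is the space
of lines in it. -/
abbrev V (n : ℕ) : Type := Fin (2 * n + 2) → ℂ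

/-- Zariski open subsets of `ℙ`: complements of common zero loci of families of homogeneous
polynomials. (Whether a homogeneous polynomial vanishes at `x` may be tested on any representative
of `x`.) -/
def IsZariskiOpen {n : ℕ} (W : Set (ℙ ℂ (V n))) : Prop :=
  ∃ T : Set (MvPolynomial (Fin (2 * n + 2)) ℂ), (∀ p ∈ T, ∃ d, p.IsHomogeneous d) ∧
    W = {x | ∃ p ∈ T, eval x.rep p ≠ 0}

/-- `r` is a regular function on `W`: locally it is a quotient of homogeneous polynomials of the
same degree. (The value of such a quotient does not depend on the representative of a point.) -/
def IsRegularFun {n : ℕ} (W : Set (ℙ ℂ (V n))) (r : ℙ ℂ (V n) → ℂ) : Prop :=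
  ∀ x₀ ∈ W, ∃ (d : ℕ) (p q : MvPolynomial (Fin (2 * n + 2)) ℂ),
    p.IsHomogeneous d ∧ q.IsHomogeneous d ∧ eval x₀.rep q ≠ 0 ∧
    ∀ x ∈ W, eval x.rep q ≠ 0 → r x = eval x.rep p / eval x.rep q

/-- Regular functions with values in a (finite-dimensional) vector space `M`, i.e. sections of the
trivial bundle `M ⊗ 𝒪`: all coordinates are regular. -/
def IsRegularVec {n : ℕ} {M : Type*} [AddCommGroup M] [Module ℂ M]
    (W : Set (ℙ ℂ (V n))) (r : ℙ ℂ (V n) → M) : Prop :=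
  ∀ l : Dual ℂ M, IsRegularFun W fun x => l (r x)

/-! ### The symplectic monad of a pair `(f, h)` -/

/-- The space `RS` of pairs `(f, h)` of linear maps `f : (S^n U)^* → H⁰(ℙ, 𝒪(1))` and
`h : S^{n+2k-2} U → H⁰(ℙ, 𝒪(1))`. All exponents are written through `k - 1`, as `k ≥ 1`. -/
@[ext] structure Pair (n k : ℕ) where
  f : Dual ℂ (S n) →ₗ[ℂ] Dual ℂ (V n)
  h : S (n + 2 * (k - 1)) →ₗ[ℂ] Dual ℂ (V n)

/-- The fibre `(S^{n+k-1} U)^* ⊕ S^{n+k-1} U` of the trivial bundle `E⁰`. -/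
abbrev E0 (n k : ℕ) : Type := Dual ℂ (S (n + (k - 1))) × S (n + (k - 1))

/-- The standard symplectic form on `(S^{n+k-1} U)^* ⊕ S^{n+k-1} U`. -/
def omega (n k : ℕ) : E0 n k →ₗ[ℂ] E0 n k →ₗ[ℂ] ℂ :=
  LinearMap.mk₂ ℂ (fun z w => z.1 w.2 - w.1 z.2)
    (fun z z' w => by simp; ring) (fun c z w => by simp; ring)
    (fun z w w' => by simp; ring) (fun c z w => by simp; ring)

theorem omega_apply {n k : ℕ} (z w : E0 n k) : omega n k z w = z.1 w.2 - w.1 z.2 := rfl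

/-- The isomorphism `J : (E⁰)^* = S^{n+k-1} U ⊕ (S^{n+k-1} U)^* → E⁰`, with matrix
`(0, id; -id, 0)`. -/
def J (n k : ℕ) : Dual ℂ (E0 n k) →ₗ[ℂ] E0 n k :=
  LinearMap.prod (LinearMap.inr ℂ _ _).dualMap
    (-((evalEquiv ℂ (S (n + (k - 1)))).symm.toLinearMap ∘ₗ (LinearMap.inl ℂ _ _).dualMap))

/-- `J` is the inverse of the isomorphism `E⁰ → (E⁰)^*` given by the symplectic form. -/
theorem omega_J {n k : ℕ} (l : Dual ℂ (E0 n k)) (z : E0 n k) : omega n k (J n k l) z = l z := by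
  have hz : z = (LinearMap.inl ℂ _ _ z.1) + (LinearMap.inr ℂ _ _ z.2) := by simp
  conv_rhs => rw [hz, map_add]
  rw [omega_apply]
  simp [J, add_comm]

theorem omega_nondeg {n k : ℕ} {z w : E0 n k} (h : ∀ y, omega n k z y = omega n k w y) :
    z = w := by
  refine Prod.ext (LinearMap.ext fun s => ?_) ?_
  · simpa [omega_apply] using h (0, s)
  · rw [← sub_eq_zero, ← Module.forall_dual_apply_eq_zero_iff ℂ]
    intro ξ
    rw [map_sub, sub_eq_zero]
    simpa [omega_apply] using h (ξ, 0)

namespace Pair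

variable {n k : ℕ}

/-- `A_{f,h}` on global sections, `E⁰ → (S^{k-1} U)^* ⊗ H⁰(ℙ, 𝒪(1))`: the pair `(ξ, s)` is sent to
`a ↦ f (b ↦ ξ (a b)) + h (a s)`. -/
def A (D : Pair n k) : E0 n k →ₗ[ℂ] S (k - 1) →ₗ[ℂ] Dual ℂ (V n) :=
  LinearMap.mk₂ ℂ
    (fun z a => D.f (z.1 ∘ₗ mulS (show k - 1 + n = n + (k - 1) by omega) a) +
      D.h (mulS (show k - 1 + (n + (k - 1)) = n + 2 * (k - 1) by omega) a z.2))
    (fun z z' a => by simp [LinearMap.add_comp]; abel)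
    (fun c z a => by simp [LinearMap.smul_comp])
    (fun z a a' => by simp [LinearMap.comp_add]; abel)
    (fun c z a => by simp [LinearMap.comp_smul])

theorem A_apply (D : Pair n k) (z : E0 n k) (a : S (k - 1)) :
    D.A z a = D.f (z.1 ∘ₗ mulS (show k - 1 + n = n + (k - 1) by omega) a) +
      D.h (mulS (show k - 1 + (n + (k - 1)) = n + 2 * (k - 1) by omega) a z.2) := rfl

/-- The map `A_{f,h} : E⁰_x → E¹_x = (S^{k-1} U)^* ⊗ 𝒪(1)_x` on fibres over a point `x`; the fibre
of `𝒪(1)` at `x` is the dual of the line `x`. -/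
def Afib (D : Pair n k) (x : ℙ ℂ (V n)) :
    E0 n k →ₗ[ℂ] S (k - 1) →ₗ[ℂ] Dual ℂ x.submodule :=
  (LinearMap.compRight ℂ x.submodule.subtype.dualMap) ∘ₗ D.A

/-- The map `J ∘ A_{f,h}^* : S^{k-1} U ⊗ 𝒪(-1)_x → E⁰_x`, where `𝒪(-1)_x` is the line `x`,
as a bilinear map in `a ∈ S^{k-1} U` and `v ∈ x`. -/
def JA (D : Pair n k) : S (k - 1) →ₗ[ℂ] V n →ₗ[ℂ] E0 n k :=
  LinearMap.mk₂ ℂ (fun a v => J n k (Dual.eval ℂ (V n) v ∘ₗ D.A.flip a))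
    (fun a a' v => by simp [LinearMap.comp_add])
    (fun c a v => by simp [LinearMap.comp_smul])
    (fun a v v' => by simp [LinearMap.add_comp])
    (fun c a v => by simp [LinearMap.smul_comp])

theorem omega_JA (D : Pair n k) (a : S (k - 1)) (v : V n) (z : E0 n k) :
    omega n k (D.JA a v) z = D.A z a v := by
  simp [JA, omega_J]

/-- The fibre of `ker A_{f,h}` at `x`. -/
def kerAt (D : Pair n k) (x : ℙ ℂ (V n)) : Submodule ℂ (E0 n k) := LinearMap.ker (D.Afib x)

/-- The fibre of `im (J ∘ A_{f,h}^*)` at `x`: the span of all `J A^* (a ⊗ v)` with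
`a ∈ S^{k-1} U` and `v` in the line `x`. -/
def imAt (D : Pair n k) (x : ℙ ℂ (V n)) : Submodule ℂ (E0 n k) :=
  Submodule.map₂ D.JA ⊤ x.submodule

theorem mem_kerAt (D : Pair n k) {x : ℙ ℂ (V n)} {z : E0 n k} :
    z ∈ D.kerAt x ↔ ∀ a, ∀ v ∈ x.submodule, D.A z a v = 0 := by
  simp only [kerAt, LinearMap.mem_ker, LinearMap.ext_iff, Subtype.forall]
  rfl

theorem JA_apply_A (D : Pair n k) (a a' : S (k - 1)) (v : V n) : D.A (D.JA a v) a' v = 0 := by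
  set w := D.JA a v with hw
  have key : ∀ z, omega n k w z = D.A z a v := D.omega_JA a v
  have h1 : ∀ s, w.1 s = D.h (mulS (show k - 1 + (n + (k - 1)) = n + 2 * (k - 1) by omega) a s) v := by
    intro s
    simpa [omega_apply, A_apply] using key (0, s)
  have h2 : ∀ ξ : Dual ℂ (S (n + (k - 1))),
      - ξ w.2 = D.f (ξ ∘ₗ mulS (show k - 1 + n = n + (k - 1) by omega) a) v := by
    intro ξ
    simpa [omega_apply, A_apply] using key (ξ, 0)
  let η : Dual ℂ (S (n + (k - 1))) := Dual.eval ℂ (V n) v ∘ₗ D.h ∘ₗ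
    mulS (show k - 1 + (n + (k - 1)) = n + 2 * (k - 1) by omega) a'
  have h3 : w.1 ∘ₗ mulS (show k - 1 + n = n + (k - 1) by omega) a' =
      η ∘ₗ mulS (show k - 1 + n = n + (k - 1) by omega) a := by
    ext b
    simp only [LinearMap.comp_apply, h1, η, Dual.eval_apply]
    congr 2
    apply S.ext
    simp only [mulS_poly]
    ring
  have h4 : η w.2 = D.h (mulS (show k - 1 + (n + (k - 1)) = n + 2 * (k - 1) by omega) a' w.2) v :=
    rfl
  rw [A_apply, LinearMap.add_apply, h3, ← h2 η, h4]
  ring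

/-- The composition of the two maps of the monad vanishes. -/
theorem imAt_le_kerAt (D : Pair n k) (x : ℙ ℂ (V n)) : D.imAt x ≤ D.kerAt x := by
  rw [imAt, Submodule.map₂_le]
  intro a _ v hv
  rw [mem_kerAt]
  intro a' v' hv'
  rw [Projectivization.submodule_eq, Submodule.mem_span_singleton] at hv hv'
  obtain ⟨c, rfl⟩ := hv
  obtain ⟨c', rfl⟩ := hv'
  simp [JA_apply_A]

/-- The fibre at `x` of the cohomology bundle `E = ker A_{f,h} / im (J ∘ A_{f,h}^*)`. -/
abbrev Fibre (D : Pair n k) (x : ℙ ℂ (V n)) : Type :=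
  ↥(D.kerAt x) ⧸ (D.imAt x).submoduleOf (D.kerAt x)

/-- The class in `E_x` of an element of the kernel. -/
abbrev cls (D : Pair n k) (x : ℙ ℂ (V n)) (z : D.kerAt x) : D.Fibre x := Submodule.Quotient.mk z

theorem omega_im_ker (D : Pair n k) {x : ℙ ℂ (V n)} {w z : E0 n k} (hw : w ∈ D.imAt x)
    (hz : z ∈ D.kerAt x) : omega n k w z = 0 := by
  have h : D.imAt x ≤ LinearMap.ker ((omega n k).flip z) := by
    rw [imAt, Submodule.map₂_le]
    intro a _ v hv
    rw [LinearMap.mem_ker, LinearMap.flip_apply, omega_JA]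
    exact D.mem_kerAt.mp hz a v hv
  exact h hw

theorem omega_swap {n k : ℕ} (z w : E0 n k) : omega n k z w = - omega n k w z := by
  simp [omega_apply]

/-- The symplectic form on `E_x` induced by the standard symplectic form. -/
def form (D : Pair n k) (x : ℙ ℂ (V n)) : D.Fibre x →ₗ[ℂ] D.Fibre x →ₗ[ℂ] ℂ :=
  LinearMap.liftQ₂ _ _ ((omega n k).domRestrict₁₂ (D.kerAt x) (D.kerAt x))
    (fun w hw => LinearMap.ext fun z => D.omega_im_ker hw z.2)
    (fun w hw => LinearMap.ext fun z => (omega_swap (n := n) (k := k) z.1 w.1).trans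
      (neg_eq_zero.mpr (D.omega_im_ker hw z.2)))

/-- The regular sections over `W` of the vector bundle `E = ker A_{f,h} / im (J ∘ A_{f,h}^*)`:
those which are, Zariski locally on `W`, the class of a regular section of `ker A_{f,h} ⊆ E⁰`.
Only the values of `s` on `W` matter. -/
def IsRegularSection (D : Pair n k) (W : Set (ℙ ℂ (V n))) (s : ∀ x, D.Fibre x) : Prop :=
  ∀ x₀ ∈ W, ∃ W' ⊆ W, IsZariskiOpen W' ∧ x₀ ∈ W' ∧ ∃ r : ℙ ℂ (V n) → E0 n k,
    IsRegularVec W' r ∧ ∀ x ∈ W', ∃ hx : r x ∈ D.kerAt x, s x = D.cls x ⟨r x, hx⟩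

/-- `φ` is a morphism of vector bundles: a family of linear maps between the fibres which sends
regular local sections to regular local sections. -/
def IsBundleMorphism (D D' : Pair n k) (φ : ∀ x, D.Fibre x →ₗ[ℂ] D'.Fibre x) : Prop :=
  ∀ W, IsZariskiOpen W → ∀ s : ∀ x, D.Fibre x, D.IsRegularSection W s →
    D'.IsRegularSection W fun x => φ x (s x)

/-- A symplectic isomorphism `E → E'` of the cohomology bundles. -/
structure SymplecticIso (D D' : Pair n k) where
  toFun : ∀ x, D.Fibre x ≃ₗ[ℂ] D'.Fibre x
  regular : IsBundleMorphism D D' fun x => (toFun x).toLinearMap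
  regular_symm : IsBundleMorphism D' D fun x => (toFun x).symm.toLinearMap
  symplectic : ∀ x a b, D'.form x (toFun x a) (toFun x b) = D.form x a b

/-- The pairs `(f, h)` which define a symplectic monad and hence the bundle `E`: `f` is injective,
and `A_{f,h} : E⁰ → E¹` is a surjective morphism of vector bundles. -/
structure DefinesMonad (D : Pair n k) : Prop where
  f_injective : Function.Injective D.f
  A_surjective : ∀ x, Function.Surjective (D.Afib x)

/-- The linear subspace `L_f` of `ℙ` where all sections in the image of `f` vanish. -/
def L (D : Pair n k) : Set (ℙ ℂ (V n)) := {x | ∀ ξ, ∀ v ∈ x.submodule, D.f ξ v = 0}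

end Pair

/-! ### The group -/

/-- The underlying set of triples of the semidirect product
`(GL(U) × ℂ^*) ⋉ (S^{2n+2k-2} U)^*`. -/
@[ext] structure Triple (n k : ℕ) where
  g : GL (Fin 2) ℂ
  t : ℂˣ
  u : Dual ℂ (S (2 * n + 2 * (k - 1)))

namespace Triple

variable {n k : ℕ}

instance : Mul (Triple n k) :=
  ⟨fun x y => ⟨x.g * y.g, x.t * y.t, y.u + x.u ∘ₗ symS _ y.g⟩⟩

instance : One (Triple n k) := ⟨⟨1, 1, 0⟩⟩

instance : Inv (Triple n k) := ⟨fun x => ⟨x.g⁻¹, x.t⁻¹, -(x.u ∘ₗ symS _ x.g⁻¹)⟩⟩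

@[simp] theorem mul_g (x y : Triple n k) : (x * y).g = x.g * y.g := rfl
@[simp] theorem mul_t (x y : Triple n k) : (x * y).t = x.t * y.t := rfl
@[simp] theorem mul_u (x y : Triple n k) : (x * y).u = y.u + x.u ∘ₗ symS _ y.g := rfl
@[simp] theorem one_g : (1 : Triple n k).g = 1 := rfl
@[simp] theorem one_t : (1 : Triple n k).t = 1 := rfl
@[simp] theorem one_u : (1 : Triple n k).u = 0 := rfl
@[simp] theorem inv_g (x : Triple n k) : (x⁻¹).g = x.g⁻¹ := rfl
@[simp] theorem inv_t (x : Triple n k) : (x⁻¹).t = x.t⁻¹ := rfl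
@[simp] theorem inv_u (x : Triple n k) : (x⁻¹).u = -(x.u ∘ₗ symS _ x.g⁻¹) := rfl

/-- The semidirect product `(GL(U) × ℂ^*) ⋉ (S^{2n+2k-2} U)^*`, in which `(g, t, u)` is the product
`(g, t, 0) * (1, 1, u)`. -/
instance : Group (Triple n k) :=
  Group.ofLeftAxioms
    (fun x y z => by
      ext : 1
      · simp [mul_assoc]
      · simp [mul_assoc]
      · ext b; simp [add_assoc])
    (fun x => by
      ext : 1
      · simp
      · simp
      · ext b; simp)
    (fun x => by
      ext : 1
      · simp
      · simp
      · ext b; simp)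

/-- The linear action on pairs:
`(g, t, u) • (f, h) = (t f ∘ (S^n g)^*, t (h - (u ⊗ f) ∘ μ_*) ∘ S^{n+2k-2} g⁻¹)`, where
`(u ⊗ f) ∘ μ_*` sends `c` to `f (b ↦ u (b c))`. -/
instance : SMul (Triple n k) (Pair n k) where
  smul x D :=
    { f := (x.t : ℂ) • (D.f ∘ₗ (symS n x.g).dualMap)
      h := (x.t : ℂ) • ((D.h - D.f ∘ₗ
          (mulS (show n + (n + 2 * (k - 1)) = 2 * n + 2 * (k - 1) by omega)).flip.compr₂ x.u) ∘ₗ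
        symS _ x.g⁻¹) }

theorem smul_f_apply (x : Triple n k) (D : Pair n k) (ξ : Dual ℂ (S n)) :
    (x • D).f ξ = (x.t : ℂ) • D.f (ξ ∘ₗ symS n x.g) := rfl

theorem smul_h_apply (x : Triple n k) (D : Pair n k) (c : S (n + 2 * (k - 1))) :
    (x • D).h c = (x.t : ℂ) • (D.h (symS _ x.g⁻¹ c) - D.f (x.u ∘ₗ
      (mulS (show n + (n + 2 * (k - 1)) = 2 * n + 2 * (k - 1) by omega)).flip
        (symS _ x.g⁻¹ c))) := rfl

instance : MulAction (Triple n k) (Pair n k) where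
  one_smul D := by
    ext : 1
    · refine LinearMap.ext fun ξ => ?_
      rw [smul_f_apply]
      have : ξ ∘ₗ symS n (1 : Triple n k).g = ξ := by ext b; simp
      rw [this]; simp
    · refine LinearMap.ext fun c => ?_
      rw [smul_h_apply]
      simp
  mul_smul x y D := by
    ext : 1
    · refine LinearMap.ext fun ξ => ?_
      simp only [smul_f_apply]
      have : ξ ∘ₗ symS n (x * y).g = (ξ ∘ₗ symS n x.g) ∘ₗ symS n y.g := by ext b; simp
      rw [this, smul_smul]; simp
    · refine LinearMap.ext fun c => ?_
      simp only [smul_h_apply, smul_f_apply]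
      have e : symS _ (x * y).g⁻¹ c = symS _ y.g⁻¹ (symS _ x.g⁻¹ c) := by
        rw [← symS_mul]; simp
      rw [e]
      set c' := symS _ x.g⁻¹ c
      have e2 : (x * y).u ∘ₗ
          (mulS (show n + (n + 2 * (k - 1)) = 2 * n + 2 * (k - 1) by omega)).flip
            (symS _ y.g⁻¹ c') =
          y.u ∘ₗ (mulS (show n + (n + 2 * (k - 1)) = 2 * n + 2 * (k - 1) by omega)).flip
            (symS _ y.g⁻¹ c') +
          (x.u ∘ₗ (mulS (show n + (n + 2 * (k - 1)) = 2 * n + 2 * (k - 1) by omega)).flip c') ∘ₗ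
            symS n y.g := by
        refine LinearMap.ext fun b => ?_
        simp [symS_mulS]
      rw [e2, map_add, ← smul_sub, smul_smul, sub_sub]
      simp

/-- The middle vertical map of the isomorphism of monads given by `(g, t, u)`:
it has diagonal entries `(S^{n+k-1} g⁻¹)^*` and `S^{n+k-1} g`, and its off-diagonal entry
`S^{n+k-1} U → (S^{n+k-1} U)^*` sends `s` to `s' ↦ u (s · g⁻¹ s')`. -/
def phi0Fun (x : Triple n k) : E0 n k →ₗ[ℂ] E0 n k :=
  LinearMap.prod
    (LinearMap.coprod (symS _ x.g⁻¹).dualMap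
      ((symS _ x.g⁻¹).dualMap ∘ₗ
        (mulS (show n + (k - 1) + (n + (k - 1)) = 2 * n + 2 * (k - 1) by omega)).compr₂ x.u))
    (symS _ x.g ∘ₗ LinearMap.snd ℂ _ _)

theorem phi0Fun_fst (x : Triple n k) (z : E0 n k) (s : S (n + (k - 1))) :
    (x.phi0Fun z).1 s = z.1 (symS _ x.g⁻¹ s) +
      x.u (mulS (show n + (k - 1) + (n + (k - 1)) = 2 * n + 2 * (k - 1) by omega) z.2
        (symS _ x.g⁻¹ s)) := rfl

theorem phi0Fun_snd (x : Triple n k) (z : E0 n k) : (x.phi0Fun z).2 = symS _ x.g z.2 := rfl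

/-- The middle vertical maps define a representation of the group on `E⁰`. -/
def phi0 : Triple n k →* Module.End ℂ (E0 n k) where
  toFun := phi0Fun
  map_one' := by
    refine LinearMap.ext fun z => Prod.ext (LinearMap.ext fun s => ?_) ?_
    · rw [phi0Fun_fst]; simp
    · rw [phi0Fun_snd]; simp
  map_mul' x y := by
    refine LinearMap.ext fun z => Prod.ext (LinearMap.ext fun s => ?_) ?_
    · rw [Module.End.mul_apply]
      simp only [phi0Fun_fst, phi0Fun_snd]
      have e : symS (n + (k - 1)) (x * y).g⁻¹ s = symS _ y.g⁻¹ (symS _ x.g⁻¹ s) := by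
        rw [← symS_mul]; simp
      rw [e]
      simp [symS_mulS, add_assoc]
    · rw [Module.End.mul_apply]
      simp only [phi0Fun_snd]
      simp

/-- The middle vertical map is a symplectic automorphism of `E⁰`. -/
theorem omega_phi0 (x : Triple n k) (z w : E0 n k) :
    omega n k (phi0 x z) (phi0 x w) = omega n k z w := by
  have h : ∀ a b : S (n + (k - 1)),
      mulS (show n + (k - 1) + (n + (k - 1)) = 2 * n + 2 * (k - 1) by omega) a b =
      mulS (show n + (k - 1) + (n + (k - 1)) = 2 * n + 2 * (k - 1) by omega) b a := by
    intro a b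
    apply S.ext
    simp [mul_comm]
  rw [omega_apply, omega_apply]
  change (x.phi0Fun z).1 (x.phi0Fun w).2 - (x.phi0Fun w).1 (x.phi0Fun z).2 = _
  simp only [phi0Fun_fst, phi0Fun_snd, symS_inv_self]
  rw [h w.2 z.2]
  ring

/-- The right-hand square of the isomorphism of monads commutes: the right vertical map is
`t (S^{k-1} g⁻¹)^*`. -/
theorem A_phi0 (x : Triple n k) (D : Pair n k) (z : E0 n k) (a : S (k - 1)) :
    (x • D).A (phi0 x z) a = (x.t : ℂ) • D.A z (symS _ x.g⁻¹ a) := by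
  rw [Pair.A_apply, Pair.A_apply, smul_f_apply, smul_h_apply, ← smul_add]
  change (x.t : ℂ) • (D.f (((x.phi0Fun z).1 ∘ₗ _) ∘ₗ _) +
    (D.h (symS _ x.g⁻¹ (mulS _ a (x.phi0Fun z).2)) - D.f (x.u ∘ₗ LinearMap.flip _
      (symS _ x.g⁻¹ (mulS _ a (x.phi0Fun z).2))))) = _
  congr 1
  rw [phi0Fun_snd, symS_mulS, symS_inv_self]
  set a' := symS (k - 1) x.g⁻¹ a
  have e : ((x.phi0Fun z).1 ∘ₗ mulS (show k - 1 + n = n + (k - 1) by omega) a) ∘ₗ symS n x.g =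
      z.1 ∘ₗ mulS (show k - 1 + n = n + (k - 1) by omega) a' +
      x.u ∘ₗ (mulS (show n + (n + 2 * (k - 1)) = 2 * n + 2 * (k - 1) by omega)).flip
        (mulS (show k - 1 + (n + (k - 1)) = n + 2 * (k - 1) by omega) a' z.2) := by
    refine LinearMap.ext fun b => ?_
    simp only [LinearMap.comp_apply, phi0Fun_fst, LinearMap.add_apply, LinearMap.flip_apply,
      symS_mulS, symS_inv_self]
    congr 2
    apply S.ext
    simp only [mulS_poly, a']
    ring
  rw [e, map_add]
  abel

/-- The left-hand square of the isomorphism of monads commutes: the left vertical map is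
`t⁻¹ S^{k-1} g`. -/
theorem phi0_JA (x : Triple n k) (D : Pair n k) (a : S (k - 1)) (v : V n) :
    phi0 x (D.JA a v) = (x • D).JA ((x.t⁻¹ : ℂ) • symS _ x.g a) v := by
  apply omega_nondeg
  intro y
  have hy : y = phi0 x (phi0 x⁻¹ y) := by
    rw [← Module.End.mul_apply, ← map_mul]; simp
  rw [hy, omega_phi0, Pair.omega_JA, Pair.omega_JA, A_phi0]
  simp

/-- The subgroup of all `(ρ • id_U, ρ^{-n}, 0)` with `ρ` an `(n+k-1)`-st root of unity, as the image
of a group homomorphism. -/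
def muHom (n k : ℕ) : rootsOfUnity (n + (k - 1)) ℂ →* Triple n k where
  toFun ρ := ⟨scalarGL ρ, (ρ : ℂˣ)⁻¹ ^ n, 0⟩
  map_one' := by ext : 1 <;> simp
  map_mul' ρ σ := by
    ext : 1
    · simp
    · simp [mul_pow, mul_comm]
    · simp

theorem root_pow (ρ : rootsOfUnity (n + (k - 1)) ℂ) : ((ρ : ℂˣ) : ℂ) ^ (n + (k - 1)) = 1 := by
  have := (mem_rootsOfUnity _ _).mp ρ.2
  simpa using congrArg Units.val this

theorem symS_root (ρ : rootsOfUnity (n + (k - 1)) ℂ) (a : S (n + (k - 1))) :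
    symS _ (scalarGL ρ) a = a := by
  rw [symS_scalarGL, root_pow, one_smul]

theorem symS_root_two (ρ : rootsOfUnity (n + (k - 1)) ℂ) (a : S (2 * n + 2 * (k - 1))) :
    symS _ (scalarGL ρ) a = a := by
  have h : ((ρ : ℂˣ) : ℂ) ^ (2 * n + 2 * (k - 1)) = 1 := by
    rw [← mul_add, mul_comm, pow_mul, root_pow, one_pow]
  rw [symS_scalarGL, h, one_smul]

/-- The image of `μ_{n+k-1}` in the semidirect product. -/
def mu (n k : ℕ) : Subgroup (Triple n k) := (muHom n k).range

theorem muHom_comm (ρ : rootsOfUnity (n + (k - 1)) ℂ) (x : Triple n k) :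
    muHom n k ρ * x = x * muHom n k ρ := by
  ext : 1
  · exact scalarGL_comm _ _
  · exact mul_comm _ _
  · refine LinearMap.ext fun b => ?_
    simp [muHom, symS_root_two]

instance mu_normal : (mu n k).Normal where
  conj_mem := by
    rintro _ ⟨ρ, rfl⟩ x
    exact ⟨ρ, by rw [← muHom_comm, mul_inv_cancel_right]⟩

theorem phi0_mu (ρ : rootsOfUnity (n + (k - 1)) ℂ) : phi0 (muHom n k ρ) = 1 := by
  refine LinearMap.ext fun z => Prod.ext (LinearMap.ext fun s => ?_) ?_
  · change ((muHom n k ρ).phi0Fun z).1 s = z.1 s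
    rw [phi0Fun_fst]
    have : symS (n + (k - 1)) (muHom n k ρ).g⁻¹ s = s := by
      change symS _ (scalarGL ρ)⁻¹ s = s
      conv_lhs => rw [← symS_root ρ s]
      simp
    rw [this]
    simp [muHom]
  · change ((muHom n k ρ).phi0Fun z).2 = z.2
    rw [phi0Fun_snd]
    exact symS_root ρ z.2

theorem mu_smul (ρ : rootsOfUnity (n + (k - 1)) ℂ) (D : Pair n k) : muHom n k ρ • D = D := by
  have hρ : ((ρ : ℂˣ) : ℂ) ≠ 0 := Units.ne_zero _
  ext : 1
  · refine LinearMap.ext fun ξ => ?_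
    rw [smul_f_apply]
    have : ξ ∘ₗ symS n (muHom n k ρ).g = ((ρ : ℂˣ) : ℂ) ^ n • ξ := by
      refine LinearMap.ext fun b => ?_
      change ξ (symS n (scalarGL ρ) b) = _
      rw [symS_scalarGL]; simp
    rw [this, map_smul, smul_smul]
    simp [muHom, hρ]
  · refine LinearMap.ext fun c => ?_
    rw [smul_h_apply]
    have e : symS _ (muHom n k ρ).g⁻¹ c = (((ρ : ℂˣ) : ℂ)⁻¹) ^ (n + 2 * (k - 1)) • c := by
      change symS _ (scalarGL ρ)⁻¹ c = _
      rw [← map_inv, symS_scalarGL]; simp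
    have e2 : (((muHom n k ρ).t : ℂˣ) : ℂ) * (((ρ : ℂˣ) : ℂ)⁻¹) ^ (n + 2 * (k - 1)) = 1 := by
      have h : n + (n + 2 * (k - 1)) = (n + (k - 1)) * 2 := by omega
      simp only [muHom, MonoidHom.coe_mk, OneHom.coe_mk, Units.val_pow_eq_pow_val,
        Units.val_inv_eq_inv_val]
      rw [← pow_add, h, pow_mul, inv_pow, root_pow]
      simp
    have e3 : (muHom n k ρ).u = 0 := rfl
    rw [e, e3, map_smul, LinearMap.zero_comp, map_zero, sub_zero, smul_smul, e2, one_smul]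

end Triple

/-- The group `G = ((GL(U) × ℂ^*) ⋉ (S^{2n+2k-2} U)^*) / μ_{n+k-1}`. -/
abbrev G (n k : ℕ) : Type := Triple n k ⧸ Triple.mu n k

namespace G

variable {n k : ℕ}

/-- The action of `G` on the pairs `(f, h)`, as a homomorphism to permutations. -/
def actHom (n k : ℕ) : G n k →* Equiv.Perm (Pair n k) :=
  QuotientGroup.lift (Triple.mu n k) (MulAction.toPermHom (Triple n k) (Pair n k)) (by
    rintro _ ⟨ρ, rfl⟩
    ext1 D
    exact Triple.mu_smul ρ D)

instance : MulAction (G n k) (Pair n k) := MulAction.compHom (Pair n k) (actHom n k)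

theorem mk_smul (x : Triple n k) (D : Pair n k) : (QuotientGroup.mk x : G n k) • D = x • D := rfl

/-- The middle vertical map of the isomorphism of monads given by an element of `G`. -/
def phi0 (n k : ℕ) : G n k →* Module.End ℂ (E0 n k) :=
  QuotientGroup.lift (Triple.mu n k) Triple.phi0 (by
    rintro _ ⟨ρ, rfl⟩
    exact Triple.phi0_mu ρ)

theorem phi0_mk (x : Triple n k) : phi0 n k (QuotientGroup.mk x) = Triple.phi0 x := rfl

theorem phi0_mem_kerAt {q : G n k} {D D' : Pair n k} (h : q • D = D') (x : ℙ ℂ (V n)) :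
    ∀ z ∈ D.kerAt x, phi0 n k q z ∈ D'.kerAt x := by
  induction q using QuotientGroup.induction_on with | _ y
  subst h
  intro z hz
  rw [Pair.mem_kerAt] at hz ⊢
  intro a v hv
  rw [mk_smul, phi0_mk, Triple.A_phi0, LinearMap.smul_apply, hz _ v hv, smul_zero]

theorem phi0_mem_imAt {q : G n k} {D D' : Pair n k} (h : q • D = D') (x : ℙ ℂ (V n)) :
    D.imAt x ≤ (D'.imAt x).comap (phi0 n k q) := by
  induction q using QuotientGroup.induction_on with | _ y
  subst h
  rw [Pair.imAt, Submodule.map₂_le]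
  intro a _ v hv
  rw [Submodule.mem_comap, phi0_mk, Triple.phi0_JA]
  exact Submodule.apply_mem_map₂ _ trivial hv

/-- The map `E_x → E'_x` induced on the cohomology of the monads by an element of `G` which
sends `(f, h)` to `(f', h')`. -/
def induced {q : G n k} {D D' : Pair n k} (h : q • D = D') (x : ℙ ℂ (V n)) :
    D.Fibre x →ₗ[ℂ] D'.Fibre x :=
  Submodule.mapQ _ _ ((phi0 n k q).restrict (phi0_mem_kerAt h x))
    (fun _ hz => phi0_mem_imAt h x hz)

end G

end RS

end

set_option linter.unusedSectionVars false

namespace RS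

/-! ### Matrices of polynomials which are surjective away from the origin -/

section PolyMatrix

open Matrix

variable {σ κ ε κ' ε' : Type*} [Fintype σ] [DecidableEq σ] [Fintype κ] [DecidableEq κ]
  [Fintype ε] [DecidableEq ε] [Fintype κ'] [DecidableEq κ'] [Fintype ε'] [DecidableEq ε']

/-! The symplectic isomorphism is first lifted to a constant linear map of `E⁰`, uniquely; the lift
is then recognised as the middle map of a triple by linear algebra on binary forms.

Lifting. Let K and K' be the kernels of `A_{f,h}` and `A_{f',h'}`. Via the symplectic form of E',
the isomorphism φ becomes a regular pairing K × K' → 𝒪. The bundle (K ⊗ K')^* is resolved by the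
Koszul-type complex with terms sums of 𝒪(-2), 𝒪(-1) and 𝒪, the last one being the constant bilinear
forms on E⁰. Since H¹(𝒪(-1)) and H²(𝒪(-2)) vanish, every such pairing comes from a constant form;
since H⁰(𝒪(-1)) and H¹(𝒪(-2)) vanish, the form is unique. This needs projective dimension at least
3, hence n ≥ 1. The cohomology is replaced by matrices of polynomials. Surjectivity outside the
origin and the Nullstellensatz give right inverses up to powers of variables
(`exists_right_inverse_pow`); two variables are used to form a quotient and two more as a regular
sequence on it (`koszul_exact_mod`). The results are `exists_const_form`, `const_eq_zero_of_vanish`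
and, for the map on E¹, `exists_const_mul`. Because the image in the monad is the symplectic
orthogonal of the kernel, the constant form yields a map Φ of E⁰ that induces φ (`exists_isLift`).
It preserves the symplectic form and is unique, again because a constant form vanishing on the
kernels is zero.

Recognition. Since L_f = L_{f'}, the maps f and f' have the same range and differ by an automorphism
θ of S^n U; let ψ be the transpose of the map induced on E¹. A dimension count (`eq_zero_of_h_mulS`)
shows that Φ preserves the Lagrangian (S^{n+k-1} U)^*. There the transpose of Φ sends ab to
ψ(a)θ(b), so ψ and θ are compatible with multiplication of binary forms and, by unique
factorisation, come from one element of GL(U) up to scalars (`exists_GL_of_mulS`). The remaining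
off-diagonal block of Φ is a bilinear form with Hankel matrix, which is a functional u of the
product (`exists_dual_of_hankel`).

Uniqueness. Two elements inducing φ have the same middle map, and a triple with trivial middle map
that fixes a pair lies in μ_{n+k-1} (`mem_mu`). -/

theorem smul_matrix_eq_zero {Q a b : Type*} [CommRing Q] {y : Q} (r : ∀ x, y * x = 0 → x = 0)
    {M : Matrix a b Q} (h : y • M = 0) : M = 0 := by
  ext i j
  exact r _ (by simpa using congrFun (congrFun h i) j)

theorem transpose_mul_injective {Q l : Type*} [CommRing Q] {A : Matrix κ ε Q} {y : Q}
    {τ : Matrix ε κ Q} (h : A * τ = y • 1) (r : ∀ x, y * x = 0 → x = 0) {M : Matrix κ l Q}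
    (hM : Aᵀ * M = 0) : M = 0 := by
  apply smul_matrix_eq_zero r
  have : τᵀ * Aᵀ = y • 1 := by rw [← transpose_mul, h]; simp
  calc y • M = (τᵀ * Aᵀ) * M := by rw [this]; simp
    _ = 0 := by rw [Matrix.mul_assoc, hM, Matrix.mul_zero]

/-- Multiplying the relation on the right by τ' and by ρ' gives two expressions, for yβ and for zβ.
As Aᵀ is injective, they yield z(ατ') = y(αρ'), and regularity of the pair y, z makes ατ' divisible
by y. The quotient is γ; cancelling y gives β, and injectivity of Aᵀ gives α. -/
theorem koszul_exact {Q : Type*} [CommRing Q] {A : Matrix κ ε Q} {A' : Matrix κ' ε' Q}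
    {y z : Q} {τ : Matrix ε κ Q} {τ' ρ' : Matrix ε' κ' Q} (hy : A * τ = y • 1)
    (hy' : A' * τ' = y • 1) (hz' : A' * ρ' = z • 1) (r : ∀ x, y * x = 0 → x = 0)
    (s : ∀ p q, z * p = y * q → ∃ c, p = y * c) {α : Matrix κ ε' Q} {β : Matrix ε κ' Q}
    (h : Aᵀ * α + β * A' = 0) : ∃ γ : Matrix κ κ' Q, α = γ * A' ∧ β = -(Aᵀ * γ) := by
  have e1 : Aᵀ * (α * τ') + y • β = 0 := by
    have := congrArg (· * τ') h
    simpa [Matrix.add_mul, Matrix.mul_assoc, hy'] using this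
  have e2 : Aᵀ * (α * ρ') + z • β = 0 := by
    have := congrArg (· * ρ') h
    simpa [Matrix.add_mul, Matrix.mul_assoc, hz'] using this
  have e3 : z • (α * τ') - y • (α * ρ') = 0 := by
    apply transpose_mul_injective hy r
    rw [Matrix.mul_sub, Matrix.mul_smul, Matrix.mul_smul, eq_neg_of_add_eq_zero_left e1,
      eq_neg_of_add_eq_zero_left e2, smul_neg, smul_neg, smul_comm]
    simp
  have e4 : ∀ i j, ∃ c, (α * τ') i j = y * c := fun i j =>
    s _ ((α * ρ') i j) (by simpa [sub_eq_zero] using congrFun (congrFun e3 i) j)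
  choose γ hγ using e4
  have e5 : α * τ' = y • (Matrix.of γ) := by ext i j; simp [hγ]
  have e6 : β = -(Aᵀ * Matrix.of γ) := by
    rw [eq_neg_iff_add_eq_zero]
    apply smul_matrix_eq_zero r
    rw [e5, Matrix.mul_smul, ← smul_add, add_comm] at e1
    exact e1
  refine ⟨Matrix.of γ, ?_, e6⟩
  rw [← sub_eq_zero]
  apply transpose_mul_injective hy r
  rw [Matrix.mul_sub, ← Matrix.mul_assoc, sub_eq_add_neg, ← Matrix.neg_mul, ← e6, h]

/-- If the common zeros of the elements of `I` are contained in the origin, then `I` contains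
powers of all variables. -/
theorem exists_X_pow_mem (I : Ideal (MvPolynomial σ ℂ))
    (h : ∀ v : σ → ℂ, v ≠ 0 → ∃ q ∈ I, eval v q ≠ 0) (i : σ) : ∃ m : ℕ, X i ^ m ∈ I := by
  have : (X i : MvPolynomial σ ℂ) ∈ I.radical := by
    rw [← vanishingIdeal_zeroLocus_eq_radical (K := ℂ)]
    intro v hv
    have hv0 : v = 0 := by
      by_contra hne
      obtain ⟨q, hq, hqv⟩ := h v hne
      exact hqv (by simpa [aeval_eq_eval] using hv q hq)
    simp [hv0]
  exact this

/-- The matrix `A` of polynomials is surjective at every point outside the origin. -/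
def SurjAwayFromZero (A : Matrix κ ε (MvPolynomial σ ℂ)) : Prop :=
  ∀ v : σ → ℂ, v ≠ 0 → Function.Surjective (A.map (eval v)).mulVec

/-- The polynomials p for which p·1 factors through A form an ideal. It contains det(Aτ) for a
constant right inverse τ at any given nonzero point, so its zeros lie in the origin and the
Nullstellensatz applies. Allowing all large exponents makes it possible to use the same one for A
and A'. -/
theorem exists_right_inverse_pow {A : Matrix κ ε (MvPolynomial σ ℂ)} (hA : SurjAwayFromZero A)
    (i : σ) : ∃ m : ℕ, ∀ e, m ≤ e →
      ∃ τ : Matrix ε κ (MvPolynomial σ ℂ), A * τ = (X i ^ e : MvPolynomial σ ℂ) • 1 := by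
  let I : Ideal (MvPolynomial σ ℂ) :=
    { carrier := {p | ∃ τ : Matrix ε κ (MvPolynomial σ ℂ), A * τ = p • 1}
      zero_mem' := ⟨0, by simp⟩
      add_mem' := by
        rintro p q ⟨τ, hτ⟩ ⟨τ', hτ'⟩
        exact ⟨τ + τ', by rw [Matrix.mul_add, hτ, hτ', add_smul]⟩
      smul_mem' := by
        rintro c p ⟨τ, hτ⟩
        exact ⟨c • τ, by rw [Matrix.mul_smul, hτ, smul_smul, smul_eq_mul]⟩ }
  obtain ⟨m, hm⟩ := exists_X_pow_mem I (fun v hv => by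
    obtain ⟨τ, hτ⟩ := (Matrix.mulVec_surjective_iff_exists_right_inverse).mp (hA v hv)
    let B := A * τ.map (C : ℂ → MvPolynomial σ ℂ)
    refine ⟨B.det, ⟨τ.map C * B.adjugate, (Matrix.mul_assoc _ _ _).symm.trans B.mul_adjugate⟩, ?_⟩
    have hB : (eval v).mapMatrix B = 1 := by
      rw [← hτ]
      simp only [RingHom.mapMatrix_apply, B, Matrix.map_mul, Matrix.map_map]
      congr 1
      ext; simp
    rw [RingHom.map_det, hB]
    simp) i
  refine ⟨m, fun e he => ?_⟩
  have : X i ^ e ∈ I := I.mem_of_dvd (pow_dvd_pow _ he) hm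
  exact this

/-- Membership in a monomial ideal is tested monomial by monomial, and divisibility by a generator
free of `X j` does not see the exponent of `X j`. Thus `X j` is a nonzerodivisor modulo such an
ideal; all regular sequences below rest on this. -/
theorem mem_span_monomial_of_X_pow_mul_mem {s : Set (σ →₀ ℕ)} {j : σ} (hs : ∀ d ∈ s, d j = 0)
    {e : ℕ} {p : MvPolynomial σ ℂ}
    (h : X j ^ e * p ∈ Ideal.span ((fun d => monomial d (1 : ℂ)) '' s)) :
    p ∈ Ideal.span ((fun d => monomial d (1 : ℂ)) '' s) := by
  rw [mem_ideal_span_monomial_image] at h ⊢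
  intro d hd
  obtain ⟨c, hc, hcd⟩ := h (Finsupp.single j e + d) (by
    rw [MvPolynomial.mem_support_iff] at hd ⊢
    rwa [X_pow_eq_monomial, coeff_monomial_mul, one_mul])
  refine ⟨c, hc, fun i => ?_⟩
  by_cases hij : i = j
  · subst hij; simp [hs c hc]
  · simpa [Finsupp.single_apply, Ne.symm hij] using hcd i

theorem dvd_of_X_pow_mul_eq {i j : σ} (hij : i ≠ j) {a e : ℕ} {p q : MvPolynomial σ ℂ}
    (h : X j ^ e * p = X i ^ a * q) : X i ^ a ∣ p := by
  have key := mem_span_monomial_of_X_pow_mul_mem (s := {Finsupp.single i a}) (j := j) (e := e)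
    (p := p) (by simp [hij])
  simp only [Set.image_singleton, Ideal.mem_span_singleton, ← X_pow_eq_monomial] at key
  exact key ⟨q, h⟩

theorem map_mul_eq_smul_one {Q Q' a b : Type*} [CommRing Q] [CommRing Q'] [Fintype a] [Fintype b]
    [DecidableEq a] (f : Q →+* Q') {M : Matrix a b Q} {N : Matrix b a Q} {c : Q}
    (h : M * N = c • 1) : M.map f * N.map f = f c • 1 := by
  rw [← Matrix.map_mul, h]
  ext u v
  simp [Matrix.one_apply, apply_ite f]

theorem exists_eq_smul_add_smul {a b : Type*} {p q : MvPolynomial σ ℂ}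
    {M : Matrix a b (MvPolynomial σ ℂ)}
    (h : M.map (Ideal.Quotient.mk (Ideal.span {p, q})) = 0) :
    ∃ M₀ M₁ : Matrix a b (MvPolynomial σ ℂ), M = p • M₀ + q • M₁ := by
  have : ∀ u v, ∃ c d, c * p + d * q = M u v := fun u v => by
    rw [← Ideal.mem_span_pair, ← Ideal.Quotient.eq_zero_iff_mem]
    exact congrFun (congrFun h u) v
  choose c d hcd using this
  refine ⟨Matrix.of c, Matrix.of d, ?_⟩
  ext1 u v
  simp only [Matrix.add_apply, Matrix.smul_apply, smul_eq_mul, Matrix.of_apply]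
  rw [← hcd]; ring

theorem span_pair_eq_span_monomial (i j : σ) (a b : ℕ) :
    (Ideal.span {X i ^ a, X j ^ b} : Ideal (MvPolynomial σ ℂ)) =
      Ideal.span ((fun d => monomial d (1 : ℂ)) '' {Finsupp.single i a, Finsupp.single j b}) := by
  rw [Set.image_pair, X_pow_eq_monomial, X_pow_eq_monomial]

theorem eq_zero_of_X_pow_mul_mk {i j k : σ} (hi : i ≠ k) (hj : j ≠ k) {a b e : ℕ}
    (x : MvPolynomial σ ℂ ⧸ (Ideal.span {X i ^ a, X j ^ b} : Ideal (MvPolynomial σ ℂ)))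
    (h : Ideal.Quotient.mk _ (X k ^ e) * x = 0) : x = 0 := by
  obtain ⟨p, rfl⟩ := Ideal.Quotient.mk_surjective x
  rw [← map_mul, Ideal.Quotient.eq_zero_iff_mem, span_pair_eq_span_monomial] at h
  rw [Ideal.Quotient.eq_zero_iff_mem, span_pair_eq_span_monomial]
  exact mem_span_monomial_of_X_pow_mul_mem (by simp [hi, hj]) h

/-- The ideal stays monomial after adjoining the power of `X k`, and none of its generators involves
`X l`, so the power of `X l` can be cancelled modulo it. -/
theorem exists_eq_mul_of_X_pow_mul_mk {i j k l : σ} (hi : i ≠ l) (hj : j ≠ l) (hk : k ≠ l)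
    {a b e e' : ℕ}
    (x y : MvPolynomial σ ℂ ⧸ (Ideal.span {X i ^ a, X j ^ b} : Ideal (MvPolynomial σ ℂ)))
    (h : Ideal.Quotient.mk _ (X l ^ e') * x = Ideal.Quotient.mk _ (X k ^ e) * y) :
    ∃ c, x = Ideal.Quotient.mk _ (X k ^ e) * c := by
  obtain ⟨p, rfl⟩ := Ideal.Quotient.mk_surjective x
  obtain ⟨q, rfl⟩ := Ideal.Quotient.mk_surjective y
  rw [← map_mul, ← map_mul, Ideal.Quotient.mk_eq_mk_iff_sub_mem] at h
  have hs : Ideal.span ((fun d => monomial d (1 : ℂ)) ''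
      {Finsupp.single k e, Finsupp.single i a, Finsupp.single j b}) =
      Ideal.span {X k ^ e} ⊔ Ideal.span {X i ^ a, X j ^ b} := by
    rw [span_pair_eq_span_monomial, Set.image_insert_eq, ← Ideal.span_insert, X_pow_eq_monomial]
  have h1 : X l ^ e' * p ∈ Ideal.span {X k ^ e} ⊔ Ideal.span {X i ^ a, X j ^ b} := by
    have := Ideal.add_mem _ (Ideal.mem_sup_right (S := Ideal.span {X k ^ e}) h)
      (Ideal.mem_sup_left (Ideal.mul_mem_right q _ (Ideal.mem_span_singleton_self (X k ^ e))))
    simpa using this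
  rw [← hs] at h1
  have h2 := mem_span_monomial_of_X_pow_mul_mem (by simp [hi, hj, hk]) h1
  rw [hs, Ideal.mem_span_singleton_sup] at h2
  obtain ⟨c, d, hd, hcd⟩ := h2
  refine ⟨Ideal.Quotient.mk _ c, ?_⟩
  rw [← map_mul, Ideal.Quotient.mk_eq_mk_iff_sub_mem, ← hcd, mul_comm c, add_sub_cancel_left]
  exact hd

/-- Exactness of the Koszul type complex of `A` and `A'` modulo `(X₀ᵃ, X₁ᵇ)`. -/
theorem koszul_exact_mod {A : Matrix κ ε (MvPolynomial σ ℂ)} {A' : Matrix κ' ε' (MvPolynomial σ ℂ)}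
    (hA : SurjAwayFromZero A) (hA' : SurjAwayFromZero A') {i : Fin 4 → σ}
    (hi : Function.Injective i) (a b : ℕ) {α : Matrix κ ε' (MvPolynomial σ ℂ)}
    {β : Matrix ε κ' (MvPolynomial σ ℂ)} {P P' : Matrix ε ε' (MvPolynomial σ ℂ)}
    (h : Aᵀ * α + β * A' = (X (i 0) ^ a : MvPolynomial σ ℂ) • P
      + (X (i 1) ^ b : MvPolynomial σ ℂ) • P') :
    ∃ (α₀ α₁ : Matrix κ ε' (MvPolynomial σ ℂ)) (β₀ β₁ : Matrix ε κ' (MvPolynomial σ ℂ)),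
      Aᵀ * α + β * A' =
      (X (i 0) ^ a : MvPolynomial σ ℂ) • (Aᵀ * α₀ + β₀ * A') +
      (X (i 1) ^ b : MvPolynomial σ ℂ) • (Aᵀ * α₁ + β₁ * A') := by
  obtain ⟨m, hm⟩ := exists_right_inverse_pow hA (i 2)
  obtain ⟨m', hm'⟩ := exists_right_inverse_pow hA' (i 2)
  obtain ⟨l, hl⟩ := exists_right_inverse_pow hA' (i 3)
  obtain ⟨τ, hτ⟩ := hm (m + m') (by omega)
  obtain ⟨τ', hτ'⟩ := hm' (m + m') (by omega)
  obtain ⟨ρ', hρ'⟩ := hl l le_rfl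
  let π := Ideal.Quotient.mk (Ideal.span {X (i 0) ^ a, X (i 1) ^ b} : Ideal (MvPolynomial σ ℂ))
  have h02 : i 0 ≠ i 2 := hi.ne (by decide)
  have h12 : i 1 ≠ i 2 := hi.ne (by decide)
  have h03 : i 0 ≠ i 3 := hi.ne (by decide)
  have h13 : i 1 ≠ i 3 := hi.ne (by decide)
  have h23 : i 2 ≠ i 3 := hi.ne (by decide)
  have h0 : (A.map π)ᵀ * α.map π + β.map π * A'.map π = 0 := by
    rw [← Matrix.transpose_map, ← Matrix.map_mul, ← Matrix.map_mul,
      ← Matrix.map_add _ (map_add π), h]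
    ext u v
    simp only [Matrix.map_apply, Matrix.zero_apply]
    refine (Ideal.Quotient.eq_zero_iff_mem).mpr ?_
    simp only [Matrix.add_apply, Matrix.smul_apply, smul_eq_mul]
    exact Ideal.add_mem _ (Ideal.mul_mem_right _ _ (Ideal.subset_span (by simp)))
      (Ideal.mul_mem_right _ _ (Ideal.subset_span (by simp)))
  -- Modulo the ideal the left-hand side is zero, while powers of the third and fourth variables are
  -- still a regular sequence. After lifting γ to δ, the matrices α - δA' and β + Aᵀδ have entries
  -- in the ideal, and replacing α and β by them does not change the sum.
  obtain ⟨γ, hγ, hγ'⟩ := koszul_exact (map_mul_eq_smul_one π hτ) (map_mul_eq_smul_one π hτ')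
    (map_mul_eq_smul_one π hρ')
    (fun x hx => eq_zero_of_X_pow_mul_mk h02 h12 x hx)
    (fun x y hxy => exists_eq_mul_of_X_pow_mul_mk h03 h13 h23 x y hxy) h0
  choose δ hδ using fun u v => Ideal.Quotient.mk_surjective (γ u v)
  have hδ' : γ = (Matrix.of δ).map π := by ext u v; exact (hδ u v).symm
  obtain ⟨α₀, α₁, hα⟩ := exists_eq_smul_add_smul (M := α - Matrix.of δ * A')
    (p := X (i 0) ^ a) (q := X (i 1) ^ b) (by
      change (α - Matrix.of δ * A').map π = 0
      rw [Matrix.map_sub _ (map_sub π), Matrix.map_mul, hγ, hδ', sub_self])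
  obtain ⟨β₀, β₁, hβ⟩ := exists_eq_smul_add_smul (M := β + Aᵀ * Matrix.of δ)
    (p := X (i 0) ^ a) (q := X (i 1) ^ b) (by
      change (β + Aᵀ * Matrix.of δ).map π = 0
      rw [Matrix.map_add _ (map_add π), Matrix.map_mul, hγ', hδ', Matrix.transpose_map,
        neg_add_cancel])
  refine ⟨α₀, α₁, β₀, β₁, ?_⟩
  have : Aᵀ * α + β * A' = Aᵀ * (α - Matrix.of δ * A') + (β + Aᵀ * Matrix.of δ) * A' := by
    rw [Matrix.mul_sub, Matrix.add_mul, Matrix.mul_assoc]; abel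
  rw [this, hα, hβ]
  rw [Matrix.mul_add, Matrix.add_mul, Matrix.mul_smul, Matrix.mul_smul, Matrix.smul_mul,
    Matrix.smul_mul, smul_add, smul_add, add_add_add_comm]

end PolyMatrix


/-! ### Regular forms on the kernels are constant -/

section PolyMatrix

open Matrix

variable {σ κ ε κ' ε' : Type*} [Fintype σ] [DecidableEq σ] [Fintype κ] [DecidableEq κ]
  [Fintype ε] [DecidableEq ε] [Fintype κ'] [DecidableEq κ'] [Fintype ε'] [DecidableEq ε']

theorem matrix_eq_zero_of_dotProduct {Q a b : Type*} [CommRing Q] [Fintype a] [Fintype b]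
    [DecidableEq a] [DecidableEq b] {M : Matrix a b Q} (h : ∀ z w, z ⬝ᵥ (M *ᵥ w) = 0) : M = 0 := by
  ext i j
  simpa using h (Pi.single i 1) (Pi.single j 1)

theorem dotProduct_koszul {Q : Type*} [CommRing Q] {A : Matrix κ ε Q} {A' : Matrix κ' ε' Q}
    {z : ε → Q} {w : ε' → Q} (hz : A *ᵥ z = 0) (hw : A' *ᵥ w = 0) (α : Matrix κ ε' Q)
    (β : Matrix ε κ' Q) : z ⬝ᵥ ((Aᵀ * α + β * A') *ᵥ w) = 0 := by
  rw [Matrix.add_mulVec, dotProduct_add, ← Matrix.mulVec_mulVec, ← Matrix.mulVec_mulVec, hw,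
    dotProduct_mulVec, vecMul_transpose, hz]
  simp

theorem map_koszul {A : Matrix κ ε (MvPolynomial σ ℂ)} {A' : Matrix κ' ε' (MvPolynomial σ ℂ)}
    (v : σ → ℂ) (α : Matrix κ ε' (MvPolynomial σ ℂ)) (β : Matrix ε κ' (MvPolynomial σ ℂ)) :
    (Aᵀ * α + β * A').map (eval v) =
      (A.map (eval v))ᵀ * α.map (eval v) + β.map (eval v) * A'.map (eval v) := by
  rw [Matrix.map_add _ (map_add _), Matrix.map_mul, Matrix.map_mul, Matrix.transpose_map]

theorem map_smul_eval {a b : Type*} (p : MvPolynomial σ ℂ) (M : Matrix a b (MvPolynomial σ ℂ))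
    (v : σ → ℂ) : (p • M).map (eval v) = eval v p • M.map (eval v) := by
  ext i j; simp

theorem polyMatrix_eq_zero {a b : Type*} {M : Matrix a b (MvPolynomial σ ℂ)}
    {p : MvPolynomial σ ℂ} (hp : p ≠ 0) (h : ∀ v, eval v p ≠ 0 → M.map (eval v) = 0) : M = 0 := by
  apply smul_matrix_eq_zero (y := p) (fun x hx => (mul_eq_zero.mp hx).resolve_left hp)
  ext1 i j
  apply MvPolynomial.funext
  intro v
  by_cases hv : eval v p = 0
  · simp [hv]
  · have := congrFun (congrFun (h v hv) i) j
    simp only [Matrix.map_apply, Matrix.zero_apply] at this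
    simp [this]

/-- A matrix of polynomials which vanishes on the kernels of `A` and `A'` at generic points. -/
theorem exists_X_pow_smul_eq {A : Matrix κ ε (MvPolynomial σ ℂ)}
    {A' : Matrix κ' ε' (MvPolynomial σ ℂ)} (hA : SurjAwayFromZero A) (hA' : SurjAwayFromZero A')
    {P : Matrix ε ε' (MvPolynomial σ ℂ)} {p : MvPolynomial σ ℂ} (hp : p ≠ 0)
    (h : ∀ v, v ≠ 0 → eval v p ≠ 0 → ∀ z w, A.map (eval v) *ᵥ z = 0 → A'.map (eval v) *ᵥ w = 0 →
      z ⬝ᵥ (P.map (eval v) *ᵥ w) = 0) (j : σ) :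
    ∃ (m : ℕ) (α : Matrix κ ε' (MvPolynomial σ ℂ)) (β : Matrix ε κ' (MvPolynomial σ ℂ)),
      (X j ^ m : MvPolynomial σ ℂ) • P = Aᵀ * α + β * A' := by
  obtain ⟨m, hm⟩ := exists_right_inverse_pow hA j
  obtain ⟨m', hm'⟩ := exists_right_inverse_pow hA' j
  obtain ⟨τ, hτ⟩ := hm (m + m') (by omega)
  obtain ⟨τ', hτ'⟩ := hm' (m + m') (by omega)
  set c : MvPolynomial σ ℂ := X j ^ (m + m') with hc
  have h1 : A * (c • (1 : Matrix ε ε (MvPolynomial σ ℂ)) - τ * A) = 0 := by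
    rw [Matrix.mul_sub, ← Matrix.mul_assoc, hτ]; simp
  have h1' : A' * (c • (1 : Matrix ε' ε' (MvPolynomial σ ℂ)) - τ' * A') = 0 := by
    rw [Matrix.mul_sub, ← Matrix.mul_assoc, hτ']; simp
  -- Since Aτ = c·1, the columns of c·1 - τA lie in the kernel of A, and likewise for A'. The
  -- product therefore vanishes at generic points, hence identically; expanding it expresses c²P in
  -- the required form.
  have h2 : (c • (1 : Matrix ε ε (MvPolynomial σ ℂ)) - τ * A)ᵀ * P *
      (c • (1 : Matrix ε' ε' (MvPolynomial σ ℂ)) - τ' * A') = 0 := by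
    generalize c • (1 : Matrix ε ε (MvPolynomial σ ℂ)) - τ * A = B at *
    generalize c • (1 : Matrix ε' ε' (MvPolynomial σ ℂ)) - τ' * A' = B' at *
    apply polyMatrix_eq_zero (p := X j * p) (mul_ne_zero (X_ne_zero j) hp)
    intro v hv
    rw [map_mul, eval_X] at hv
    have hv0 : v ≠ 0 := by
      rintro rfl
      simp at hv
    apply matrix_eq_zero_of_dotProduct
    intro z w
    rw [Matrix.map_mul, Matrix.map_mul, Matrix.transpose_map, ← Matrix.mulVec_mulVec,
      ← Matrix.mulVec_mulVec, dotProduct_mulVec, vecMul_transpose]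
    apply h v hv0 (right_ne_zero_of_mul hv)
    · rw [Matrix.mulVec_mulVec, ← Matrix.map_mul, h1]; simp
    · rw [Matrix.mulVec_mulVec, ← Matrix.map_mul, h1']; simp
  refine ⟨m + m' + (m + m'), τᵀ * P * (c • (1 : Matrix ε' ε' (MvPolynomial σ ℂ)) - τ' * A'),
    c • (P * τ'), ?_⟩
  rw [pow_add, ← hc]
  have h3 : (c • (1 : Matrix ε ε (MvPolynomial σ ℂ)) - τ * A)ᵀ = c • 1 - Aᵀ * τᵀ := by simp
  rw [h3, Matrix.sub_mul, Matrix.sub_mul, sub_eq_zero] at h2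
  rw [← Matrix.mul_assoc, ← Matrix.mul_assoc, ← h2, Matrix.mul_sub]
  simp [Matrix.mul_assoc, smul_smul]

/-- All entries of `A` are linear forms. -/
def IsLinearMatrix {a b : Type*} (A : Matrix a b (MvPolynomial σ ℂ)) : Prop :=
  ∀ (c : ℂ) (v : σ → ℂ), A.map (eval (c • v)) = c • A.map (eval v)

theorem IsLinearMatrix.map_zero {a b : Type*} {A : Matrix a b (MvPolynomial σ ℂ)}
    (h : IsLinearMatrix A) : A.map (eval (0 : σ → ℂ)) = 0 := by
  simpa using h 0 0

/-- By continuity along the line through v. This is how a polynomial that is constant on punctured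
lines through the origin is replaced by its value at the origin. -/
theorem eval_zero_eq {p : MvPolynomial σ ℂ} {v : σ → ℂ} {c : ℂ}
    (h : ∀ t : ℂ, t ≠ 0 → eval (t • v) p = c) : eval 0 p = c := by
  have hcont : Continuous fun t : ℂ => eval (t • v) p :=
    (MvPolynomial.continuous_eval p).comp (continuous_id.smul continuous_const)
  have h2 : (fun t : ℂ => eval (t • v) p) = fun _ => c :=
    Continuous.ext_on (dense_compl_singleton (0 : ℂ)) hcont continuous_const fun t ht => h t ht
  simpa using congrFun h2 0

/-- A constant bilinear form which vanishes on all kernels of `A` and `A'` is zero. -/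
theorem const_eq_zero_of_vanish {A : Matrix κ ε (MvPolynomial σ ℂ)}
    {A' : Matrix κ' ε' (MvPolynomial σ ℂ)} (hA : SurjAwayFromZero A) (hA' : SurjAwayFromZero A')
    (lA : IsLinearMatrix A) (lA' : IsLinearMatrix A') {i : Fin 4 → σ} (hi : Function.Injective i)
    {K : Matrix ε ε' ℂ}
    (h : ∀ v : σ → ℂ, v ≠ 0 → ∀ z w, A.map (eval v) *ᵥ z = 0 → A'.map (eval v) *ᵥ w = 0 →
      z ⬝ᵥ (K *ᵥ w) = 0) : K = 0 := by
  set P : Matrix ε ε' (MvPolynomial σ ℂ) := K.map MvPolynomial.C with hP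
  have hPv : ∀ v : σ → ℂ, P.map (eval v) = K := fun v => by ext; simp [hP]
  obtain ⟨m, α, β, hαβ⟩ := exists_X_pow_smul_eq hA hA' (P := P) (p := 1) one_ne_zero
    (fun v hv _ z w hz hw => by rw [hPv]; exact h v hv z w hz hw) (i 0)
  -- The first power of the second variable suffices: it gives K = N + X₁·(...) with N = Aᵀα₀ +
  -- β₀A'. At the origin N vanishes, as A and A' are linear, and so does the multiple of X₁.
  obtain ⟨α₀, α₁, β₀, β₁, h2⟩ := koszul_exact_mod hA hA' hi m 1 (α := α) (β := β) (P := P)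
    (P' := 0) (by rw [← hαβ, smul_zero, add_zero])
  rw [← hαβ] at h2
  have h3 : ∀ a b, ∃ c, (P - (Aᵀ * α₀ + β₀ * A')) a b = X (i 1) ^ 1 * c := by
    intro a b
    have h4 := congrFun (congrFun h2 a) b
    simp only [Matrix.add_apply (X (i 0) ^ m • _), Matrix.smul_apply, smul_eq_mul] at h4
    apply dvd_of_X_pow_mul_eq (i := i 1) (j := i 0) (hi.ne (by decide)) (e := m)
      (q := (Aᵀ * α₁ + β₁ * A') a b)
    rw [Matrix.sub_apply, mul_sub, h4]
    ring
  ext1 a b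
  obtain ⟨c, hc⟩ := h3 a b
  have h5 := congrArg (eval (0 : σ → ℂ)) hc
  have h6 : (Aᵀ * α₀ + β₀ * A').map (eval (0 : σ → ℂ)) = 0 := by
    rw [map_koszul, lA.map_zero, lA'.map_zero]; simp
  have h7 := congrFun (congrFun h6 a) b
  simp only [Matrix.map_apply, Matrix.zero_apply] at h7
  rw [Matrix.sub_apply, map_sub, h7] at h5
  simpa [hP] using h5

/-- A family of bilinear forms on the kernels of `A` and `A'` which is regular away from the origin
and homogeneous of degree `0` is given by a constant bilinear form. -/
theorem exists_const_form {A : Matrix κ ε (MvPolynomial σ ℂ)}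
    {A' : Matrix κ' ε' (MvPolynomial σ ℂ)} (hA : SurjAwayFromZero A) (hA' : SurjAwayFromZero A')
    (lA : IsLinearMatrix A) (lA' : IsLinearMatrix A') {i : Fin 4 → σ} (hi : Function.Injective i)
    {b : (σ → ℂ) → (ε → ℂ) → (ε' → ℂ) → ℂ} (hb : ∀ (c : ℂ) v, c ≠ 0 → v ≠ 0 → b (c • v) = b v)
    (hreg : ∀ j, ∃ (m : ℕ) (P : Matrix ε ε' (MvPolynomial σ ℂ)), ∀ v, v ≠ 0 → ∀ z w,
      A.map (eval v) *ᵥ z = 0 → A'.map (eval v) *ᵥ w = 0 →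
        v j ^ m * b v z w = z ⬝ᵥ (P.map (eval v) *ᵥ w)) :
    ∃ K : Matrix ε ε' ℂ, ∀ v, v ≠ 0 → ∀ z w,
      A.map (eval v) *ᵥ z = 0 → A'.map (eval v) *ᵥ w = 0 → b v z w = z ⬝ᵥ (K *ᵥ w) := by
  choose m P hmP using hreg
  have smul_dot : ∀ (c : ℂ) (z : ε → ℂ) (M : Matrix ε ε' ℂ) (w : ε' → ℂ),
      z ⬝ᵥ ((c • M) *ᵥ w) = c * (z ⬝ᵥ (M *ᵥ w)) := fun c z M w => by
    rw [Matrix.smul_mulVec, dotProduct_smul, smul_eq_mul]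
  -- Numerators for the denominators X₀^{m₀} and X₁^{m₁}: the difference X₁^{m₁}P₀ - X₀^{m₀}P₁
  -- vanishes on the kernels because both terms give X₀^{m₀}X₁^{m₁}b there.
  obtain ⟨M, α, β, hαβ⟩ := exists_X_pow_smul_eq hA hA'
    (P := (X (i 1) ^ m (i 1) : MvPolynomial σ ℂ) • P (i 0) -
      (X (i 0) ^ m (i 0) : MvPolynomial σ ℂ) • P (i 1)) (p := 1) one_ne_zero
    (fun v hv _ z w hz hw => by
      rw [Matrix.map_sub _ (map_sub _), map_smul_eval, map_smul_eval, Matrix.sub_mulVec,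
        dotProduct_sub, smul_dot, smul_dot, ← hmP _ v hv z w hz hw, ← hmP _ v hv z w hz hw]
      simp only [map_pow, eval_X]
      ring) (i 0)
  obtain ⟨α₀, α₁, β₀, β₁, h2⟩ := koszul_exact_mod hA hA' hi (M + m (i 0)) (m (i 1)) (α := α)
    (β := β) (P := - P (i 1)) (P' := (X (i 0) ^ M : MvPolynomial σ ℂ) • P (i 0)) (by
      rw [← hαβ, smul_sub, smul_smul, smul_smul, smul_smul, smul_neg, pow_add, sub_eq_neg_add,
        mul_comm (X (i 0) ^ M) (X (i 1) ^ m (i 1))])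
  rw [← hαβ] at h2
  -- Sorting by the two powers gives X₁^{m₁}(X₀^M P₀ - N₁) = X₀^{M+m₀}(P₁ + N₀), where N₀ and N₁
  -- vanish on the kernels. Coprimality then removes the whole denominator of b: it is given by the
  -- polynomial matrix D wherever X₀ ≠ 0.
  have h3 : ∀ a b, ∃ c, ((X (i 0) ^ M : MvPolynomial σ ℂ) • P (i 0) - (Aᵀ * α₁ + β₁ * A')) a b =
      X (i 0) ^ (M + m (i 0)) * c := by
    intro a b
    have h4 := congrFun (congrFun h2 a) b
    simp only [Matrix.add_apply (X (i 0) ^ _ • _), Matrix.smul_apply, Matrix.sub_apply,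
      smul_eq_mul] at h4
    apply dvd_of_X_pow_mul_eq (i := i 0) (j := i 1) (hi.ne (by decide)) (e := m (i 1))
      (q := P (i 1) a b + (Aᵀ * α₀ + β₀ * A') a b)
    rw [Matrix.sub_apply, Matrix.smul_apply, smul_eq_mul, mul_sub]
    linear_combination h4
  choose D hD using h3
  have hD' : (X (i 0) ^ M : MvPolynomial σ ℂ) • P (i 0) - (Aᵀ * α₁ + β₁ * A') =
      (X (i 0) ^ (M + m (i 0)) : MvPolynomial σ ℂ) • Matrix.of D := by
    ext1 a b; rw [hD]; rfl
  have h5 : ∀ v, v (i 0) ≠ 0 → ∀ z w, A.map (eval v) *ᵥ z = 0 → A'.map (eval v) *ᵥ w = 0 →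
      b v z w = z ⬝ᵥ ((Matrix.of D).map (eval v) *ᵥ w) := by
    intro v hv0 z w hz hw
    have hv : v ≠ 0 := by rintro rfl; simp at hv0
    have h6 := congrArg (fun N => z ⬝ᵥ (Matrix.map N (eval v) *ᵥ w)) hD'
    simp only [Matrix.map_sub _ (map_sub (eval v)), map_smul_eval, Matrix.sub_mulVec,
      dotProduct_sub, smul_dot, map_koszul, dotProduct_koszul hz hw, sub_zero,
      ← hmP _ v hv z w hz hw, map_pow, eval_X, ← mul_assoc, ← pow_add] at h6
    exact mul_left_cancel₀ (pow_ne_zero _ hv0) h6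
  refine ⟨(Matrix.of D).map (eval 0), ?_⟩
  -- Both b and the kernels are unchanged under scaling of v, so the form defined by D is constant
  -- along punctured lines, with value that of D(0).
  have h6 : ∀ v, v (i 0) ≠ 0 → ∀ z w, A.map (eval v) *ᵥ z = 0 → A'.map (eval v) *ᵥ w = 0 →
      b v z w = z ⬝ᵥ ((Matrix.of D).map (eval 0) *ᵥ w) := by
    intro v hv0 z w hz hw
    have hv : v ≠ 0 := by rintro rfl; simp at hv0
    let p : MvPolynomial σ ℂ := ∑ x, ∑ y, C (z x) * (D x y * C (w y))
    have hp : ∀ u, eval u p = z ⬝ᵥ ((Matrix.of D).map (eval u) *ᵥ w) := fun u => by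
      simp [p, dotProduct, Matrix.mulVec, Finset.mul_sum]
    rw [← hp]
    symm
    apply eval_zero_eq (v := v)
    intro t ht
    rw [hp, ← h5 (t • v) (by simpa [ht] using hv0) z w (by rw [lA, Matrix.smul_mulVec, hz, smul_zero])
      (by rw [lA', Matrix.smul_mulVec, hw, smul_zero]), hb t v ht hv]
  intro v hv z w hz hw
  obtain ⟨j, hj⟩ : ∃ j, v j ≠ 0 := by
    by_contra! hcon
    exact hv (funext hcon)
  set K := (Matrix.of D).map (eval (0 : σ → ℂ)) with hK
  have hKv : ∀ u : σ → ℂ, (K.map (C : ℂ → MvPolynomial σ ℂ)).map (eval u) = K :=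
    fun u => by ext; simp
  -- The identity is extended to points with X₀ = 0: the difference vanishes on the kernels where X₀
  -- ≠ 0, so a power of X_j times it is a Koszul combination, and this vanishes on the kernels at
  -- every point.
  obtain ⟨N, α', β', h7⟩ := exists_X_pow_smul_eq hA hA'
    (P := P j - (X j ^ m j : MvPolynomial σ ℂ) • K.map C) (p := X (i 0)) (X_ne_zero _)
    (fun u hu hu0 z w hz hw => by
      rw [eval_X] at hu0
      rw [Matrix.map_sub _ (map_sub _), map_smul_eval, Matrix.sub_mulVec, hKv,
        dotProduct_sub, smul_dot, ← hmP _ u hu z w hz hw, ← h6 u hu0 z w hz hw]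
      simp) j
  have h8 := congrArg (fun N => z ⬝ᵥ (Matrix.map N (eval v) *ᵥ w)) h7
  simp only [Matrix.map_sub _ (map_sub (eval v)), map_smul_eval, Matrix.sub_mulVec, hKv,
      dotProduct_sub, smul_dot, map_koszul, dotProduct_koszul hz hw,
      ← hmP _ v hv z w hz hw, map_pow, eval_X, mul_eq_zero, pow_ne_zero _ hj, false_or,
      sub_eq_zero] at h8
  exact mul_left_cancel₀ (pow_ne_zero _ hj) h8

/-- A matrix of linear forms whose kernels contain those of `A` is a constant multiple of `A`. -/
theorem exists_const_mul {A : Matrix κ ε (MvPolynomial σ ℂ)} {B : Matrix κ' ε (MvPolynomial σ ℂ)}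
    (hA : SurjAwayFromZero A) (lA : IsLinearMatrix A) (lB : IsLinearMatrix B) {i j : σ}
    (hij : i ≠ j)
    (h : ∀ v : σ → ℂ, v ≠ 0 → ∀ z, A.map (eval v) *ᵥ z = 0 → B.map (eval v) *ᵥ z = 0) :
    ∃ K : Matrix κ' κ ℂ, ∀ v : σ → ℂ, B.map (eval v) = K * A.map (eval v) := by
  have key : ∀ l, ∃ (e : ℕ) (τ : Matrix ε κ (MvPolynomial σ ℂ)), A * τ = (X l ^ e : MvPolynomial σ ℂ) • 1 ∧
      (X l ^ e : MvPolynomial σ ℂ) • B = B * τ * A := by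
    intro l
    obtain ⟨e, he⟩ := exists_right_inverse_pow hA l
    obtain ⟨τ, hτ⟩ := he e le_rfl
    refine ⟨e, τ, hτ, ?_⟩
    have h1 : A * ((X l ^ e : MvPolynomial σ ℂ) • (1 : Matrix ε ε (MvPolynomial σ ℂ)) - τ * A) = 0 := by
      rw [Matrix.mul_sub, ← Matrix.mul_assoc, hτ]; simp
    have h2 : B * ((X l ^ e : MvPolynomial σ ℂ) • (1 : Matrix ε ε (MvPolynomial σ ℂ)) - τ * A) = 0 := by
      generalize (X l ^ e : MvPolynomial σ ℂ) • (1 : Matrix ε ε (MvPolynomial σ ℂ)) - τ * A = N at *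
      apply polyMatrix_eq_zero (p := X l) (X_ne_zero l)
      intro v hv
      have hv0 : v ≠ 0 := by
        rintro rfl
        simp at hv
      apply matrix_eq_zero_of_dotProduct
      intro z w
      rw [Matrix.map_mul, ← Matrix.mulVec_mulVec, h v hv0 _ (by
        rw [Matrix.mulVec_mulVec, ← Matrix.map_mul, h1]; simp)]
      simp
    rw [Matrix.mul_sub, ← Matrix.mul_assoc, sub_eq_zero] at h2
    rw [← h2]; simp
  obtain ⟨e, τ, hτ, hτB⟩ := key i
  obtain ⟨e', τ', hτ', hτB'⟩ := key j
  -- Bτ/X_i^e and Bτ'/X_j^{e'} are the same quotient of B by A. Having denominators in two different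
  -- variables, it is a polynomial matrix D with B = DA; comparing degrees leaves only D(0).
  have h3 : (X j ^ e' : MvPolynomial σ ℂ) • (B * τ) = (X i ^ e : MvPolynomial σ ℂ) • (B * τ') := by
    have h4 : ((X j ^ e' : MvPolynomial σ ℂ) • (B * τ)) * (A * τ) =
        ((X i ^ e : MvPolynomial σ ℂ) • (B * τ')) * (A * τ) := by
      rw [← Matrix.mul_assoc, ← Matrix.mul_assoc]
      simp only [Matrix.smul_mul, ← hτB, ← hτB']
      exact smul_comm _ _ _
    rw [hτ, Matrix.mul_smul, Matrix.mul_smul, Matrix.mul_one, Matrix.mul_one, ← sub_eq_zero,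
      ← smul_sub] at h4
    rw [← sub_eq_zero]
    exact smul_matrix_eq_zero (y := (X i ^ e : MvPolynomial σ ℂ))
      (fun x hx => (mul_eq_zero.mp hx).resolve_left (pow_ne_zero _ (X_ne_zero i))) h4
  have h5 : ∀ a b, ∃ c, (B * τ) a b = X i ^ e * c := fun a b =>
    dvd_of_X_pow_mul_eq hij (e := e') (q := (B * τ') a b)
      (by simpa using congrFun (congrFun h3 a) b)
  choose D hD using h5
  have h6 : B = Matrix.of D * A := by
    have h7 : B * τ = (X i ^ e : MvPolynomial σ ℂ) • Matrix.of D := by ext1 a b; rw [hD]; rfl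
    rw [h7, Matrix.smul_mul, ← sub_eq_zero, ← smul_sub] at hτB
    rw [← sub_eq_zero]
    exact smul_matrix_eq_zero (y := (X i ^ e : MvPolynomial σ ℂ))
      (fun x hx => (mul_eq_zero.mp hx).resolve_left (pow_ne_zero _ (X_ne_zero i))) hτB
  refine ⟨(Matrix.of D).map (eval 0), fun v => ?_⟩
  ext1 a b
  let p : MvPolynomial σ ℂ := ∑ x, D a x * C (A.map (eval v) x b)
  have hp : ∀ u, eval u p = ((Matrix.of D).map (eval u) * A.map (eval v)) a b := fun u => by
    simp [p, Matrix.mul_apply]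
  rw [← hp]
  symm
  apply eval_zero_eq (v := v)
  intro t ht
  have h8 : t • B.map (eval v) = t • ((Matrix.of D).map (eval (t • v)) * A.map (eval v)) := by
    rw [← lB, ← Matrix.mul_smul, ← lA, ← Matrix.map_mul, ← h6]
  rw [hp]
  have h9 := congrFun (congrFun h8 a) b
  rw [Matrix.smul_apply, Matrix.smul_apply] at h9
  exact (smul_right_injective ℂ ht h9).symm

end PolyMatrix


/-! ### Local projections to the kernel; regular functions on the cone -/

section Local

open Matrix

variable {σ κ ε : Type*} [Fintype σ] [DecidableEq σ] [Fintype κ] [DecidableEq κ]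
  [Fintype ε] [DecidableEq ε]

theorem eval_smul_of_isHomogeneous {p : MvPolynomial σ ℂ} {d : ℕ} (hp : p.IsHomogeneous d) (c : ℂ)
    (v : σ → ℂ) : eval (c • v) p = c ^ d * eval v p := by
  rw [eval_eq', eval_eq', Finset.mul_sum]
  refine Finset.sum_congr rfl fun m hm => ?_
  have hd : ∑ i, m i = d := by
    rw [hp.degree_eq_sum_deg_support hm]
    exact (Finset.sum_subset (Finset.subset_univ _) (by simp)).symm
  simp only [Pi.smul_apply, smul_eq_mul, mul_pow, Finset.prod_mul_distrib,
    Finset.prod_pow_eq_pow_sum, hd]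
  ring

theorem isHomogeneous_det {M : Matrix κ κ (MvPolynomial σ ℂ)} (h : ∀ i j, (M i j).IsHomogeneous 1) :
    M.det.IsHomogeneous (Fintype.card κ) := by
  rw [Matrix.det_apply]
  refine IsHomogeneous.sum _ _ _ fun s _ => ?_
  have h1 := IsHomogeneous.prod Finset.univ (fun i => M (s i) i) (fun _ => 1) (fun i _ => h _ _)
  simp only [Finset.sum_const, Finset.card_univ, smul_eq_mul, mul_one] at h1
  rcases Int.units_eq_one_or (Equiv.Perm.sign s) with hs | hs
  · simpa [hs] using h1
  · simpa [hs] using h1.neg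

/-- A projection to the kernel of `A`, up to a factor which does not vanish at a given point. -/
theorem exists_local_projection {A : Matrix κ ε (MvPolynomial σ ℂ)} (hA : SurjAwayFromZero A)
    (hA1 : ∀ i j, (A i j).IsHomogeneous 1) {v₀ : σ → ℂ} (hv₀ : v₀ ≠ 0) :
    ∃ (d : ℕ) (q : MvPolynomial σ ℂ) (P : Matrix ε ε (MvPolynomial σ ℂ)),
      q.IsHomogeneous d ∧ (∀ a b, (P a b).IsHomogeneous d) ∧ eval v₀ q ≠ 0 ∧ A * P = 0 ∧
      ∀ v z, A.map (eval v) *ᵥ z = 0 → P.map (eval v) *ᵥ z = eval v q • z := by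
  obtain ⟨τ, hτ⟩ := (Matrix.mulVec_surjective_iff_exists_right_inverse).mp (hA v₀ hv₀)
  set T : Matrix ε κ (MvPolynomial σ ℂ) := τ.map C with hT
  set B : Matrix κ κ (MvPolynomial σ ℂ) := A * T with hB
  have hτe : ∀ v : σ → ℂ, T.map (eval v) = τ := fun v => by
    ext; simp [hT]
  have hB1 : ∀ i j, (B i j).IsHomogeneous 1 := fun i j => by
    rw [hB, Matrix.mul_apply]
    refine IsHomogeneous.sum _ _ _ fun l _ => ?_
    exact (hA1 i l).mul (isHomogeneous_C σ (τ l j))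
  have hq := isHomogeneous_det hB1
  -- With B = Aτ, the matrix 1 - τB⁻¹A is a projection to ker A where B is invertible; multiplying
  -- by det B clears the denominator. At the given point B is the identity.
  refine ⟨Fintype.card κ, B.det, B.det • 1 - T * (B.adjugate * A), hq, ?_, ?_, ?_, ?_⟩
  · intro a b
    rw [Matrix.sub_apply]
    apply IsHomogeneous.sub
    · by_cases hab : a = b
      · simpa [hab] using hq
      · simpa [hab] using isHomogeneous_zero σ ℂ _
    · rw [Matrix.mul_apply]
      refine IsHomogeneous.sum _ _ _ fun l _ => ?_
      -- By Cramer's rule the entries are determinants of matrices of linear forms, so they have the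
      -- same degree as det B.
      have : (B.adjugate * A) l b = (B.updateCol l (fun i => A i b)).det := by
        rw [← Matrix.cramer_apply, Matrix.cramer_eq_adjugate_mulVec]
        rfl
      rw [this]
      have h2 := (isHomogeneous_C σ (τ a l)).mul (isHomogeneous_det
        (M := B.updateCol l (fun i => A i b)) (fun i j => by
          by_cases hj : j = l
          · subst hj; simpa using hA1 i b
          · simpa [hj] using hB1 i j))
      rw [zero_add] at h2
      exact h2
  · have h3 : (eval v₀).mapMatrix B = 1 := by
      rw [RingHom.mapMatrix_apply, hB, Matrix.map_mul, hτe, hτ]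
    rw [RingHom.map_det, h3]
    simp
  · rw [Matrix.mul_sub, ← Matrix.mul_assoc, ← Matrix.mul_assoc, ← hB, Matrix.mul_adjugate]
    simp
  · intro v z hz
    rw [Matrix.map_sub _ (map_sub _), map_smul_eval, Matrix.map_mul, Matrix.map_mul,
      Matrix.sub_mulVec, ← Matrix.mulVec_mulVec, ← Matrix.mulVec_mulVec, hz]
    have h1 : (1 : Matrix ε ε (MvPolynomial σ ℂ)).map (eval v) = 1 :=
      Matrix.map_one _ (map_zero _) (map_one _)
    rw [h1]
    simp [Matrix.smul_mulVec]

/-- The polynomials `q` such that `q F` is a polynomial function outside the origin. -/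
def denomIdeal (F : (σ → ℂ) → ℂ) : Ideal (MvPolynomial σ ℂ) where
  carrier := {q | ∃ p : MvPolynomial σ ℂ, ∀ v, v ≠ 0 → eval v q * F v = eval v p}
  zero_mem' := ⟨0, by simp⟩
  add_mem' := by
    rintro q q' ⟨p, hp⟩ ⟨p', hp'⟩
    exact ⟨p + p', fun v hv => by rw [map_add, map_add, add_mul, hp v hv, hp' v hv]⟩
  smul_mem' := by
    rintro c q ⟨p, hp⟩
    exact ⟨c * p, fun v hv => by rw [smul_eq_mul, map_mul, map_mul, mul_assoc, hp v hv]⟩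

theorem mem_denomIdeal {F : (σ → ℂ) → ℂ} {q : MvPolynomial σ ℂ} :
    q ∈ denomIdeal F ↔ ∃ p : MvPolynomial σ ℂ, ∀ v, v ≠ 0 → eval v q * F v = eval v p := Iff.rfl

variable {n : ℕ}

theorem exists_rep_eq_smul {v : V n} (hv : v ≠ 0) :
    ∃ c : ℂ, c ≠ 0 ∧ (Projectivization.mk ℂ v hv).rep = c • v := by
  obtain ⟨a, ha⟩ := Projectivization.exists_smul_eq_mk_rep ℂ v hv
  exact ⟨a, a.ne_zero, ha.symm⟩

theorem IsZariskiOpen.exists_poly {W : Set (ℙ ℂ (V n))} (hW : IsZariskiOpen W) {v₀ : V n}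
    (hv₀ : v₀ ≠ 0) (h : Projectivization.mk ℂ v₀ hv₀ ∈ W) :
    ∃ q : MvPolynomial (Fin (2 * n + 2)) ℂ, eval v₀ q ≠ 0 ∧
      ∀ (v : V n) (hv : v ≠ 0), eval v q ≠ 0 → Projectivization.mk ℂ v hv ∈ W := by
  obtain ⟨T, hT, rfl⟩ := hW
  obtain ⟨q, hq, hq0⟩ := h
  obtain ⟨d, hd⟩ := hT q hq
  refine ⟨q, ?_, fun v hv hqv => ⟨q, hq, ?_⟩⟩
  · obtain ⟨c, hc, hrep⟩ := exists_rep_eq_smul hv₀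
    rw [hrep, eval_smul_of_isHomogeneous hd] at hq0
    exact right_ne_zero_of_mul hq0
  · obtain ⟨c, hc, hrep⟩ := exists_rep_eq_smul hv
    rw [hrep, eval_smul_of_isHomogeneous hd]
    exact mul_ne_zero (pow_ne_zero _ hc) hqv

open Classical in
/-- The function on the cone given by a function on projective space. -/
noncomputable def onCone (r : ℙ ℂ (V n) → ℂ) (v : V n) : ℂ :=
  if hv : v ≠ 0 then r (Projectivization.mk ℂ v hv) else 0

theorem onCone_apply (r : ℙ ℂ (V n) → ℂ) {v : V n} (hv : v ≠ 0) :
    onCone r v = r (Projectivization.mk ℂ v hv) := dif_pos hv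

theorem IsRegularFun.exists_mem_denomIdeal {W : Set (ℙ ℂ (V n))} (hW : IsZariskiOpen W)
    {r : ℙ ℂ (V n) → ℂ} (hr : IsRegularFun W r) {v₀ : V n}
    (hv₀ : v₀ ≠ 0) (h : Projectivization.mk ℂ v₀ hv₀ ∈ W) :
    ∃ q ∈ denomIdeal (onCone r), eval v₀ q ≠ 0 := by
  obtain ⟨q₀, hq₀, hW'⟩ := hW.exists_poly hv₀ h
  obtain ⟨d, p, q, hp, hq, hne, hpq⟩ := hr _ h
  obtain ⟨c, hc, hrep⟩ := exists_rep_eq_smul hv₀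
  rw [hrep, eval_smul_of_isHomogeneous hq] at hne
  -- The identity has to hold on the whole punctured cone: q₀ makes both sides vanish where
  -- membership in W is not known, and the additional factor q where the quotient p/q is not
  -- defined.
  refine ⟨q₀ * q * q, ⟨q₀ * q * p, fun v hv => ?_⟩, ?_⟩
  · by_cases h0 : eval v q₀ = 0
    · simp [h0]
    by_cases h1 : eval v q = 0
    · simp [h1]
    obtain ⟨c', hc', hrep'⟩ := exists_rep_eq_smul hv
    have h2 := hpq _ (hW' v hv h0) (by
      rw [hrep', eval_smul_of_isHomogeneous hq]
      exact mul_ne_zero (pow_ne_zero _ hc') h1)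
    rw [hrep', eval_smul_of_isHomogeneous hq, eval_smul_of_isHomogeneous hp,
      mul_div_mul_left _ _ (pow_ne_zero _ hc')] at h2
    rw [onCone_apply r hv, h2]
    simp only [map_mul]
    field_simp
  · simp [hq₀, right_ne_zero_of_mul hne]

end Local

/-! ### The map `A_{f,h}` as a matrix of linear forms -/

namespace Pair

open Matrix

variable {n k : ℕ}

/-- A basis of the space `E⁰`. -/
noncomputable def basisE (n k : ℕ) : Basis (Fin (finrank ℂ (E0 n k))) ℂ (E0 n k) :=
  finBasis ℂ (E0 n k)

/-- A basis of `S^{k-1} U`. -/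
noncomputable def basisS (k : ℕ) : Basis (Fin (finrank ℂ (S (k - 1)))) ℂ (S (k - 1)) :=
  finBasis ℂ (S (k - 1))

/-- The matrix of linear forms of the map `A_{f,h}`. -/
noncomputable def mat (D : Pair n k) : Matrix (Fin (finrank ℂ (S (k - 1))))
    (Fin (finrank ℂ (E0 n k))) (MvPolynomial (Fin (2 * n + 2)) ℂ) :=
  Matrix.of fun i a => ∑ j, C (D.A (basisE n k a) (basisS k i) (Pi.single j 1)) * X j

theorem mat_isHomogeneous (D : Pair n k) (i a) : (D.mat i a).IsHomogeneous 1 :=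
  IsHomogeneous.sum Finset.univ
    (fun j => C (D.A (basisE n k a) (basisS k i) (Pi.single j 1)) * X j) 1
    fun _ _ => isHomogeneous_C_mul_X _ _

theorem mat_map_apply (D : Pair n k) (v : V n) (i a) :
    D.mat.map (eval v) i a = D.A (basisE n k a) (basisS k i) v := by
  have hv : v = ∑ j, v j • (Pi.single j 1 : V n) := by
    ext l; simp [Finset.sum_apply, Pi.single_apply]
  conv_rhs => rw [hv]
  simp [mat, mul_comm]

theorem mat_mulVec (D : Pair n k) (v : V n) (z : E0 n k) (i) :
    (D.mat.map (eval v) *ᵥ (basisE n k).repr z) i = D.A z (basisS k i) v := by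
  conv_rhs => rw [← (basisE n k).sum_repr z]
  simp only [Matrix.mulVec, dotProduct, mat_map_apply, map_sum, map_smul, LinearMap.sum_apply,
    LinearMap.smul_apply, smul_eq_mul, mul_comm]

theorem isLinearMatrix_mat (D : Pair n k) : IsLinearMatrix D.mat := by
  intro c v
  ext i a
  rw [mat_map_apply, Matrix.smul_apply, mat_map_apply, map_smul]

theorem mem_kerAt_mk (D : Pair n k) {v : V n} (hv : v ≠ 0) {z : E0 n k} :
    z ∈ D.kerAt (Projectivization.mk ℂ v hv) ↔ ∀ a, D.A z a v = 0 := by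
  rw [mem_kerAt]
  constructor
  · intro h a
    exact h a v (by rw [Projectivization.submodule_mk]; exact Submodule.mem_span_singleton_self v)
  · intro h a w hw
    rw [Projectivization.submodule_mk, Submodule.mem_span_singleton] at hw
    obtain ⟨c, rfl⟩ := hw
    rw [map_smul, h, smul_zero]

theorem mem_kerAt_iff_mat (D : Pair n k) {v : V n} (hv : v ≠ 0) {z : E0 n k} :
    z ∈ D.kerAt (Projectivization.mk ℂ v hv) ↔
      D.mat.map (eval v) *ᵥ (basisE n k).repr z = 0 := by
  rw [mem_kerAt_mk]
  constructor
  · intro h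
    ext i
    rw [mat_mulVec, h]; rfl
  · intro h a
    rw [← (basisS k).sum_repr a]
    simp only [map_sum, map_smul, LinearMap.sum_apply, LinearMap.smul_apply]
    refine Finset.sum_eq_zero fun i _ => ?_
    rw [← mat_mulVec, h]; simp

theorem DefinesMonad.exists_A_eq {D : Pair n k} (hD : D.DefinesMonad) {v : V n} (hv : v ≠ 0)
    (l : Dual ℂ (S (k - 1))) : ∃ z, ∀ a, D.A z a v = l a := by
  obtain ⟨i, hi⟩ : ∃ i, v i ≠ 0 := by
    by_contra! hcon
    exact hv (funext hcon)
  let x := Projectivization.mk ℂ v hv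
  have hvx : v ∈ x.submodule := by
    rw [Projectivization.submodule_mk]; exact Submodule.mem_span_singleton_self v
  -- A normalised coordinate function trivialises 𝒪(1) at the point, so that surjectivity on the
  -- fibre can be read off at the vector v.
  let e : Dual ℂ x.submodule := (v i)⁻¹ • (LinearMap.proj i ∘ₗ x.submodule.subtype)
  have he : e ⟨v, hvx⟩ = 1 := by simp [e, hi]
  obtain ⟨z, hz⟩ := hD.A_surjective x (l.smulRight e)
  refine ⟨z, fun a => ?_⟩
  have h1 := LinearMap.congr_fun (LinearMap.congr_fun hz a) ⟨v, hvx⟩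
  rw [LinearMap.smulRight_apply, LinearMap.smul_apply, he, smul_eq_mul, mul_one] at h1
  exact h1

theorem DefinesMonad.surjAwayFromZero {D : Pair n k} (hD : D.DefinesMonad) :
    SurjAwayFromZero D.mat := by
  intro v hv y
  obtain ⟨z, hz⟩ := hD.exists_A_eq hv ((basisS k).constr ℂ y)
  refine ⟨(basisE n k).repr z, ?_⟩
  ext i
  rw [mat_mulVec, hz, Basis.constr_basis]

end Pair


/-! ### The pairing defined by φ comes from a constant bilinear form -/

namespace Pair

open Matrix

variable {n k : ℕ} {D D' : Pair n k}

theorem symm_mem_kerAt_iff (D : Pair n k) {v : V n} (hv : v ≠ 0)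
    (z : Fin (finrank ℂ (E0 n k)) → ℂ) :
    (basisE n k).equivFun.symm z ∈ D.kerAt (Projectivization.mk ℂ v hv) ↔
      D.mat.map (eval v) *ᵥ z = 0 := by
  rw [mem_kerAt_iff_mat, ← Basis.equivFun_apply, LinearEquiv.apply_symm_apply]

theorem sum_mem_kerAt {P : Matrix (Fin (finrank ℂ (E0 n k)))
    (Fin (finrank ℂ (E0 n k))) (MvPolynomial (Fin (2 * n + 2)) ℂ)} (hP : D.mat * P = 0) (a)
    (v : V n) (hv : v ≠ 0) :
    ∑ c, eval v (P c a) • basisE n k c ∈ D.kerAt (Projectivization.mk ℂ v hv) := by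
  have h1 : ∑ c, eval v (P c a) • basisE n k c =
      (basisE n k).equivFun.symm (P.map (eval v) *ᵥ Pi.single a 1) := by
    simp [Basis.equivFun_symm_apply]
  rw [h1, symm_mem_kerAt_iff, Matrix.mulVec_mulVec, ← Matrix.map_mul, hP,
    Matrix.map_zero _ (map_zero _), Matrix.zero_mulVec]

theorem sum_smul_sum_basisE {v : V n} {z : Fin (finrank ℂ (E0 n k)) → ℂ}
    {P : Matrix (Fin (finrank ℂ (E0 n k))) (Fin (finrank ℂ (E0 n k)))
      (MvPolynomial (Fin (2 * n + 2)) ℂ)} {q : ℂ} (h : P.map (eval v) *ᵥ z = q • z) :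
    ∑ a, z a • ∑ c, eval v (P c a) • basisE n k c = q • (basisE n k).equivFun.symm z := by
  rw [← map_smul, ← h]
  apply (basisE n k).equivFun.injective
  rw [LinearEquiv.apply_symm_apply]
  ext c
  simp [Matrix.mulVec, dotProduct, Finsupp.single_apply, mul_comm]

namespace SymplecticIso

/-- The pairing between the fibres of the kernel bundles given by `φ` and the symplectic form. -/
noncomputable def pairing (φ : SymplecticIso D D') (x : ℙ ℂ (V n)) (w : D'.kerAt x) :
    D.kerAt x →ₗ[ℂ] ℂ :=
  (D'.form x).flip (D'.cls x w) ∘ₗ (φ.toFun x).toLinearMap ∘ₗ Submodule.mkQ _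

theorem pairing_apply (φ : SymplecticIso D D') (x : ℙ ℂ (V n)) (w : D'.kerAt x) (z : D.kerAt x) :
    φ.pairing x w z = D'.form x (φ.toFun x (D.cls x z)) (D'.cls x w) := rfl

/-- Locally, the pairing with a given regular section of the kernel bundle is regular. -/
theorem exists_local_pairing (φ : SymplecticIso D D') {d : ℕ}
    {q : MvPolynomial (Fin (2 * n + 2)) ℂ}
    {p : Fin (finrank ℂ (E0 n k)) → MvPolynomial (Fin (2 * n + 2)) ℂ}
    (hq : q.IsHomogeneous d) (hp : ∀ c, (p c).IsHomogeneous d)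
    (hker : ∀ (v : V n) (hv : v ≠ 0),
      ∑ c, eval v (p c) • basisE n k c ∈ D.kerAt (Projectivization.mk ℂ v hv))
    {v₀ : V n} (hv₀ : v₀ ≠ 0) (hqv₀ : eval v₀ q ≠ 0) :
    ∃ (F : Fin (finrank ℂ (E0 n k)) → V n → ℂ) (q₀ : MvPolynomial (Fin (2 * n + 2)) ℂ),
      (∀ b, ∃ q' ∈ denomIdeal (F b), eval v₀ q' ≠ 0) ∧ eval v₀ q₀ ≠ 0 ∧
      ∀ (v : V n) (hv : v ≠ 0), eval v q₀ ≠ 0 →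
        ∀ w : D'.kerAt (Projectivization.mk ℂ v hv),
          φ.pairing _ w ⟨∑ c, eval v (p c) • basisE n k c, hker v hv⟩ =
            eval v q * ∑ b, (basisE n k).repr w b * F b v := by
  -- Dividing by q gives degree 0, hence a section of the kernel bundle over the open set where q ≠
  -- 0.
  let r : ℙ ℂ (V n) → E0 n k := fun x =>
    (eval x.rep q)⁻¹ • ∑ c, eval x.rep (p c) • basisE n k c
  have hrv : ∀ (v : V n) (hv : v ≠ 0), r (Projectivization.mk ℂ v hv) =
      (eval v q)⁻¹ • ∑ c, eval v (p c) • basisE n k c := by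
    intro v hv
    obtain ⟨c, hc, hrep⟩ := exists_rep_eq_smul hv
    simp only [r, hrep, eval_smul_of_isHomogeneous hq, eval_smul_of_isHomogeneous (hp _)]
    simp only [mul_smul, ← Finset.smul_sum]
    rw [smul_smul, mul_inv, mul_right_comm, inv_mul_cancel₀ (pow_ne_zero _ hc), one_mul]
  have hr : ∀ x, r x ∈ D.kerAt x := by
    intro x
    induction x using Projectivization.ind with | _ v hv
    rw [hrv]
    exact Submodule.smul_mem _ _ (hker v hv)
  let W : Set (ℙ ℂ (V n)) := {x | eval x.rep q ≠ 0}
  have hW : IsZariskiOpen W :=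
    ⟨{q}, fun q' hq' => ⟨d, by rw [Set.mem_singleton_iff.mp hq']; exact hq⟩, by simp [W]⟩
  have hrW : IsRegularVec W r := by
    intro l x₀ hx₀
    refine ⟨d, ∑ c, C (l (basisE n k c)) * p c, q, ?_, hq, hx₀, fun x _ _ => ?_⟩
    · exact IsHomogeneous.sum _ _ _ fun c _ => by
        simpa using (isHomogeneous_C _ (l (basisE n k c))).mul (hp c)
    · simp only [r, map_smul, map_sum, smul_eq_mul, map_mul, eval_C]
      rw [div_eq_inv_mul]
      congr 1
      exact Finset.sum_congr rfl fun c _ => mul_comm _ _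
  obtain ⟨c₀, hc₀, hrep₀⟩ := exists_rep_eq_smul hv₀
  have hx₀ : Projectivization.mk ℂ v₀ hv₀ ∈ W := by
    change eval (Projectivization.mk ℂ v₀ hv₀).rep q ≠ 0
    rw [hrep₀, eval_smul_of_isHomogeneous hq]
    exact mul_ne_zero (pow_ne_zero _ hc₀) hqv₀
  -- Regularity of φ enters here: near the point, φ sends the class of r to the class of a regular
  -- r' in E⁰, and the pairing with w becomes ω(r', w), whose coefficients are regular functions.
  obtain ⟨W', -, hW', hx₀', r', hr', hφ⟩ := φ.regular W hW (fun x => D.cls x ⟨r x, hr x⟩)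
    (fun x₀ hx₀ => ⟨W, subset_rfl, hW, hx₀, r, hrW, fun x _ => ⟨hr x, rfl⟩⟩) _ hx₀
  obtain ⟨q₁, hq₁, hq₁W⟩ := hW'.exists_poly hv₀ hx₀'
  refine ⟨fun b => onCone fun x => omega n k (r' x) (basisE n k b), q₁ * q, fun b => ?_,
    by simp [hq₁, hqv₀], fun v hv hqv w => ?_⟩
  · exact (hr' ((omega n k).flip (basisE n k b))).exists_mem_denomIdeal hW' hv₀ hx₀'
  · rw [map_mul] at hqv
    obtain ⟨hx, hφx⟩ := hφ _ (hq₁W v hv (left_ne_zero_of_mul hqv))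
    have hz : (⟨∑ c, eval v (p c) • basisE n k c, hker v hv⟩ : D.kerAt (.mk ℂ v hv)) =
        eval v q • ⟨r (.mk ℂ v hv), hr _⟩ := by
      apply Subtype.ext
      rw [Submodule.coe_smul]
      change _ = eval v q • r (.mk ℂ v hv)
      rw [hrv, smul_smul, mul_inv_cancel₀ (right_ne_zero_of_mul hqv), one_smul]
    rw [hz, map_smul, smul_eq_mul, pairing_apply]
    congr 1
    refine (congrArg (fun y => D'.form _ y (D'.cls _ w)) hφx).trans ?_
    change omega n k (r' _) w = _
    conv_lhs => rw [← (basisE n k).sum_repr w]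
    simp only [map_sum, map_smul, smul_eq_mul, onCone_apply _ hv]

open Classical in
/-- The pairing, extended by zero to all of `E⁰`. -/
noncomputable def pointPairing (φ : SymplecticIso D D') (x : ℙ ℂ (V n)) (z w : E0 n k) : ℂ :=
  if h : z ∈ D.kerAt x ∧ w ∈ D'.kerAt x then φ.pairing x ⟨w, h.2⟩ ⟨z, h.1⟩ else 0

open Classical in
/-- The pairing in coordinates, as a function on the cone. -/
noncomputable def conePairing (φ : SymplecticIso D D') (v : V n)
    (z w : Fin (finrank ℂ (E0 n k)) → ℂ) : ℂ :=
  if hv : v ≠ 0 then φ.pointPairing (Projectivization.mk ℂ v hv) ((basisE n k).equivFun.symm z)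
    ((basisE n k).equivFun.symm w) else 0

theorem conePairing_apply (φ : SymplecticIso D D') {v : V n} (hv : v ≠ 0)
    {z w : Fin (finrank ℂ (E0 n k)) → ℂ}
    (hz : (basisE n k).equivFun.symm z ∈ D.kerAt (Projectivization.mk ℂ v hv))
    (hw : (basisE n k).equivFun.symm w ∈ D'.kerAt (Projectivization.mk ℂ v hv)) :
    φ.conePairing v z w = φ.pairing (Projectivization.mk ℂ v hv) ⟨_, hw⟩ ⟨_, hz⟩ :=
  (dif_pos hv).trans (dif_pos ⟨hz, hw⟩)

theorem conePairing_smul (φ : SymplecticIso D D') {c : ℂ} {v : V n} (hc : c ≠ 0) (hv : v ≠ 0) :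
    φ.conePairing (c • v) = φ.conePairing v := by
  have hcv : c • v ≠ 0 := smul_ne_zero hc hv
  have hmk : Projectivization.mk ℂ (c • v) hcv = Projectivization.mk ℂ v hv :=
    (Projectivization.mk_eq_mk_iff' ℂ _ _ _ _).mpr ⟨c, rfl⟩
  funext z w
  rw [conePairing, conePairing, dif_pos hv, dif_pos hcv, hmk]

/-- A vector z in the kernel is q⁻¹ times a combination of the columns of the local projection, and
the pairing with each column is locally regular. A common denominator for all columns and
coordinates is taken, with further factors that vanish where these local descriptions are not
available. -/
theorem exists_conePairing_local (φ : SymplecticIso D D') (hD : D.DefinesMonad) {v₀ : V n}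
    (hv₀ : v₀ ≠ 0) :
    ∃ (q : MvPolynomial (Fin (2 * n + 2)) ℂ) (P : Matrix (Fin (finrank ℂ (E0 n k)))
      (Fin (finrank ℂ (E0 n k))) (MvPolynomial (Fin (2 * n + 2)) ℂ)), eval v₀ q ≠ 0 ∧
      ∀ v, v ≠ 0 → ∀ z w, D.mat.map (eval v) *ᵥ z = 0 → D'.mat.map (eval v) *ᵥ w = 0 →
        eval v q * φ.conePairing v z w = z ⬝ᵥ (P.map (eval v) *ᵥ w) := by
  obtain ⟨d, q, P, hq, hP, hqv₀, hAP, hPz⟩ :=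
    exists_local_projection hD.surjAwayFromZero D.mat_isHomogeneous hv₀
  choose F q₀ hF hq₀ hpair using fun a => φ.exists_local_pairing hq (fun c => hP c a)
    (sum_mem_kerAt hAP a) hv₀ hqv₀
  choose q' hq' hq'v₀ using hF
  let Q : MvPolynomial (Fin (2 * n + 2)) ℂ := ∏ a, ∏ b, q' a b
  have hQ : ∀ a b, Q ∈ denomIdeal (F a b) := fun a b =>
    Ideal.mem_of_dvd _ ((Finset.dvd_prod_of_mem (q' a) (Finset.mem_univ b)).trans
      (Finset.dvd_prod_of_mem (fun a => ∏ b, q' a b) (Finset.mem_univ a))) (hq' a b)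
  choose p hp using fun a b => mem_denomIdeal.mp (hQ a b)
  refine ⟨q * (∏ a, q₀ a) * Q, Matrix.of fun a b => q * (∏ a, q₀ a) * p a b, ?_,
    fun v hv z w hz hw => ?_⟩
  · simp only [map_mul, map_prod, Q]
    exact mul_ne_zero (mul_ne_zero hqv₀ (Finset.prod_ne_zero_iff.mpr fun a _ => hq₀ a))
      (Finset.prod_ne_zero_iff.mpr fun a _ => Finset.prod_ne_zero_iff.mpr fun b _ => hq'v₀ a b)
  · have hrhs : z ⬝ᵥ ((Matrix.of fun a b => q * (∏ a, q₀ a) * p a b).map (eval v) *ᵥ w) =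
        eval v (q * ∏ a, q₀ a) * ∑ a, ∑ b, z a * (w b * eval v (p a b)) := by
      simp only [dotProduct, Matrix.mulVec, Matrix.map_apply, Matrix.of_apply, map_mul,
        Finset.mul_sum]
      refine Finset.sum_congr rfl fun a _ => Finset.sum_congr rfl fun b _ => ?_
      ring
    rw [hrhs, map_mul _ _ Q, mul_assoc]
    by_cases h0 : eval v (q * ∏ a, q₀ a) = 0
    · rw [h0, zero_mul, zero_mul]
    congr 1
    rw [map_mul, map_prod] at h0
    have hqv := left_ne_zero_of_mul h0
    have hq₀v := Finset.prod_ne_zero_iff.mp (right_ne_zero_of_mul h0)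
    have hz' := (D.symm_mem_kerAt_iff hv z).mpr hz
    have hw' := (D'.symm_mem_kerAt_iff hv w).mpr hw
    rw [conePairing_apply φ hv hz' hw']
    have hsum : (⟨_, hz'⟩ : D.kerAt (Projectivization.mk ℂ v hv)) = (eval v q)⁻¹ •
        ∑ a, z a • ⟨∑ c, eval v (P c a) • basisE n k c, sum_mem_kerAt hAP a v hv⟩ := by
      apply Subtype.ext
      rw [Submodule.coe_smul, eq_inv_smul_iff₀ hqv, AddSubmonoidClass.coe_finsetSum]
      exact (sum_smul_sum_basisE (hPz v z hz)).symm
    have hL := congrArg (φ.pairing _ ⟨_, hw'⟩) hsum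
    rw [map_smul, map_sum] at hL
    refine (congrArg (eval v Q * ·) hL).trans ?_
    simp only [map_smul, hpair _ v hv (hq₀v _ (Finset.mem_univ _)), smul_eq_mul, ← Basis.equivFun_apply,
      LinearEquiv.apply_symm_apply]
    simp only [Finset.mul_sum, ← hp _ _ v hv]
    refine Finset.sum_congr rfl fun a _ => Finset.sum_congr rfl fun b _ => ?_
    field_simp

theorem exists_omega_eq_form (φ : SymplecticIso D D') (hn : 1 ≤ n) (hD : D.DefinesMonad)
    (hD' : D'.DefinesMonad) :
    ∃ Φ : E0 n k →ₗ[ℂ] E0 n k, ∀ x (z : D.kerAt x) (w : D'.kerAt x),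
      omega n k (Φ z) w = D'.form x (φ.toFun x (D.cls x z)) (D'.cls x w) := by
  have hi : Function.Injective (Fin.castLE (show 4 ≤ 2 * n + 2 by omega)) :=
    Fin.castLE_injective _
  obtain ⟨K, hK⟩ := exists_const_form hD.surjAwayFromZero hD'.surjAwayFromZero
    D.isLinearMatrix_mat D'.isLinearMatrix_mat hi (b := φ.conePairing)
    (fun c v hc hv => φ.conePairing_smul hc hv) (fun j => by
      -- The polynomials clearing the denominators of the pairing form an ideal. By the local
      -- statement they have no common zero outside the origin, so powers of all variables belong to
      -- it.
      let I : Ideal (MvPolynomial (Fin (2 * n + 2)) ℂ) :=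
        { carrier := {q | ∃ (P : Matrix (Fin (finrank ℂ (E0 n k)))
            (Fin (finrank ℂ (E0 n k))) (MvPolynomial (Fin (2 * n + 2)) ℂ)), ∀ v, v ≠ 0 → ∀ z w,
              D.mat.map (eval v) *ᵥ z = 0 → D'.mat.map (eval v) *ᵥ w = 0 →
                eval v q * φ.conePairing v z w = z ⬝ᵥ (P.map (eval v) *ᵥ w)}
          zero_mem' := ⟨0, by simp⟩
          add_mem' := by
            rintro p q ⟨P, hP⟩ ⟨Q, hQ⟩
            refine ⟨P + Q, fun v hv z w hz hw => ?_⟩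
            rw [map_add, add_mul, hP v hv z w hz hw, hQ v hv z w hz hw,
              Matrix.map_add _ (map_add _), Matrix.add_mulVec, dotProduct_add]
          smul_mem' := by
            rintro c p ⟨P, hP⟩
            refine ⟨c • P, fun v hv z w hz hw => ?_⟩
            rw [smul_eq_mul, map_mul, mul_assoc, hP v hv z w hz hw, map_smul_eval,
              Matrix.smul_mulVec, dotProduct_smul, smul_eq_mul] }
      obtain ⟨m, P, hP⟩ := exists_X_pow_mem I (fun v hv => by
        obtain ⟨q, P, hq, hP⟩ := φ.exists_conePairing_local hD hv
        exact ⟨q, ⟨P, hP⟩, hq⟩) j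
      exact ⟨m, P, by simpa using hP⟩)
  refine ⟨J n k ∘ₗ Matrix.toBilin (basisE n k) K, fun x z w => ?_⟩
  rw [LinearMap.comp_apply, omega_J, ← pairing_apply]
  induction x using Projectivization.ind with | _ v hv
  have h1 := hK v hv ((basisE n k).equivFun z) ((basisE n k).equivFun w)
    ((D.mem_kerAt_iff_mat hv).mp z.2) ((D'.mem_kerAt_iff_mat hv).mp w.2)
  rw [conePairing_apply φ hv (by rw [LinearEquiv.symm_apply_apply]; exact z.2)
    (by rw [LinearEquiv.symm_apply_apply]; exact w.2)] at h1
  simp only [LinearEquiv.symm_apply_apply, Subtype.coe_eta] at h1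
  rw [h1, Matrix.toBilin_apply]
  simp only [dotProduct, Matrix.mulVec, Finset.mul_sum, Basis.equivFun_apply, mul_assoc]

end SymplecticIso

/-- A constant bilinear form which vanishes on the fibres of both kernel bundles is zero. -/
theorem eq_zero_of_vanish_on_kerAt (hn : 1 ≤ n) (hD : D.DefinesMonad)
    (hD' : D'.DefinesMonad) {B : E0 n k →ₗ[ℂ] E0 n k →ₗ[ℂ] ℂ}
    (h : ∀ x, ∀ z ∈ D.kerAt x, ∀ w ∈ D'.kerAt x, B z w = 0) : B = 0 := by
  have hi : Function.Injective (Fin.castLE (show 4 ≤ 2 * n + 2 by omega)) :=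
    Fin.castLE_injective _
  have hB : ∀ z w, B ((basisE n k).equivFun.symm z) ((basisE n k).equivFun.symm w) =
      z ⬝ᵥ (LinearMap.BilinForm.toMatrix (basisE n k) B *ᵥ w) := by
    intro z w
    simp only [Basis.equivFun_symm_apply, map_sum, map_smul, LinearMap.sum_apply,
      LinearMap.smul_apply, smul_eq_mul, dotProduct, Matrix.mulVec, Finset.mul_sum,
      LinearMap.BilinForm.toMatrix_apply]
    rw [Finset.sum_comm]
    refine Finset.sum_congr rfl fun a _ => Finset.sum_congr rfl fun b _ => ?_
    ring
  have h0 := const_eq_zero_of_vanish hD.surjAwayFromZero hD'.surjAwayFromZero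
    D.isLinearMatrix_mat D'.isLinearMatrix_mat hi
    (K := LinearMap.BilinForm.toMatrix (basisE n k) B) (fun v hv z w hz hw => by
      rw [← hB]
      apply h (Projectivization.mk ℂ v hv)
      · rw [mem_kerAt_iff_mat]
        simpa [← Basis.equivFun_apply, -Basis.equivFun_symm_apply] using hz
      · rw [mem_kerAt_iff_mat]
        simpa [← Basis.equivFun_apply, -Basis.equivFun_symm_apply] using hw)
  exact (LinearMap.BilinForm.toMatrix (basisE n k)).map_eq_zero_iff.mp h0

end Pair


/-! ### Lifting φ to an isomorphism of monads -/

namespace Pair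

open Matrix

variable {n k : ℕ} {D D' : Pair n k}

theorem mem_kerAt_of_omega (D : Pair n k) {x : ℙ ℂ (V n)} {z : E0 n k}
    (h : ∀ w ∈ D.imAt x, omega n k z w = 0) : z ∈ D.kerAt x := by
  rw [mem_kerAt]
  intro a v hv
  rw [← omega_JA, omega_swap, h _ (Submodule.apply_mem_map₂ _ trivial hv), neg_zero]

/-- A functional vanishing on the kernel of A at v factors through A at v; after dualising, w is of
the form J A^*(a ⊗ v). Together with `mem_kerAt_of_omega`, the kernel and the image are each other's
symplectic orthogonals. -/
theorem mem_imAt_of_omega (D : Pair n k) {x : ℙ ℂ (V n)} {w : E0 n k}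
    (h : ∀ z ∈ D.kerAt x, omega n k w z = 0) : w ∈ D.imAt x := by
  induction x using Projectivization.ind with | _ v hv
  let T : E0 n k →ₗ[ℂ] Dual ℂ (S (k - 1)) := LinearMap.compRight ℂ (Dual.eval ℂ (V n) v) ∘ₗ D.A
  have hT : ∀ z a, T z a = D.A z a v := fun z a => rfl
  have h1 : omega n k w ∈ LinearMap.range T.dualMap := by
    rw [LinearMap.range_dualMap_eq_dualAnnihilator_ker, Submodule.mem_dualAnnihilator]
    intro z hz
    apply h
    rw [mem_kerAt_mk]
    intro a
    rw [← hT, LinearMap.mem_ker.mp hz]; rfl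
  obtain ⟨m, hm⟩ := h1
  have h2 : w = D.JA ((evalEquiv ℂ (S (k - 1))).symm m) v := by
    apply omega_nondeg
    intro y
    rw [omega_JA, ← hm, ← hT]
    simp
  rw [h2]
  refine Submodule.apply_mem_map₂ _ Submodule.mem_top ?_
  rw [Projectivization.submodule_mk]
  exact Submodule.mem_span_singleton_self v

/-- The linear map `Φ` of `E⁰` lifts the isomorphism `φ`. -/
def SymplecticIso.IsLift (φ : SymplecticIso D D') (Φ : E0 n k →ₗ[ℂ] E0 n k) : Prop :=
  ∀ x (z : D.kerAt x), ∃ h : Φ z ∈ D'.kerAt x, φ.toFun x (D.cls x z) = D'.cls x ⟨Φ z, h⟩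

/-- Φ represents the constant form of the pairing. Testing against the image, on which the pairing
vanishes, puts Φz in the kernel; testing against the kernel shows that Φz differs from a
representative of φ[z] by an element of the image. -/
theorem SymplecticIso.exists_isLift (φ : SymplecticIso D D') (hn : 1 ≤ n) (hD : D.DefinesMonad)
    (hD' : D'.DefinesMonad) : ∃ Φ, φ.IsLift Φ := by
  obtain ⟨Φ, hΦ⟩ := φ.exists_omega_eq_form hn hD hD'
  refine ⟨Φ, fun x z => ?_⟩
  have hker : Φ z ∈ D'.kerAt x := by
    apply mem_kerAt_of_omega
    intro w hw
    have h1 := hΦ x z ⟨w, D'.imAt_le_kerAt x hw⟩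
    have h2 : D'.cls x ⟨w, D'.imAt_le_kerAt x hw⟩ = 0 :=
      (Submodule.Quotient.mk_eq_zero _).mpr hw
    rw [h2, map_zero] at h1
    exact h1
  refine ⟨hker, ?_⟩
  obtain ⟨u, hu⟩ := Submodule.Quotient.mk_surjective _ (φ.toFun x (D.cls x z))
  rw [← hu, ← sub_eq_zero]
  change (Submodule.Quotient.mk (u - ⟨Φ z, hker⟩) : D'.Fibre x) = 0
  rw [Submodule.Quotient.mk_eq_zero]
  apply mem_imAt_of_omega
  intro w hw
  have h1 := hΦ x z ⟨w, hw⟩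
  rw [← hu] at h1
  change omega n k (u - Φ z) w = 0
  rw [map_sub, LinearMap.sub_apply, h1, sub_eq_zero]
  rfl

/-- The difference of the two forms vanishes on the kernel bundle since φ is symplectic, and a
constant form with this property is zero. -/
theorem SymplecticIso.IsLift.omega_eq {φ : SymplecticIso D D'} {Φ : E0 n k →ₗ[ℂ] E0 n k}
    (h : φ.IsLift Φ) (hn : 1 ≤ n) (hD : D.DefinesMonad) (z w : E0 n k) :
    omega n k (Φ z) (Φ w) = omega n k z w := by
  have h0 : (omega n k).compl₁₂ Φ Φ - omega n k = 0 := by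
    apply eq_zero_of_vanish_on_kerAt hn hD hD
    intro x z hz w hw
    obtain ⟨h1, h2⟩ := h x ⟨z, hz⟩
    obtain ⟨h3, h4⟩ := h x ⟨w, hw⟩
    have h5 := φ.symplectic x (D.cls x ⟨z, hz⟩) (D.cls x ⟨w, hw⟩)
    rw [h2, h4] at h5
    exact sub_eq_zero.mpr h5
  exact sub_eq_zero.mp (LinearMap.congr_fun (LinearMap.congr_fun h0 z) w)

theorem SymplecticIso.IsLift.unique {φ : SymplecticIso D D'} {Φ Φ' : E0 n k →ₗ[ℂ] E0 n k}
    (h : φ.IsLift Φ) (h' : φ.IsLift Φ') (hn : 1 ≤ n) (hD : D.DefinesMonad)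
    (hD' : D'.DefinesMonad) : Φ = Φ' := by
  have h0 : (omega n k) ∘ₗ (Φ - Φ') = 0 := by
    apply eq_zero_of_vanish_on_kerAt hn hD hD'
    intro x z hz w hw
    obtain ⟨h1, h2⟩ := h x ⟨z, hz⟩
    obtain ⟨h3, h4⟩ := h' x ⟨z, hz⟩
    rw [h2] at h4
    have h5 := (Submodule.Quotient.eq ((D'.imAt x).submoduleOf (D'.kerAt x))).mp h4
    exact D'.omega_im_ker h5 hw
  refine LinearMap.ext fun z => ?_
  rw [← sub_eq_zero]
  apply omega_nondeg
  intro y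
  simpa using LinearMap.congr_fun (LinearMap.congr_fun h0 z) y

/-- On fibres, A'Φ kills the kernel of A, so it is a constant matrix times A. The map ψ is the
transpose of the resulting right vertical map of the morphism of monads. -/
theorem exists_right_map {Φ : E0 n k →ₗ[ℂ] E0 n k} (hn : 1 ≤ n) (hD : D.DefinesMonad)
    (h : ∀ x, ∀ z ∈ D.kerAt x, Φ z ∈ D'.kerAt x) :
    ∃ ψ : S (k - 1) →ₗ[ℂ] S (k - 1), ∀ z a, D'.A (Φ z) a = D.A z (ψ a) := by
  let N := LinearMap.toMatrix (basisE n k) (basisE n k) Φ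
  let N' : Matrix _ _ (MvPolynomial (Fin (2 * n + 2)) ℂ) := N.map C
  let B := D'.mat * N'
  have hN' : ∀ v, N'.map (eval v) = N := fun v => by ext; simp [N']
  have hB : ∀ v, B.map (eval v) = D'.mat.map (eval v) * N := fun v => by
    rw [Matrix.map_mul, hN']
  have hBz : ∀ v z, B.map (eval v) *ᵥ (basisE n k).repr z =
      D'.mat.map (eval v) *ᵥ (basisE n k).repr (Φ z) := fun v z => by
    rw [hB, ← Matrix.mulVec_mulVec, LinearMap.toMatrix_mulVec_repr]
  obtain ⟨K, hK⟩ := exists_const_mul (B := B) (i := ⟨0, by omega⟩) (j := ⟨1, by omega⟩)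
    hD.surjAwayFromZero D.isLinearMatrix_mat
    (fun c v => by rw [hB, hB, D'.isLinearMatrix_mat, Matrix.smul_mul]) (by simp)
    (fun v hv z hz => by
      rw [← symm_mem_kerAt_iff D hv] at hz
      have h1 := h _ _ hz
      rw [mem_kerAt_iff_mat, ← hBz, ← Basis.equivFun_apply, LinearEquiv.apply_symm_apply] at h1
      exact h1)
  refine ⟨(basisS k).constr ℂ fun i => ∑ j, K i j • basisS k j, fun z a => ?_⟩
  have h2 : D'.A (Φ z) = D.A z ∘ₗ (basisS k).constr ℂ fun i => ∑ j, K i j • basisS k j := by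
    apply (basisS k).ext
    intro i
    refine LinearMap.ext fun v => ?_
    rw [← mat_mulVec, ← hBz, hK, ← Matrix.mulVec_mulVec, LinearMap.comp_apply, Basis.constr_basis]
    simp [Matrix.mulVec, dotProduct, ← mat_mulVec]
  rw [h2]; rfl

end Pair


/-! ### Monomial bases, factorisation and Hankel forms -/

section BinaryForms

/-- The exponent of the monomial `X₀^{p-i} X₁^i`. -/
noncomputable def expo (p i : ℕ) : Fin 2 →₀ ℕ := Finsupp.single 0 (p - i) + Finsupp.single 1 i

@[simp] theorem expo_zero (p i : ℕ) : expo p i 0 = p - i := by simp [expo]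

@[simp] theorem expo_one (p i : ℕ) : expo p i 1 = i := by simp [expo]

theorem degree_expo {p i : ℕ} (h : i ≤ p) : (expo p i).degree = p := by
  rw [Finsupp.degree_eq_sum, Fin.sum_univ_two, expo_zero, expo_one]
  omega

theorem eq_expo {p : ℕ} {d : Fin 2 →₀ ℕ} (h : d.degree = p) : d = expo p (d 1) := by
  rw [Finsupp.degree_eq_sum, Fin.sum_univ_two] at h
  ext i
  fin_cases i
  · simp only [Fin.zero_eta, expo_zero]; omega
  · simp

open Classical in
/-- The monomial `X₀^{p-i} X₁^i` as a binary form of degree `p`; it is zero for `i > p`. -/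
noncomputable def mono (p i : ℕ) : S p :=
  if h : i ≤ p then ⟨monomial (expo p i) 1, isHomogeneous_monomial _ (degree_expo h)⟩ else 0

theorem mono_poly_eq_monomial {p i : ℕ} (h : i ≤ p) : (mono p i).poly = monomial (expo p i) 1 :=
  congrArg S.poly (dif_pos h)

theorem mono_poly {p i : ℕ} (h : i ≤ p) :
    (mono p i).poly = (X 0 ^ (p - i) * X 1 ^ i : MvPolynomial (Fin 2) ℂ) := by
  rw [mono_poly_eq_monomial h, X_pow_eq_monomial, X_pow_eq_monomial, monomial_mul, one_mul, expo]

theorem coeff_mono {p i j : ℕ} (h : i ≤ p) :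
    coeff (expo p j) (mono p i).poly = if i = j then 1 else 0 := by
  rw [mono_poly_eq_monomial h, coeff_monomial]
  congr 1
  exact propext ⟨fun h => by simpa using DFunLike.congr_fun h 1, fun h => by rw [h]⟩

theorem S.eq_sum_mono {p : ℕ} (a : S p) :
    a = ∑ i : Fin (p + 1), coeff (expo p i) a.poly • mono p i := by
  apply S.ext
  ext d
  rw [map_sum, coeff_sum]
  by_cases hd : d.degree = p
  · rw [eq_expo hd]
    have h1 : d 1 ≤ p := by
      rw [Finsupp.degree_eq_sum, Fin.sum_univ_two] at hd
      omega
    rw [Finset.sum_eq_single (⟨d 1, by omega⟩ : Fin (p + 1))]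
    · rw [map_smul, coeff_smul, coeff_mono h1]; simp
    · intro i _ hi
      rw [map_smul, coeff_smul, coeff_mono (by omega), if_neg (fun h => hi (Fin.ext h))]; simp
    · simp
  · rw [a.isHomogeneous.coeff_eq_zero hd, Finset.sum_eq_zero]
    intro i _
    rw [map_smul, coeff_smul, (mono p i).isHomogeneous.coeff_eq_zero hd, smul_zero]

/-- The basis of monomials of the space of binary forms. -/
noncomputable def basisMono (p : ℕ) : Basis (Fin (p + 1)) ℂ (S p) :=
  Basis.ofEquivFun
    { toFun := fun a i => coeff (expo p i) a.poly
      map_add' := fun a b => by ext i; simp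
      map_smul' := fun c a => by ext i; simp
      invFun := fun c => ∑ i, c i • mono p i
      left_inv := fun a => a.eq_sum_mono.symm
      right_inv := fun c => by
        ext j
        change coeff (expo p j) (∑ i, c i • mono p i : S p).poly = c j
        rw [map_sum, coeff_sum, Finset.sum_eq_single j]
        · rw [map_smul, coeff_smul, coeff_mono (by omega)]; simp
        · intro i _ hi
          rw [map_smul, coeff_smul, coeff_mono (by omega), if_neg (fun h => hi (Fin.ext h))]; simp
        · simp }

theorem basisMono_apply (p : ℕ) (i : Fin (p + 1)) : basisMono p i = mono p i := by
  rw [basisMono, Basis.coe_ofEquivFun]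
  change ∑ j, (Function.update 0 i 1 : Fin (p + 1) → ℂ) j • mono p j = _
  rw [Finset.sum_eq_single i]
  · simp
  · intro j _ hj; simp [hj]
  · simp

theorem finrank_S (p : ℕ) : finrank ℂ (S p) = p + 1 := by
  rw [finrank_eq_card_basis (basisMono p), Fintype.card_fin]

theorem linearMap_ext_mono {p : ℕ} {M : Type*} [AddCommGroup M] [Module ℂ M] {l l' : S p →ₗ[ℂ] M}
    (h : ∀ i ≤ p, l (mono p i) = l' (mono p i)) : l = l' :=
  (basisMono p).ext fun i => by rw [basisMono_apply]; exact h i (by omega)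

theorem mulS_mono {p q r : ℕ} (e : p + q = r) {i j : ℕ} (hi : i ≤ p) (hj : j ≤ q) :
    mulS e (mono p i) (mono q j) = mono r (i + j) := by
  apply S.ext
  rw [mulS_poly, mono_poly hi, mono_poly hj, mono_poly (by omega),
    show r - (i + j) = (p - i) + (q - j) by omega]
  ring

theorem exists_mulS_mono_eq {p q r : ℕ} (e : p + q = r) {l : ℕ} (hl : l ≤ r) :
    ∃ i ≤ p, ∃ j ≤ q, i + j = l ∧ mulS e (mono p i) (mono q j) = mono r l := by
  refine ⟨min l p, min_le_right _ _, l - min l p, by omega, by omega, ?_⟩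
  rw [mulS_mono e (min_le_right _ _) (by omega)]
  congr 1
  omega

theorem linearMap_ext_mulS {p q r : ℕ} (e : p + q = r) {M : Type*} [AddCommGroup M] [Module ℂ M]
    {l l' : S r →ₗ[ℂ] M} (h : ∀ a b, l (mulS e a b) = l' (mulS e a b)) : l = l' :=
  linearMap_ext_mono fun i hi => by
    obtain ⟨_, _, _, _, _, h'⟩ := exists_mulS_mono_eq e hi
    rw [← h', h]

theorem S.poly_injective {p : ℕ} : Function.Injective (S.poly (p := p)) := fun _ _ => S.ext

theorem S.poly_ne_zero {p : ℕ} {a : S p} (h : a ≠ 0) : a.poly ≠ 0 :=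
  (map_ne_zero_iff _ S.poly_injective).mpr h

theorem mulS_injective {p q r : ℕ} (e : p + q = r) {a : S p} (h : a ≠ 0) :
    Function.Injective (mulS e a) := by
  rw [← LinearMap.ker_eq_bot, LinearMap.ker_eq_bot']
  intro b hb
  have h1 := congrArg S.poly hb
  rw [mulS_poly, map_zero] at h1
  exact S.ext ((mul_eq_zero.mp h1).resolve_left (S.poly_ne_zero h))

theorem mono_ne_zero {p i : ℕ} (h : i ≤ p) : mono p i ≠ 0 := by
  intro h0
  have := coeff_mono (p := p) (i := i) (j := i) h
  rw [h0] at this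
  simp at this

theorem exists_eval_eq_zero {p : ℕ} (s : S (p + 1)) :
    ∃ v : Fin 2 → ℂ, v ≠ 0 ∧ eval v s.poly = 0 := by
  by_cases h0 : coeff (expo (p + 1) 0) s.poly = 0
  · refine ⟨![1, 0], fun h => by simpa using congrFun h 0, ?_⟩
    rw [s.eq_sum_mono, map_sum, map_sum]
    refine Finset.sum_eq_zero fun i _ => ?_
    rw [map_smul, smul_eval, mono_poly (by omega)]
    by_cases hi : (i : ℕ) = 0
    · rw [hi, h0, zero_mul]
    · simp [hi]
  -- The dehomogenisation at X₁ = 1. Its leading coefficient is nonzero because (1, 0) is not a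
  -- root, so it has positive degree and a root.
  · let f : Polynomial ℂ := ∑ i : Fin (p + 2),
      Polynomial.C (coeff (expo (p + 1) i) s.poly) * Polynomial.X ^ (p + 1 - i)
    have hf : f.coeff (p + 1) ≠ 0 := by
      simp only [f, Polynomial.finsetSum_coeff, Polynomial.coeff_C_mul, Polynomial.coeff_X_pow]
      rw [Finset.sum_eq_single (0 : Fin (p + 2))]
      · simpa using h0
      · intro i _ hi
        have : (i : ℕ) ≠ 0 := fun h => hi (Fin.ext h)
        rw [if_neg (by omega), mul_zero]
      · simp
    obtain ⟨t, ht⟩ := IsAlgClosed.exists_root f (by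
      have := Polynomial.le_degree_of_ne_zero hf
      intro h
      rw [h] at this
      exact absurd this (by exact_mod_cast Nat.not_succ_le_zero p))
    refine ⟨![t, 1], fun h => by simpa using congrFun h 1, ?_⟩
    rw [s.eq_sum_mono, map_sum, map_sum, ← ht, Polynomial.eval_finsetSum]
    refine Finset.sum_congr rfl fun i _ => ?_
    rw [map_smul, smul_eval, mono_poly (by omega)]
    simp

theorem eval_subst (g : Matrix (Fin 2) (Fin 2) ℂ) (v : Fin 2 → ℂ) (a : MvPolynomial (Fin 2) ℂ) :
    eval v (subst g a) = eval (Matrix.vecMul v g) a := by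
  have : (eval v).comp (subst g : MvPolynomial (Fin 2) ℂ →+* MvPolynomial (Fin 2) ℂ) =
      eval (Matrix.vecMul v g) := by
    apply MvPolynomial.ringHom_ext
    · intro c; simp [subst]
    · intro j; simp [subst, Matrix.vecMul, dotProduct, mul_comm]
  exact RingHom.congr_fun this a

theorem exists_GL_row {v : Fin 2 → ℂ} (hv : v ≠ 0) :
    ∃ g : GL (Fin 2) ℂ, Matrix.vecMul ![1, 0] g.1 = v := by
  have key : ∀ M : Matrix (Fin 2) (Fin 2) ℂ, M.det ≠ 0 → M 0 0 = v 0 → M 0 1 = v 1 →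
      ∃ g : GL (Fin 2) ℂ, Matrix.vecMul ![1, 0] g.1 = v := by
    intro M hM h0 h1
    refine ⟨Matrix.GeneralLinearGroup.mkOfDetNeZero M hM, ?_⟩
    ext j
    fin_cases j
    · simp [Matrix.vecMul, dotProduct, Matrix.GeneralLinearGroup.mkOfDetNeZero, h0]
    · simp [Matrix.vecMul, dotProduct, Matrix.GeneralLinearGroup.mkOfDetNeZero, h1]
  by_cases h0 : v 0 = 0
  · have h1 : v 1 ≠ 0 := fun h1 => hv (by ext j; fin_cases j <;> simp [h0, h1])
    exact key !![v 0, v 1; 1, 0] (by simp [Matrix.det_fin_two, h1]) rfl rfl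
  · exact key !![v 0, v 1; 0, 1] (by simp [Matrix.det_fin_two, h0]) rfl rfl

/-- Every binary form of positive degree has a linear factor. -/
theorem exists_linear_factor {p : ℕ} (s : S (p + 1)) :
    ∃ (l : S 1) (b : S p), mulS (add_comm 1 p) l b = s := by
  obtain ⟨v, hv, hs⟩ := exists_eval_eq_zero s
  obtain ⟨g, hg⟩ := exists_GL_row hv
  -- The substitution moves the root to (1, 0); there the form has no X₀^{p+1} term and is visibly
  -- divisible by X₁.
  set s' := symS (p + 1) g s with hs'
  have h0 : coeff (expo (p + 1) 0) s'.poly = 0 := by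
    have h1 : eval ![1, 0] s'.poly = 0 := by rw [hs', symS_poly, eval_subst, hg, hs]
    rw [s'.eq_sum_mono, map_sum, map_sum, Finset.sum_eq_single (0 : Fin (p + 2))] at h1
    · rw [map_smul, smul_eval, mono_poly (by simp)] at h1
      simpa using h1
    · intro i _ hi
      have : (i : ℕ) ≠ 0 := fun h => hi (Fin.ext h)
      rw [map_smul, smul_eval, mono_poly (by omega)]
      simp [this]
    · simp
  have h2 : s' = mulS (add_comm 1 p) (mono 1 1)
      (∑ i : Fin (p + 1), coeff (expo (p + 1) (i + 1)) s'.poly • mono p i) := by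
    conv_lhs => rw [s'.eq_sum_mono, Fin.sum_univ_succ]
    rw [Fin.val_zero, h0, zero_smul, zero_add, map_sum]
    refine Finset.sum_congr rfl fun i _ => ?_
    rw [map_smul, mulS_mono _ le_rfl (by omega), Fin.val_succ, add_comm 1]
  refine ⟨symS 1 g⁻¹ (mono 1 1), symS p g⁻¹
    (∑ i : Fin (p + 1), coeff (expo (p + 1) (i + 1)) s'.poly • mono p i), ?_⟩
  rw [← symS_mulS, ← h2, hs', symS_inv_self]

theorem exists_factor {p q r : ℕ} (e : p + q = r) (s : S r) :
    ∃ (a : S p) (b : S q), mulS e a b = s := by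
  induction p generalizing r with
  | zero =>
    obtain rfl : q = r := by omega
    refine ⟨mono 0 0, s, S.ext ?_⟩
    rw [mulS_poly, mono_poly le_rfl]
    simp
  | succ p ih =>
    obtain rfl : p + q + 1 = r := by omega
    obtain ⟨l, s', hs'⟩ := exists_linear_factor s
    obtain ⟨a, b, hab⟩ := ih rfl s'
    refine ⟨mulS (add_comm 1 p) l a, b, S.ext ?_⟩
    rw [← hs', ← hab]
    simp only [mulS_poly, mul_assoc]

/-- A bilinear form on `S^m U` with a Hankel matrix factors through the multiplication. -/
theorem exists_dual_of_hankel {m r : ℕ} (e : m + m = r) (κ : S m →ₗ[ℂ] S m →ₗ[ℂ] ℂ)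
    (h : ∀ i j, i < m → j < m → κ (mono m i) (mono m (j + 1)) = κ (mono m (i + 1)) (mono m j)) :
    ∃ u : Dual ℂ (S r), ∀ s s', κ s s' = u (mulS e s s') := by
  have h1 : ∀ c i j, i + c ≤ m → j + c ≤ m →
      κ (mono m i) (mono m (j + c)) = κ (mono m (i + c)) (mono m j) := by
    intro c
    induction c with
    | zero => intro i j _ _; rfl
    | succ c ih =>
      intro i j hi hj
      rw [← add_assoc, h i (j + c) (by omega) (by omega), ih (i + 1) j (by omega) (by omega),
        add_right_comm, add_assoc]
  have h2 : ∀ i j i' j', i ≤ m → j ≤ m → i' ≤ m → j' ≤ m → i + j = i' + j' →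
      κ (mono m i) (mono m j) = κ (mono m i') (mono m j') := by
    intro i j i' j' hi hj hi' hj' hij
    rcases le_total i i' with hle | hle
    · obtain ⟨c, rfl⟩ := Nat.exists_eq_add_of_le hle
      obtain rfl : j = j' + c := by omega
      exact h1 c i j' hi' hj
    · obtain ⟨c, rfl⟩ := Nat.exists_eq_add_of_le hle
      obtain rfl : j' = j + c := by omega
      exact (h1 c i' j hi hj').symm
  -- The index l is split as a sum of two indices at most m; by `h2` the value does not depend on
  -- the splitting.
  let u : Dual ℂ (S r) := (basisMono r).constr ℂ fun l =>
    κ (mono m (min (l : ℕ) m)) (mono m ((l : ℕ) - min (l : ℕ) m))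
  have hu : ∀ l, l ≤ r → u (mono r l) = κ (mono m (min l m)) (mono m (l - min l m)) := by
    intro l hl
    have := (basisMono r).constr_basis ℂ (fun l =>
      κ (mono m (min (l : ℕ) m)) (mono m ((l : ℕ) - min (l : ℕ) m)))
      ⟨l, by omega⟩
    rwa [basisMono_apply] at this
  refine ⟨u, fun s s' => ?_⟩
  have h3 : κ = (mulS e).compr₂ u := by
    refine linearMap_ext_mono fun i hi => linearMap_ext_mono fun j hj => ?_
    rw [LinearMap.compr₂_apply, mulS_mono e hi hj, hu _ (by omega)]
    exact h2 _ _ _ _ hi hj (min_le_right _ _) (by omega) (by omega)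
  rw [h3]; rfl

end BinaryForms


/-! ### Automorphisms of the multiplication of binary forms -/

section MulIso

/-- The sequence is geometric with ratio B/A in lowest terms, so A^p a_p = B^p a_0 forces A^p to
divide a_0, and c is the quotient. -/
theorem exists_eq_mul_pow {R : Type*} [CommRing R] [IsDomain R] [UniqueFactorizationMonoid R]
    {p : ℕ} {a : ℕ → R} {A B : R} (hAB : IsRelPrime A B) (hA : A ≠ 0)
    (h : ∀ i < p, A * a (i + 1) = B * a i) : ∃ c, ∀ i ≤ p, a i = c * (A ^ (p - i) * B ^ i) := by
  have h1 : ∀ i ≤ p, A ^ i * a i = B ^ i * a 0 := by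
    intro i
    induction i with
    | zero => intro _; simp
    | succ i ih =>
      intro hi
      rw [pow_succ, mul_assoc, h i (by omega), mul_left_comm, ih (by omega)]
      ring
  have h2 : A ^ p ∣ B ^ p * a 0 := ⟨a p, (h1 p le_rfl).symm⟩
  obtain ⟨c, hc⟩ := (hAB.pow : IsRelPrime (A ^ p) (B ^ p)).dvd_of_dvd_mul_left h2
  refine ⟨c, fun i hi => ?_⟩
  apply mul_left_cancel₀ (pow_ne_zero i hA)
  rw [h1 i hi, hc, ← pow_mul_pow_sub A hi]
  ring

theorem isHomogeneous_one_of_totalDegree {A : MvPolynomial (Fin 2) ℂ} (h : A.totalDegree ≤ 1)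
    (h0 : eval 0 A = 0) : A.IsHomogeneous 1 := by
  intro d hd
  have h1 := MvPolynomial.le_totalDegree (MvPolynomial.mem_support_iff.mpr hd)
  have h2 : d ≠ 0 := by
    rintro rfl
    apply hd
    rw [← MvPolynomial.constantCoeff_eq]
    simpa [MvPolynomial.constantCoeff] using h0
  have h3 : d.degree ≠ 0 := fun h => h2 ((Finsupp.degree_eq_zero_iff d).mp h)
  have h4 : d.degree ≤ 1 := by
    rw [Finsupp.degree_eq_sum]
    rw [Finsupp.sum_fintype _ _ (fun _ => rfl)] at h1
    omega
  have h5 : (Finsupp.weight 1) d = d.degree :=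
    (DFunLike.congr_fun Finsupp.degree_eq_weight_one d).symm
  rw [h5]
  omega

theorem exists_matrix_of_linear {A B : MvPolynomial (Fin 2) ℂ} (hA : A.IsHomogeneous 1)
    (hB : B.IsHomogeneous 1) : ∃ g : Matrix (Fin 2) (Fin 2) ℂ,
      subst g (X 0) = A ∧ subst g (X 1) = B := by
  have key : ∀ {L : MvPolynomial (Fin 2) ℂ}, L.IsHomogeneous 1 →
      ∃ c : Fin 2 → ℂ, ∑ i, C (c i) * X i = L := by
    intro L hL
    let s : S 1 := ⟨L, hL⟩
    refine ⟨![coeff (expo 1 0) L, coeff (expo 1 1) L], ?_⟩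
    have h1 : L = s.poly := rfl
    conv_rhs => rw [h1, s.eq_sum_mono, map_sum, Fin.sum_univ_two]
    rw [map_smul, map_smul, mono_poly (by simp), mono_poly (by simp), Fin.sum_univ_two,
      smul_eq_C_mul, smul_eq_C_mul]
    simp [← h1]
  obtain ⟨c, hc⟩ := key hA
  obtain ⟨d, hd⟩ := key hB
  refine ⟨Matrix.of fun i j => ![c, d] j i, ?_, ?_⟩
  · rw [← hc]; simp [subst]
  · rw [← hd]; simp [subst]

theorem eq_C_of_totalDegree {c : MvPolynomial (Fin 2) ℂ} (h : c.totalDegree = 0) :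
    ∃ γ : ℂ, c = C γ := ⟨_, totalDegree_eq_zero_iff_eq_C.mp h⟩

theorem totalDegree_pow_eq {L : MvPolynomial (Fin 2) ℂ} (hL : L ≠ 0) (m : ℕ) :
    (L ^ m).totalDegree = m * L.totalDegree := by
  induction m with
  | zero => simp
  | succ m ih =>
    rw [pow_succ, totalDegree_mul_of_isDomain (pow_ne_zero _ hL) hL, ih]
    ring

theorem poly_apply_mono_ne_zero {m : ℕ} {η : S m →ₗ[ℂ] S m} (hη : Function.Injective η) {i : ℕ}
    (hi : i ≤ m) : (η (mono m i)).poly ≠ 0 :=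
  S.poly_ne_zero ((map_ne_zero_iff _ hη).mpr (mono_ne_zero hi))

theorem apply_mono_independent {m : ℕ} {η : S m →ₗ[ℂ] S m} (hη : Function.Injective η) (hm : 1 ≤ m)
    (x y : ℂ) (hxy : x • (η (mono m 0)).poly + y • (η (mono m 1)).poly = 0) : x = 0 ∧ y = 0 := by
  have h1 : x • mono m 0 + y • mono m 1 = 0 := by
    apply hη
    apply S.ext
    simpa using hxy
  have h2 : ∀ j, coeff (expo m j) (x • mono m 0 + y • mono m 1).poly = 0 := fun j => by
    rw [h1]; simp
  have h3 := h2 0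
  have h4 := h2 1
  simp only [map_add, map_smul, coeff_add, coeff_smul, coeff_mono (Nat.zero_le m),
    coeff_mono hm] at h3 h4
  constructor
  · simpa using h3
  · simpa using h4

theorem exists_GL_of_linear {A B : MvPolynomial (Fin 2) ℂ} (hA : A.IsHomogeneous 1)
    (hB : B.IsHomogeneous 1) (hAB : ∀ x y : ℂ, x • A + y • B = 0 → x = 0 ∧ y = 0) :
    ∃ g : GL (Fin 2) ℂ, subst g.1 (X 0) = A ∧ subst g.1 (X 1) = B := by
  obtain ⟨g, hg0, hg1⟩ := exists_matrix_of_linear hA hB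
  have hdet : g.det ≠ 0 := by
    intro h0
    obtain ⟨w, hw, hgw⟩ := Matrix.exists_mulVec_eq_zero_iff.mpr h0
    have h1 := hAB (w 0) (w 1) (by
      rw [← hg0, ← hg1]
      have e0 := congrFun hgw 0
      have e1 := congrFun hgw 1
      simp only [Matrix.mulVec, dotProduct, Fin.sum_univ_two, Pi.zero_apply] at e0 e1
      have e0' := congrArg (C : ℂ → MvPolynomial (Fin 2) ℂ) e0
      have e1' := congrArg (C : ℂ → MvPolynomial (Fin 2) ℂ) e1
      simp only [C_add, C_mul, C_0] at e0' e1'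
      simp only [subst, aeval_X, Fin.sum_univ_two, smul_eq_C_mul]
      linear_combination X 0 * e0' + X 1 * e1')
    exact hw (by ext j; fin_cases j <;> simp [h1])
  exact ⟨Matrix.GeneralLinearGroup.mkOfDetNeZero g hdet, hg0, hg1⟩

theorem eq_smul_symS {m : ℕ} {η : S m →ₗ[ℂ] S m} {A B : MvPolynomial (Fin 2) ℂ} {c : ℂ}
    {g : GL (Fin 2) ℂ} (hg0 : subst g.1 (X 0) = A) (hg1 : subst g.1 (X 1) = B)
    (h : ∀ i ≤ m, (η (mono m i)).poly = C c * (A ^ (m - i) * B ^ i)) (a : S m) :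
    η a = c • symS m g a := by
  refine LinearMap.congr_fun (f := η) (g := c • symS m g) (linearMap_ext_mono fun i hi => ?_) a
  apply S.ext
  rw [h i hi, LinearMap.smul_apply, map_smul, symS_poly, mono_poly hi, map_mul, map_pow,
    map_pow, hg0, hg1, smul_eq_C_mul]

/-- If `c A^p` and `c B^p` are nonzero binary forms of degree `p` and `A`, `B` are linearly
independent, then `A` and `B` are linear forms. -/
theorem isHomogeneous_one_of_mul_pow {p : ℕ} (hp : 1 ≤ p) {a₀ aₚ : S p} (h₀ : a₀.poly ≠ 0)
    (hₚ : aₚ.poly ≠ 0) {A B c : MvPolynomial (Fin 2) ℂ} (hA : a₀.poly = c * A ^ p)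
    (hB : aₚ.poly = c * B ^ p) (hAB : ∀ x y : ℂ, x • A + y • B = 0 → x = 0 ∧ y = 0) :
    A.IsHomogeneous 1 ∧ B.IsHomogeneous 1 := by
  have hc0 : c ≠ 0 := by rintro rfl; exact h₀ (by rw [hA, zero_mul])
  have hA0 : A ≠ 0 := by rintro rfl; exact h₀ (by rw [hA, zero_pow (by omega), mul_zero])
  have hB0 : B ≠ 0 := by rintro rfl; exact hₚ (by rw [hB, zero_pow (by omega), mul_zero])
  have hdeg : ∀ {a : S p} {L : MvPolynomial (Fin 2) ℂ}, a.poly ≠ 0 → L ≠ 0 → a.poly = c * L ^ p →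
      c.totalDegree + p * L.totalDegree = p := by
    intro a L ha hL haL
    have h1 := a.isHomogeneous.totalDegree ha
    rw [haL, totalDegree_mul_of_isDomain hc0 (pow_ne_zero _ hL),
      totalDegree_pow_eq hL] at h1
    exact h1
  -- From deg c + p·deg A = p the degree of A is 0 or 1, and B has the same degree. Degree 0 would
  -- make A and B proportional constants; in degree 1 the factor c is constant, and A, B have no
  -- constant term because the forms vanish at the origin.
  have dA := hdeg h₀ hA0 hA
  have dB := hdeg hₚ hB0 hB
  have hAd : A.totalDegree = B.totalDegree := Nat.eq_of_mul_eq_mul_left hp (by omega)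
  have hA1 : A.totalDegree ≤ 1 := by
    by_contra hcon
    have : p * 2 ≤ p * A.totalDegree := Nat.mul_le_mul_left _ (by omega)
    omega
  have hA1' : A.totalDegree ≠ 0 := by
    intro h0
    obtain ⟨α, rfl⟩ := eq_C_of_totalDegree h0
    obtain ⟨β, rfl⟩ := eq_C_of_totalDegree (hAd ▸ h0)
    have h2 := hAB β (-α) (by rw [smul_eq_C_mul, smul_eq_C_mul, C_neg]; ring)
    exact hB0 (by rw [h2.1, C_0])
  have hA2 : A.totalDegree = 1 := by omega
  obtain ⟨γ, rfl⟩ := eq_C_of_totalDegree (c := c) (by rw [hA2] at dA; omega)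
  have hγ : γ ≠ 0 := by rintro rfl; exact hc0 C_0
  have hev : ∀ a : S p, eval 0 a.poly = 0 := by
    intro a
    have h1 := eval_smul_of_isHomogeneous a.isHomogeneous (0 : ℂ) 0
    rw [zero_pow (by omega), zero_mul, smul_zero] at h1
    exact h1
  have hev' : ∀ {a : S p} {L : MvPolynomial (Fin 2) ℂ}, a.poly = C γ * L ^ p → eval 0 L = 0 := by
    intro a L h
    have h1 := hev a
    rw [h, map_mul, map_pow, eval_C] at h1
    exact eq_zero_of_pow_eq_zero ((mul_eq_zero.mp h1).resolve_left hγ)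
  exact ⟨isHomogeneous_one_of_totalDegree hA1 (hev' hA),
    isHomogeneous_one_of_totalDegree (hAd ▸ hA1) (hev' hB)⟩

theorem isConst_of_eq_mul_pow {q : ℕ} {b : S q} (hb : b.poly ≠ 0) {A d : MvPolynomial (Fin 2) ℂ}
    (hA : A.IsHomogeneous 1) (h : b.poly = d * A ^ q) : ∃ δ : ℂ, d = C δ := by
  apply eq_C_of_totalDegree
  have hd0 : d ≠ 0 := by rintro rfl; exact hb (by rw [h, zero_mul])
  have hA0 : A ^ q ≠ 0 := by intro h0; exact hb (by rw [h, h0, mul_zero])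
  have h1 := b.isHomogeneous.totalDegree hb
  have h2 := (hA.pow q).totalDegree hA0
  rw [h, totalDegree_mul_of_isDomain hd0 hA0, h2] at h1
  omega

/-- An automorphism of the multiplication of binary forms is induced by an element of `GL(U)`, up
to scalars. -/
theorem exists_GL_of_mulS {p q r : ℕ} (e : p + q = r) (hpq : 1 ≤ p ∧ 1 ≤ q ∨ p = 0 ∧ q = 1)
    {ψ : S p →ₗ[ℂ] S p} {θ : S q →ₗ[ℂ] S q} (hψ : Function.Injective ψ)
    (hθ : Function.Injective θ) (h : ∀ a b a' b', mulS e a b = mulS e a' b' →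
      mulS e (ψ a) (θ b) = mulS e (ψ a') (θ b')) :
    ∃ (g : GL (Fin 2) ℂ) (c d : ℂ), c ≠ 0 ∧ d ≠ 0 ∧ (∀ a, ψ a = c • symS p g a) ∧
      ∀ b, θ b = d • symS q g b := by
  have hconst : ∀ {m : ℕ} {η : S m →ₗ[ℂ] S m} (_ : Function.Injective η) {P : MvPolynomial (Fin 2) ℂ}
      {c : ℂ}, (η (mono m 0)).poly = C c * P → c ≠ 0 := by
    rintro m η hη P c h0 rfl
    exact poly_apply_mono_ne_zero hη (Nat.zero_le m) (by rw [h0, C_0, zero_mul])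
  have fin : ∀ {A B : MvPolynomial (Fin 2) ℂ} {c d : ℂ}, A.IsHomogeneous 1 → B.IsHomogeneous 1 →
      (∀ x y : ℂ, x • A + y • B = 0 → x = 0 ∧ y = 0) →
      (∀ i ≤ p, (ψ (mono p i)).poly = C c * (A ^ (p - i) * B ^ i)) →
      (∀ i ≤ q, (θ (mono q i)).poly = C d * (A ^ (q - i) * B ^ i)) →
      ∃ (g : GL (Fin 2) ℂ) (c d : ℂ), c ≠ 0 ∧ d ≠ 0 ∧ (∀ a, ψ a = c • symS p g a) ∧
        ∀ b, θ b = d • symS q g b := by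
    intro A B c d hA hB hAB hψA hθA
    obtain ⟨g, hg0, hg1⟩ := exists_GL_of_linear hA hB hAB
    exact ⟨g, c, d, hconst hψ (hψA 0 (Nat.zero_le p)), hconst hθ (hθA 0 (Nat.zero_le q)),
      eq_smul_symS hg0 hg1 hψA, eq_smul_symS hg0 hg1 hθA⟩
  rcases hpq with ⟨hp, hq⟩ | ⟨rfl, rfl⟩
  -- Hence the ratios of consecutive ψ(X₀^{p-i}X₁^i) and of consecutive θ(X₀^{q-j}X₁^j) all agree.
  -- Written as B/A in lowest terms, this ratio gives the images A and B of X₀ and X₁.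
  · have hcomm : ∀ i j, i < p → j < q →
        (ψ (mono p i)).poly * (θ (mono q (j + 1))).poly =
        (ψ (mono p (i + 1))).poly * (θ (mono q j)).poly := by
      intro i j hi hj
      have h1 := h (mono p i) (mono q (j + 1)) (mono p (i + 1)) (mono q j) (by
        rw [mulS_mono e hi.le hj, mulS_mono e hi hj.le]
        congr 1; omega)
      exact congrArg S.poly h1
    obtain ⟨A, B, c', hAB, hA, hB⟩ := UniqueFactorizationMonoid.exists_reduced_factors
      (ψ (mono p 0)).poly (poly_apply_mono_ne_zero hψ (Nat.zero_le p)) (ψ (mono p 1)).poly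
    have ha0 := poly_apply_mono_ne_zero hψ (Nat.zero_le p)
    have hc' : c' ≠ 0 := by rintro rfl; exact ha0 (by rw [← hA, zero_mul])
    have hA0 : A ≠ 0 := by rintro rfl; exact ha0 (by rw [← hA, mul_zero])
    have hθ1 : ∀ j < q, A * (θ (mono q (j + 1))).poly = B * (θ (mono q j)).poly := by
      intro j hj
      apply mul_left_cancel₀ hc'
      rw [← mul_assoc, ← mul_assoc, hA, hB]
      exact hcomm 0 j hp hj
    have hψ1 : ∀ i < p, A * (ψ (mono p (i + 1))).poly = B * (ψ (mono p i)).poly := by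
      intro i hi
      apply mul_right_cancel₀ (poly_apply_mono_ne_zero hθ (Nat.zero_le q))
      rw [mul_assoc, ← hcomm i 0 hi hq, mul_left_comm, hθ1 0 hq]
      ring
    obtain ⟨c, hc⟩ := exists_eq_mul_pow (a := fun i => (ψ (mono p i)).poly) hAB hA0 hψ1
    obtain ⟨d, hd⟩ := exists_eq_mul_pow (a := fun j => (θ (mono q j)).poly) hAB hA0 hθ1
    have hAB_ind : ∀ x y : ℂ, x • A + y • B = 0 → x = 0 ∧ y = 0 := by
      intro x y hxy
      apply apply_mono_independent hψ hp
      rw [← hA, ← hB, ← mul_smul_comm, ← mul_smul_comm, ← mul_add, hxy, mul_zero]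
    obtain ⟨hAh, hBh⟩ := isHomogeneous_one_of_mul_pow hp ha0 (poly_apply_mono_ne_zero hψ le_rfl)
      (by rw [hc 0 (Nat.zero_le p), pow_zero, mul_one, Nat.sub_zero])
      (by rw [hc p le_rfl, Nat.sub_self, pow_zero, one_mul]) hAB_ind
    obtain ⟨c₀, rfl⟩ := isConst_of_eq_mul_pow ha0 hAh
      (by rw [hc 0 (Nat.zero_le p), pow_zero, mul_one, Nat.sub_zero])
    obtain ⟨d₀, rfl⟩ := isConst_of_eq_mul_pow (poly_apply_mono_ne_zero hθ (Nat.zero_le q)) hAh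
      (by rw [hd 0 (Nat.zero_le q), pow_zero, mul_one, Nat.sub_zero])
    exact fin hAh hBh hAB_ind hc hd
  -- For p = 0 and q = 1 the multiplication imposes nothing: ψ is a scalar and θ is itself an
  -- element of GL(U).
  · obtain ⟨γ, hγ⟩ := eq_C_of_totalDegree (c := (ψ (mono 0 0)).poly)
      ((S.isHomogeneous _).totalDegree (poly_apply_mono_ne_zero hψ le_rfl))
    refine fin (A := (θ (mono 1 0)).poly) (B := (θ (mono 1 1)).poly) (c := γ) (d := 1)
      (S.isHomogeneous _) (S.isHomogeneous _) (apply_mono_independent hθ le_rfl) ?_ ?_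
    · intro i hi
      obtain rfl : i = 0 := by omega
      simpa using hγ
    · intro i hi
      interval_cases i <;> simp

/-- If `g` acts trivially on the binary forms of degree `m ≥ 1`, it is a scalar. -/
theorem eq_scalarGL_of_symS_eq {m : ℕ} (hm : 1 ≤ m) {g : GL (Fin 2) ℂ}
    (h : ∀ a : S m, symS m g a = a) : ∃ ρ : ℂˣ, (ρ : ℂ) ^ m = 1 ∧ g = scalarGL ρ := by
  -- Invariance of the monomials, evaluated at points. X₀^m at (0, 1) and X₁^m at (1, 0) kill the
  -- off-diagonal entries; X₀^m at (1, 0) and X₀^{m-1}X₁ at (1, 1) make the diagonal entries equal.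
  have key : ∀ i ≤ m, ∀ v : Fin 2 → ℂ, (v 0 * g.1 0 0 + v 1 * g.1 1 0) ^ (m - i) *
      (v 0 * g.1 0 1 + v 1 * g.1 1 1) ^ i = v 0 ^ (m - i) * v 1 ^ i := by
    intro i hi v
    have h1 := congrArg (fun a => eval v (S.poly a)) (h (mono m i))
    simp only [symS_poly, mono_poly hi, map_mul, map_pow] at h1
    simpa [subst, mul_comm] using h1
  have h10 : g.1 1 0 = 0 := by
    have := key 0 (by omega) ![0, 1]
    exact eq_zero_of_pow_eq_zero (n := m) (by simpa [zero_pow (by omega : m ≠ 0)] using this)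
  have h01 : g.1 0 1 = 0 := by
    have := key m le_rfl ![1, 0]
    exact eq_zero_of_pow_eq_zero (n := m) (by simpa [zero_pow (by omega : m ≠ 0)] using this)
  have h00 : g.1 0 0 ^ m = 1 := by
    have := key 0 (by omega) ![1, 0]
    simpa using this
  have h11 : g.1 0 0 ^ (m - 1) * g.1 1 1 = 1 := by
    have := key 1 hm ![1, 1]
    simpa [h10, h01] using this
  have h0 : g.1 0 0 ≠ 0 := by
    intro h0
    rw [h0, zero_pow (by omega)] at h00
    exact zero_ne_one h00
  have heq : g.1 1 1 = g.1 0 0 := by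
    apply mul_left_cancel₀ (pow_ne_zero (m - 1) h0)
    rw [h11, ← pow_succ, Nat.sub_add_cancel hm, h00]
  refine ⟨Units.mk0 _ h0, h00, ?_⟩
  apply Units.ext
  ext i j
  fin_cases i <;> fin_cases j <;> simp [scalarGL, h10, h01, heq]

end MulIso

/-! ### A dimension count on L_f -/

namespace Pair

variable {n k : ℕ}

/-- A binary form `s₀` such that all `h (a s₀)` vanish on `L_f` is zero. -/
theorem DefinesMonad.eq_zero_of_h_mulS {D : Pair n k} (hD : D.DefinesMonad) {s₀ : S (n + (k - 1))}
    (h : ∀ a v, (∀ χ, D.f χ v = 0) →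
      D.h (mulS (show k - 1 + (n + (k - 1)) = n + 2 * (k - 1) by omega) a s₀) v = 0) :
    s₀ = 0 := by
  by_contra hs
  obtain ⟨a, s₁, has⟩ := exists_factor (show k - 1 + n = n + (k - 1) by omega) s₀
  have ha : a ≠ 0 := by rintro rfl; exact hs (by rw [← has]; simp)
  have hs₁ : s₁ ≠ 0 := by rintro rfl; exact hs (by rw [← has]; simp)
  let N : Submodule ℂ (V n) := (LinearMap.range D.f).dualCoannihilator
  have hN : ∀ v, v ∈ N ↔ ∀ χ, D.f χ v = 0 := fun v => by
    rw [Submodule.mem_dualCoannihilator]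
    simp
  have hNr : finrank ℂ N = n + 1 := by
    have h1 := Subspace.finrank_add_finrank_dualCoannihilator_eq (LinearMap.range D.f)
    rw [LinearMap.finrank_range_of_inj hD.f_injective, Subspace.dual_finrank_eq, finrank_S,
      Module.finrank_fin_fun] at h1
    change n + 1 + finrank ℂ N = _ at h1
    omega
  let Y : Submodule ℂ (S (n + (k - 1))) :=
    LinearMap.range (mulS (show n + (k - 1) = n + (k - 1) from rfl) s₁)
  have hY : finrank ℂ Y.dualAnnihilator = n := by
    have h1 := Subspace.finrank_add_finrank_dualAnnihilator_eq Y
    rw [LinearMap.finrank_range_of_inj (mulS_injective _ hs₁), finrank_S, finrank_S] at h1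
    omega
  let Λ₀ : V n →ₗ[ℂ] Dual ℂ (S (n + (k - 1))) :=
    (D.h ∘ₗ mulS (show k - 1 + (n + (k - 1)) = n + 2 * (k - 1) by omega) a).flip
  have hΛ₀ : ∀ v s, Λ₀ v s =
      D.h (mulS (show k - 1 + (n + (k - 1)) = n + 2 * (k - 1) by omega) a s) v := fun _ _ => rfl
  -- N is the cone over L_f, of dimension n+1. For v in N the functional s ↦ h(as)(v) kills
  -- s₁·S^{k-1} U, since a·s₁·a' = a'·s₀. The annihilator of that space has dimension only n, so Λ
  -- has a nonzero kernel vector v.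
  let Λ : N →ₗ[ℂ] Y.dualAnnihilator := (Λ₀ ∘ₗ N.subtype).codRestrict _ (by
    intro v
    rw [Submodule.mem_dualAnnihilator]
    rintro _ ⟨a', rfl⟩
    rw [LinearMap.comp_apply, hΛ₀]
    rw [← h a' v ((hN v).mp v.2)]
    congr 2
    apply S.ext
    rw [← has]
    simp only [mulS_poly]
    ring)
  obtain ⟨v, hv, hv0⟩ := Submodule.exists_mem_ne_zero_of_ne_bot
    (LinearMap.ker_ne_bot_of_finrank_lt (f := Λ) (by rw [hNr, hY]; omega))
  have hv' : (v : V n) ≠ 0 := fun h0 => hv0 (Subtype.ext h0)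
  obtain ⟨l, hl⟩ : ∃ l : Dual ℂ (S (k - 1)), l a ≠ 0 := by
    by_contra! hcon
    exact ha ((Module.forall_dual_apply_eq_zero_iff ℂ a).mp hcon)
  -- At this v all of f and all h(as) vanish, so every element of the image of A is zero on a ≠ 0,
  -- against surjectivity.
  obtain ⟨z, hz⟩ := hD.exists_A_eq hv' l
  apply hl
  rw [← hz, A_apply, LinearMap.add_apply, (hN v).mp v.2, zero_add, ← hΛ₀]
  have := congrArg Subtype.val (LinearMap.mem_ker.mp hv)
  exact LinearMap.congr_fun this z.2

end Pair


/-! ### From isomorphisms of monads to elements of the group -/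

namespace Pair

variable {n k : ℕ} {D D' : Pair n k}

theorem range_f_eq (hL : D.L = D'.L) : LinearMap.range D.f = LinearMap.range D'.f := by
  have key : ∀ (D : Pair n k) (v : V n) (hv : v ≠ 0),
      v ∈ (LinearMap.range D.f).dualCoannihilator ↔ Projectivization.mk ℂ v hv ∈ D.L := by
    intro D v hv
    rw [Submodule.mem_dualCoannihilator]
    constructor
    · intro h ξ w hw
      rw [Projectivization.submodule_mk, Submodule.mem_span_singleton] at hw
      obtain ⟨c, rfl⟩ := hw
      rw [map_smul, h _ ⟨ξ, rfl⟩, smul_zero]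
    · rintro h _ ⟨ξ, rfl⟩
      exact h ξ v (by
        rw [Projectivization.submodule_mk]; exact Submodule.mem_span_singleton_self v)
  have h1 : (LinearMap.range D.f).dualCoannihilator = (LinearMap.range D'.f).dualCoannihilator := by
    ext v
    by_cases hv : v = 0
    · simp [hv]
    · rw [key D v hv, key D' v hv, hL]
  rw [← Subspace.dualCoannihilator_dualAnnihilator_eq (W := LinearMap.range D.f), h1,
    Subspace.dualCoannihilator_dualAnnihilator_eq]

theorem exists_transpose {M : Type*} [AddCommGroup M] [Module ℂ M] [Module.Finite ℂ M]
    {T : Dual ℂ M →ₗ[ℂ] Dual ℂ M} (hT : Function.Injective T) :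
    ∃ θ : M →ₗ[ℂ] M, Function.Injective θ ∧ ∀ χ b, T χ b = χ (θ b) := by
  let θ : M →ₗ[ℂ] M :=
    (evalEquiv ℂ M).symm.toLinearMap ∘ₗ T.dualMap ∘ₗ (evalEquiv ℂ M).toLinearMap
  have hθ : ∀ χ b, T χ b = χ (θ b) := fun χ b => by simp [θ]
  refine ⟨θ, ?_, hθ⟩
  rw [← LinearMap.ker_eq_bot, LinearMap.ker_eq_bot']
  intro b hb
  rw [← Module.forall_dual_apply_eq_zero_iff ℂ]
  intro χ
  obtain ⟨χ', rfl⟩ := LinearMap.surjective_of_injective hT χ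
  rw [hθ, hb, map_zero]

/-- The composite of f with the inverse of f' on the common range is an automorphism of (S^n U)^*,
hence a transpose by finite dimension. -/
theorem exists_theta (hf : Function.Injective D.f) (hf' : Function.Injective D'.f)
    (h : LinearMap.range D.f = LinearMap.range D'.f) :
    ∃ θ : S n →ₗ[ℂ] S n, Function.Injective θ ∧ ∀ χ, D.f χ = D'.f (χ ∘ₗ θ) := by
  let e := LinearEquiv.ofInjective D'.f hf'
  let T : Dual ℂ (S n) →ₗ[ℂ] Dual ℂ (S n) := e.symm.toLinearMap ∘ₗ
    D.f.codRestrict (LinearMap.range D'.f) (fun χ => h ▸ LinearMap.mem_range_self D.f χ)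
  have hT : ∀ χ, D'.f (T χ) = D.f χ := fun χ =>
    congrArg Subtype.val (e.apply_symm_apply (D.f.codRestrict (LinearMap.range D'.f) _ χ))
  obtain ⟨θ, hθ, hθT⟩ := exists_transpose (T := T) (fun χ χ' hχ => hf (by rw [← hT, hχ, hT]))
  refine ⟨θ, hθ, fun χ => ?_⟩
  rw [← hT]
  congr 1
  exact LinearMap.ext fun b => hθT χ b

theorem injective_of_omega {Φ : E0 n k →ₗ[ℂ] E0 n k}
    (h : ∀ z w, omega n k (Φ z) (Φ w) = omega n k z w) : Function.Injective Φ := by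
  intro z z' hz
  apply omega_nondeg
  intro y
  rw [← h, hz, h]

theorem injective_right_map (hD' : D'.DefinesMonad) {Φ : E0 n k →ₗ[ℂ] E0 n k}
    (h : Function.Injective Φ) {ψ : S (k - 1) →ₗ[ℂ] S (k - 1)}
    (hψ : ∀ z a, D'.A (Φ z) a = D.A z (ψ a)) : Function.Injective ψ := by
  rw [← LinearMap.ker_eq_bot, LinearMap.ker_eq_bot']
  intro a ha
  rw [← Module.forall_dual_apply_eq_zero_iff ℂ]
  intro l
  have hv : (Pi.single 0 1 : V n) ≠ 0 := by simp
  obtain ⟨z, hz⟩ := hD'.exists_A_eq hv l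
  obtain ⟨z', rfl⟩ := LinearMap.surjective_of_injective h z
  rw [← hz, hψ, ha, map_zero]; rfl

/-- A symplectic lift sends the Lagrangian `(S^{n+k-1} U)^*` to itself. -/
theorem snd_apply_inl (hD' : D'.DefinesMonad) {Φ : E0 n k →ₗ[ℂ] E0 n k}
    {ψ : S (k - 1) →ₗ[ℂ] S (k - 1)} (hψ : ∀ z a, D'.A (Φ z) a = D.A z (ψ a))
    {θ : S n →ₗ[ℂ] S n} (hθ : ∀ χ, D.f χ = D'.f (χ ∘ₗ θ)) (ξ : Dual ℂ (S (n + (k - 1)))) :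
    (Φ (ξ, 0)).2 = 0 := by
  -- By the right-hand square, h' of a times the component in question is a difference of values of
  -- f', so it vanishes on L_{f'}.
  apply hD'.eq_zero_of_h_mulS
  intro a v hv
  have h1 := LinearMap.congr_fun (hψ (ξ, 0) a) v
  rw [A_apply, A_apply, hθ] at h1
  simpa [hv] using h1

/-- With the second component zero, the right-hand square involves only f', which can be cancelled.
Consequently ψ(a)θ(b) depends only on the product ab. -/
theorem fst_apply_inl (hD' : D'.DefinesMonad) {Φ : E0 n k →ₗ[ℂ] E0 n k}
    {ψ : S (k - 1) →ₗ[ℂ] S (k - 1)} (hψ : ∀ z a, D'.A (Φ z) a = D.A z (ψ a))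
    {θ : S n →ₗ[ℂ] S n} (hθ : ∀ χ, D.f χ = D'.f (χ ∘ₗ θ)) (ξ : Dual ℂ (S (n + (k - 1))))
    (a : S (k - 1)) (b : S n) :
    (Φ (ξ, 0)).1 (mulS (show k - 1 + n = n + (k - 1) by omega) a b) =
      ξ (mulS (show k - 1 + n = n + (k - 1) by omega) (ψ a) (θ b)) := by
  have h1 := hψ (ξ, 0) a
  rw [A_apply, A_apply, hθ, snd_apply_inl hD' hψ hθ] at h1
  simp only [map_zero, add_zero] at h1
  exact LinearMap.congr_fun (hD'.f_injective h1) b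

/-- The scalars c and d are absorbed into g⁻¹ = ργ and t = c/ρ^p; the second equation then requires
ρ^{p+n} = cd. The choice of the root ρ is the ambiguity μ_{n+k-1} when p = k-1. -/
theorem exists_scaling {p n : ℕ} (hn : 1 ≤ n) {γ : GL (Fin 2) ℂ} {c d : ℂ} (hc : c ≠ 0)
    (hd : d ≠ 0) : ∃ (g : GL (Fin 2) ℂ) (t : ℂˣ),
      (∀ a, c • symS p γ a = (t : ℂ) • symS p g⁻¹ a) ∧
      (∀ b, d • symS n γ b = (t : ℂ)⁻¹ • symS n g⁻¹ b) := by
  obtain ⟨ρ, hρ⟩ := IsAlgClosed.exists_pow_nat_eq (c * d) (show 0 < p + n by omega)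
  have hρ0 : ρ ≠ 0 := by
    rintro rfl
    rw [zero_pow (by omega)] at hρ
    exact mul_ne_zero hc hd hρ.symm
  refine ⟨(scalarGL (Units.mk0 ρ hρ0) * γ)⁻¹, Units.mk0 (c / ρ ^ p)
    (div_ne_zero hc (pow_ne_zero _ hρ0)), fun a => ?_, fun b => ?_⟩
  · rw [inv_inv, symS_mul, symS_scalarGL, smul_smul]
    congr 1
    simp [hρ0]
  · rw [inv_inv, symS_mul, symS_scalarGL, smul_smul]
    congr 1
    rw [pow_add] at hρ
    simp only [Units.val_mk0, inv_div]
    field_simp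
    linear_combination -hρ

/-- A symplectic isomorphism of monads is given by an element of the group. -/
theorem exists_triple (hn : 1 ≤ n) (hnk : n = 1 ∨ 2 ≤ k) (hD : D.DefinesMonad)
    (hD' : D'.DefinesMonad) (hL : D.L = D'.L) {Φ : E0 n k →ₗ[ℂ] E0 n k}
    (hΦ : ∀ z w, omega n k (Φ z) (Φ w) = omega n k z w) {ψ : S (k - 1) →ₗ[ℂ] S (k - 1)}
    (hψ : ∀ z a, D'.A (Φ z) a = D.A z (ψ a)) :
    ∃ x : Triple n k, x • D = D' ∧ Triple.phi0 x = Φ := by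
  obtain ⟨θ, hθi, hθ⟩ := exists_theta hD.f_injective hD'.f_injective (range_f_eq hL)
  have hψi := injective_right_map hD' (injective_of_omega hΦ) hψ
  have hsnd := snd_apply_inl hD' hψ hθ
  have hfst := fst_apply_inl hD' hψ hθ
  obtain ⟨γ, c, d, hc, hd, hψγ, hθγ⟩ := exists_GL_of_mulS
    (show k - 1 + n = n + (k - 1) by omega) (by omega) hψi hθi (fun a b a' b' hab => by
      rw [← sub_eq_zero, ← Module.forall_dual_apply_eq_zero_iff ℂ]
      intro ξ
      rw [map_sub, ← hfst, ← hfst, hab, sub_self])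
  obtain ⟨g, t, hgψ, hgθ⟩ := exists_scaling (p := k - 1) (γ := γ) hn hc hd
  have ht : (t : ℂ) ≠ 0 := t.ne_zero
  have hψg : ∀ a, ψ a = (t : ℂ) • symS _ g⁻¹ a := fun a => by rw [hψγ, hgψ]
  have hθg : ∀ b, θ b = (t : ℂ)⁻¹ • symS _ g⁻¹ b := fun b => by rw [hθγ, hgθ]
  have hf : ∀ χ, D'.f χ = (t : ℂ) • D.f (χ ∘ₗ symS n g) := by
    intro χ
    rw [hθ, ← map_smul]
    congr 1
    refine LinearMap.ext fun b => ?_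
    rw [LinearMap.smul_apply, LinearMap.comp_apply, LinearMap.comp_apply, hθg, map_smul, map_smul,
      symS_self_inv, smul_smul, mul_inv_cancel₀ ht, one_smul]
  have hfst' : ∀ ξ, (Φ (ξ, 0)).1 = ξ ∘ₗ symS _ g⁻¹ := by
    intro ξ
    apply linearMap_ext_mulS (show k - 1 + n = n + (k - 1) by omega)
    intro a b
    rw [hfst, hψg, hθg, LinearMap.comp_apply, symS_mulS, map_smul, map_smul, map_smul,
      LinearMap.smul_apply, map_smul, smul_smul, inv_mul_cancel₀ ht, one_smul]
  have hsnd' : ∀ s, (Φ (0, s)).2 = symS _ g s := by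
    intro s
    rw [← sub_eq_zero, ← Module.forall_dual_apply_eq_zero_iff ℂ]
    intro ξ
    have h1 := hΦ (ξ ∘ₗ symS _ g, 0) (0, s)
    rw [omega_apply, omega_apply, hfst', hsnd] at h1
    have h2 : (ξ ∘ₗ symS _ g) ∘ₗ symS _ g⁻¹ = ξ := LinearMap.ext fun s => by simp
    rw [h2] at h1
    simpa [sub_eq_zero] using h1
  -- The off-diagonal block of Φ, with g composed into the second argument. It is symmetric because
  -- Φ is symplectic.
  let κ : S (n + (k - 1)) →ₗ[ℂ] S (n + (k - 1)) →ₗ[ℂ] ℂ :=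
    (LinearMap.fst ℂ _ _ ∘ₗ Φ ∘ₗ LinearMap.inr ℂ _ _).compl₂ (symS _ g)
  have hκ : ∀ s s', κ s s' = (Φ (0, s)).1 (symS _ g s') := fun _ _ => rfl
  have hκsymm : ∀ s s', κ s s' = κ s' s := by
    intro s s'
    have h1 := hΦ (0, s) (0, s')
    rw [omega_apply, omega_apply, hsnd', hsnd', ← hκ, ← hκ] at h1
    simpa [sub_eq_zero] using h1
  -- The right-hand square on elements (0, s). All other terms depend only on as, so by injectivity
  -- of f the functional b ↦ κ(s, ab) depends only on as.
  have hrel : ∀ (a : S (k - 1)) (s : S (n + (k - 1))),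
      (t : ℂ) • D.f (κ s ∘ₗ mulS (show k - 1 + n = n + (k - 1) by omega) a) +
        D'.h (symS _ g (mulS (show k - 1 + (n + (k - 1)) = n + 2 * (k - 1) by omega) a s)) =
      (t : ℂ) • D.h (mulS (show k - 1 + (n + (k - 1)) = n + 2 * (k - 1) by omega) a s) := by
    intro a s
    have h1 := hψ (0, s) (symS _ g a)
    rw [hψg, symS_inv_self, map_smul, A_apply, A_apply, hf, hsnd', ← symS_mulS] at h1
    have h2 : ((Φ (0, s)).1 ∘ₗ mulS (show k - 1 + n = n + (k - 1) by omega) (symS _ g a)) ∘ₗ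
        symS n g = κ s ∘ₗ mulS (show k - 1 + n = n + (k - 1) by omega) a := by
      refine LinearMap.ext fun b => ?_
      rw [LinearMap.comp_apply, LinearMap.comp_apply, ← symS_mulS]
      rfl
    rw [h2] at h1
    simpa using h1
  have hhank : ∀ i j, i < n + (k - 1) → j < n + (k - 1) →
      κ (mono _ i) (mono _ (j + 1)) = κ (mono _ (i + 1)) (mono _ j) := by
    intro i j hi hj
    -- A factor X₁/X₀ is moved from a to s with the product kept fixed, while b = X₀^{n-j'}X₁^{j'}
    -- with j' = min(j, n) takes up as much of j as possible. There is room for one more X₁ in a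
    -- exactly because k - 1 ≥ 1.
    by_cases hk1 : 2 ≤ k
    · have h1 := hrel (mono _ (j - min j n + 1)) (mono _ i)
      have h2 := hrel (mono _ (j - min j n)) (mono _ (i + 1))
      have h3 : mulS (show k - 1 + (n + (k - 1)) = n + 2 * (k - 1) by omega)
          (mono _ (j - min j n + 1)) (mono _ i) =
          mulS (show k - 1 + (n + (k - 1)) = n + 2 * (k - 1) by omega)
          (mono _ (j - min j n)) (mono _ (i + 1)) := by
        rw [mulS_mono _ (by omega) (by omega), mulS_mono _ (by omega) (by omega)]
        congr 1; omega
      rw [h3, ← h2] at h1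
      have h4 := hD.f_injective (smul_right_injective _ ht (add_right_cancel h1))
      have h5 := LinearMap.congr_fun h4 (mono n (min j n))
      rw [LinearMap.comp_apply, LinearMap.comp_apply, mulS_mono _ (by omega) (by omega),
        mulS_mono _ (by omega) (by omega)] at h5
      rwa [show j - min j n + 1 + min j n = j + 1 by omega,
        show j - min j n + min j n = j by omega] at h5
    -- Here n = 1 and k - 1 = 0, the matrix of κ is 2 × 2, and the Hankel condition is its symmetry.
    · obtain rfl : i = 0 := by omega
      obtain rfl : j = 0 := by omega
      exact hκsymm _ _
  obtain ⟨u, hu⟩ := exists_dual_of_hankel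
    (show n + (k - 1) + (n + (k - 1)) = 2 * n + 2 * (k - 1) by omega) κ hhank
  refine ⟨⟨g, t, u⟩, ?_, ?_⟩
  · ext1
    · refine LinearMap.ext fun χ => ?_
      rw [Triple.smul_f_apply, hf]
    · have h1 : ((⟨g, t, u⟩ : Triple n k) • D).h ∘ₗ symS _ g = D'.h ∘ₗ symS _ g := by
        apply linearMap_ext_mulS (show k - 1 + (n + (k - 1)) = n + 2 * (k - 1) by omega)
        intro a s
        rw [LinearMap.comp_apply, LinearMap.comp_apply, Triple.smul_h_apply,
          ← add_right_inj ((t : ℂ) • D.f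
            (κ s ∘ₗ mulS (show k - 1 + n = n + (k - 1) by omega) a)), hrel, ← smul_add,
          symS_inv_self]
        congr 1
        have h2 : κ s ∘ₗ mulS (show k - 1 + n = n + (k - 1) by omega) a =
            u ∘ₗ (mulS (show n + (n + 2 * (k - 1)) = 2 * n + 2 * (k - 1) by omega)).flip
              (mulS (show k - 1 + (n + (k - 1)) = n + 2 * (k - 1) by omega) a s) := by
          refine LinearMap.ext fun b => ?_
          rw [LinearMap.comp_apply, hu, LinearMap.comp_apply, LinearMap.flip_apply]
          congr 1
          apply S.ext
          simp only [mulS_poly]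
          ring
        rw [h2]
        abel
      refine LinearMap.ext fun x => ?_
      have h2 := LinearMap.congr_fun h1 (symS _ g⁻¹ x)
      simpa only [LinearMap.comp_apply, symS_self_inv] using h2
  · refine LinearMap.ext fun z => ?_
    have hz : Φ z = Φ (z.1, 0) + Φ (0, z.2) := by rw [← map_add]; simp
    refine Prod.ext (LinearMap.ext fun s => ?_) ?_
    · change ((⟨g, t, u⟩ : Triple n k).phi0Fun z).1 s = _
      rw [Triple.phi0Fun_fst, hz, Prod.fst_add, LinearMap.add_apply, hfst', ← hu, hκ,
        symS_self_inv]
      rfl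
    · change ((⟨g, t, u⟩ : Triple n k).phi0Fun z).2 = _
      rw [Triple.phi0Fun_snd, hz, Prod.snd_add, hsnd, hsnd', zero_add]

end Pair

/-! ### Triples that act trivially -/

namespace Triple

variable {n k : ℕ}

/-- The elements which act trivially on `E⁰` and fix some pair with `f` injective. -/
theorem mem_mu {x : Triple n k} {D : Pair n k} (hn : 1 ≤ n) (hf : Function.Injective D.f)
    (hx : phi0 x = 1) (hxD : x • D = D) : x ∈ mu n k := by
  have hphi : ∀ z, x.phi0Fun z = z := fun z => LinearMap.congr_fun hx z
  have hg : ∀ s, symS (n + (k - 1)) x.g s = s := fun s => by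
    rw [← phi0Fun_snd x (0, s), hphi]
  obtain ⟨ρ, hρ, hgρ⟩ := eq_scalarGL_of_symS_eq (show 1 ≤ n + (k - 1) by omega) hg
  have hg' : ∀ s, symS (n + (k - 1)) x.g⁻¹ s = s := fun s => by
    conv_lhs => rw [← hg s]
    exact symS_inv_self _ _ _
  have hu : x.u = 0 := by
    apply linearMap_ext_mulS
      (show n + (k - 1) + (n + (k - 1)) = 2 * n + 2 * (k - 1) by omega)
    intro s s'
    have h1 := phi0Fun_fst x (0, s) s'
    rw [hphi, hg'] at h1
    simpa using h1.symm
  -- The trivial action on E⁰ does not constrain t; it is fixed by the action on f, where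
  -- injectivity allows f to be cancelled.
  have ht : (x.t : ℂ) * (ρ : ℂ) ^ n = 1 := by
    obtain ⟨χ, hχ⟩ : ∃ χ : Dual ℂ (S n), χ (mono n 0) ≠ 0 := by
      by_contra! hcon
      exact mono_ne_zero (Nat.zero_le n) ((Module.forall_dual_apply_eq_zero_iff ℂ _).mp hcon)
    have h1 := LinearMap.congr_fun (congrArg Pair.f hxD) χ
    rw [smul_f_apply, ← map_smul] at h1
    have h2 := LinearMap.congr_fun (hf h1) (mono n 0)
    rw [LinearMap.smul_apply, LinearMap.comp_apply, hgρ, symS_scalarGL, map_smul, smul_smul,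
      smul_eq_mul] at h2
    exact mul_right_cancel₀ hχ (by rw [h2, one_mul])
  refine ⟨⟨ρ, (mem_rootsOfUnity _ _).mpr (Units.ext (by simpa using hρ))⟩, ?_⟩
  ext1
  · exact hgρ.symm
  · apply Units.ext
    change (((ρ⁻¹ ^ n : ℂˣ)) : ℂ) = x.t
    rw [inv_pow, Units.val_inv_eq_inv_val, Units.val_pow_eq_pow_val]
    exact inv_eq_of_mul_eq_one_left ht
  · exact hu.symm

end Triple

end RS

theorem proposition5p3 (n k : ℕ) (hn : 1 ≤ n) (hk : 1 ≤ k) (hnk : n = 1 ∨ 2 ≤ k)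
    (D D' : RS.Pair n k) (hD : D.DefinesMonad) (hD' : D'.DefinesMonad) (hL : D.L = D'.L)
    (φ : RS.Pair.SymplecticIso D D') :
    ∃! q : RS.G n k, ∃ hq : q • D = D',
      ∀ x, RS.G.induced hq x = (φ.toFun x).toLinearMap := by
  obtain ⟨Φ, hΦ⟩ := φ.exists_isLift hn hD hD'
  obtain ⟨ψ, hψ⟩ := RS.Pair.exists_right_map hn hD (fun x z hz => (hΦ x ⟨z, hz⟩).1)
  obtain ⟨y, hyD, hyΦ⟩ := RS.Pair.exists_triple hn hnk hD hD' hL (hΦ.omega_eq hn hD) hψ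
  refine ⟨QuotientGroup.mk y, ⟨hyD, fun x => ?_⟩, ?_⟩
  · refine LinearMap.ext fun ζ => ?_
    obtain ⟨z, rfl⟩ := Submodule.Quotient.mk_surjective _ ζ
    obtain ⟨h1, h2⟩ := hΦ x z
    subst hyΦ
    exact h2.symm
  · rintro q ⟨hq, hqφ⟩
    obtain ⟨w, rfl⟩ := QuotientGroup.mk_surjective q
    -- The middle map of any element inducing φ is a lift of φ, so uniqueness of lifts reduces the
    -- claim to triples with trivial middle map.
    have hlift : φ.IsLift (RS.Triple.phi0 w) := fun x z =>
      ⟨RS.G.phi0_mem_kerAt hq x z z.2, (LinearMap.congr_fun (hqφ x) (D.cls x z)).symm⟩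
    have heq : RS.Triple.phi0 w = RS.Triple.phi0 y := by
      rw [hyΦ]
      exact hlift.unique hΦ hn hD hD'
    symm
    rw [QuotientGroup.eq]
    apply RS.Triple.mem_mu hn hD.f_injective
    · rw [map_mul, heq, ← map_mul, inv_mul_cancel, map_one]
    · have hwD : w • D = D' := hq
      rw [mul_smul, hwD, ← hyD, inv_smul_smul]
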